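/- Let $\bar\Sigma=\Sigma\cup\{\varepsilon\}$. A weight function $w:\bar\Sigma^2\to\mathbb{R}_{\ge 0}$ is \emph{normalized} if $w(a,a)=0$ and $w(a,b)\ge 1$ for all distinct $a,b\in\bar\Sigma$ (the triangle inequality is not required). A forest over $\Sigma$ is identified with its Euler tour, a balanced string of parentheses labeled by $\Sigma$, in which each node contributes a matching pair of parentheses carrying its label. A \emph{forest alignment} of forests $F,G$ is a monotone path from $(0,0)$ to $(|F|,|G|)$ with steps $(1,0)$ (deleting a parenthesis of $F$), $(0,1)$ (inserting a parenthesis of $G$) and $(1,1)$ (aligning two parentheses) such that whenever $F[i]$ is aligned to $G[j]$, the parenthesis matching $F[i]$ is aligned to the parenthesis matching $G[j]$; its cost is half the sum of the weights $w(a,\varepsilon)$, $w(\varepsilon,b)$ and $w(a,b)$ of its deletions, insertions and aligned pairs, where $a$ and $b$ are the labels of the parentheses of $F$ and $G$ involved. The tree edit distance $\mathsf{ted}^w(F,G)$ is the minimum cost of a forest alignment of $F$ and $G$. There exists a deterministic algorithm (on a unit-cost random access machine with words of $O(\log n)$ bits that can also add, subtract, halve and compare real numbers) that, given two forests $F$ and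 $G$ with $n$ nodes in total, each with a label from an alphabet $\Sigma$, and oracle access to a normalized weight function $w:\bar\Sigma^2\to\mathbb{R}_{\ge 0}$, determines $k:=\mathsf{ted}^w(F,G)$ in $O(nk^2\log n)$ time; in the degenerate cases where this expression vanishes ($F=G$ or $n\le 1$), the time is $O(n+1)$. That is, the running time is at most $C\,(nk^2\log n+n+1)$ with an absolute constant $C$. -/

import Mathlib

universe u

namespace TED

/-! ## Forests as balanced strings of parentheses -/

/-- Parentheses with labels in `α`: `op a` is the opening and `cl a` the closing one. -/
inductive Paren (α : Type u) : Type u where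
  | op (a : α) : Paren α
  | cl (a : α) : Paren α

/-- The label of a parenthesis. -/
def Paren.label {α : Type u} : Paren α → α
  | .op a => a
  | .cl a => a

/-- Whether a parenthesis is an opening one. -/
def Paren.isOp {α : Type u} : Paren α → Bool
  | .op _ => true
  | .cl _ => false

/-- Forests over `α`: the smallest set of strings of parentheses that contains the empty string
and is closed under concatenation and under enclosing in a pair of matching parentheses. -/
inductive IsForest {α : Type u} : List (Paren α) → Prop where
  | nil : IsForest []
  | append {F G : List (Paren α)} : IsForest F → IsForest G → IsForest (F ++ G)
  | node {F : List (Paren α)} (a : α) : IsForest F → IsForest (Paren.op a :: (F ++ [Paren.cl a]))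

/-- The number of nodes of a forest, that is, of its opening parentheses. -/
def numNodes {α : Type u} (F : List (Paren α)) : ℕ := F.countP Paren.isOp

/-- `[i .. j]` is a node of `F`: `F[i]` is an opening parenthesis, `F[j]` is a closing one, and the
string strictly between them is balanced. -/
def IsNode {α : Type u} (F : List (Paren α)) (i j : ℕ) : Prop :=
  i < j ∧ (∃ a, F[i]? = some (Paren.op a)) ∧ (∃ b, F[j]? = some (Paren.cl b)) ∧
    IsForest ((F.drop (i + 1)).take (j - (i + 1)))

/-- The parentheses at positions `i` and `j` of `F` belong to the same node. -/
def IsMate {α : Type u} (F : List (Paren α)) (i j : ℕ) : Prop := IsNode F i j ∨ IsNode F j i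

/-! ## Weight functions, forest alignments, tree edit distance -/

/-- Weight functions on `α ∪ {ε}`, where `none` stands for the empty string `ε`. -/
abbrev Weight (α : Type u) : Type u := Option α → Option α → ℝ

/-- Normalized weight functions. (Together the two clauses make `w` non-negative.) -/
structure Normalized {α : Type u} (w : Weight α) : Prop where
  self : ∀ a, w a a = 0
  one_le : ∀ a b, a ≠ b → 1 ≤ w a b

/-- The edges of the alignment graph: from `(x, y)`, the move `del` leads to `(x + 1, y)`,
the move `ins` leads to `(x, y + 1)`, and the move `diag` leads to `(x + 1, y + 1)`. -/
inductive Move : Type where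
  | del : Move
  | ins : Move
  | diag : Move

/-- `IsPath x y x' y' A`: the path that starts in `(x, y)` and follows `A` ends in `(x', y')`. -/
def IsPath : ℕ → ℕ → ℕ → ℕ → List Move → Prop
  | x, y, x', y', [] => x = x' ∧ y = y'
  | x, y, x', y', .del :: A => IsPath (x + 1) y x' y' A
  | x, y, x', y', .ins :: A => IsPath x (y + 1) x' y' A
  | x, y, x', y', .diag :: A => IsPath (x + 1) (y + 1) x' y' A

/-- `Aligns x y A f g`: the path that starts in `(x, y)` and follows `A` contains the diagonal edge
`(f, g) → (f + 1, g + 1)`. -/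
def Aligns : ℕ → ℕ → List Move → ℕ → ℕ → Prop
  | _, _, [], _, _ => False
  | x, y, .del :: A, f, g => Aligns (x + 1) y A f g
  | x, y, .ins :: A, f, g => Aligns x (y + 1) A f g
  | x, y, .diag :: A, f, g => (f = x ∧ g = y) ∨ Aligns (x + 1) (y + 1) A f g

/-- The label of the parenthesis at position `i` of `F` (`none` past the end). -/
def labelAt {α : Type u} (F : List (Paren α)) (i : ℕ) : Option α := (F[i]?).map Paren.label

/-- The cost of the path that starts in `(x, y)` and follows `A`; the cost of every single
parenthesis edit is one half of the weight of the labels. -/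
noncomputable def cost {α : Type u} (w : Weight α) (F G : List (Paren α)) :
    ℕ → ℕ → List Move → ℝ
  | _, _, [] => 0
  | x, y, .del :: A => w (labelAt F x) none / 2 + cost w F G (x + 1) y A
  | x, y, .ins :: A => w none (labelAt G y) / 2 + cost w F G x (y + 1) A
  | x, y, .diag :: A => w (labelAt F x) (labelAt G y) / 2 + cost w F G (x + 1) (y + 1) A

/-- Forest alignments of `F` onto `G`: paths from `(0, 0)` to `(|F|, |G|)` that, whenever they align
two parentheses, also align their mates. -/
def IsForestAlignment {α : Type u} (F G : List (Paren α)) (A : List Move) : Prop :=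
  IsPath 0 0 F.length G.length A ∧
    ∀ f g f' g', Aligns 0 0 A f g → IsMate F f f' → IsMate G g g' → Aligns 0 0 A f' g'

/-- The costs of all forest alignments of `F` onto `G`. -/
def alignmentCosts {α : Type u} (w : Weight α) (F G : List (Paren α)) : Set ℝ :=
  {c | ∃ A, IsForestAlignment F G A ∧ c = cost w F G 0 0 A}

/-- The tree edit distance: the minimum cost of a forest alignment. -/
noncomputable def ted {α : Type u} (w : Weight α) (F G : List (Paren α)) : ℝ :=
  sInf (alignmentCosts w F G)

theorem IsPath.length_le : ∀ (A : List Move) (x y x' y' : ℕ), IsPath x y x' y' A →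
    A.length + x + y ≤ x' + y'
  | [], x, y, x', y', h => by
      obtain ⟨h1, h2⟩ := h
      simp [h1, h2]
  | .del :: A, x, y, x', y', h => by
      have := IsPath.length_le A (x + 1) y x' y' h
      simp only [List.length_cons]; omega
  | .ins :: A, x, y, x', y', h => by
      have := IsPath.length_le A x (y + 1) x' y' h
      simp only [List.length_cons]; omega
  | .diag :: A, x, y, x', y', h => by
      have := IsPath.length_le A (x + 1) (y + 1) x' y' h
      simp only [List.length_cons]; omega

theorem isPath_del_ins (b y : ℕ) : ∀ (a x : ℕ), IsPath x y (x + a) (y + b)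
    (List.replicate a .del ++ List.replicate b .ins)
  | 0, x => by
      induction b generalizing y with
      | zero => exact ⟨rfl, rfl⟩
      | succ b ih =>
          have := ih (y + 1)
          simp only [List.replicate_zero, List.nil_append] at this
          rw [show y + 1 + b = y + (b + 1) by omega] at this
          exact this
  | a + 1, x => by
      have := isPath_del_ins b y a (x + 1)
      rw [show x + 1 + a = x + (a + 1) by omega] at this
      exact this

theorem not_aligns (f g : ℕ) : ∀ (A : List Move) (x y : ℕ), Move.diag ∉ A → ¬ Aligns x y A f g
  | [], _, _, _ => id
  | .del :: A, x, y, h => not_aligns f g A (x + 1) y (fun h' => h (List.mem_cons_of_mem _ h'))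
  | .ins :: A, x, y, h => not_aligns f g A x (y + 1) (fun h' => h (List.mem_cons_of_mem _ h'))
  | .diag :: _, _, _, h => (h List.mem_cons_self).elim

/-- The tree edit distance is an attained minimum. -/
theorem ted_isLeast {α : Type u} (w : Weight α) (F G : List (Paren α)) :
    IsLeast (alignmentCosts w F G) (ted w F G) := by
  have hfin : (alignmentCosts w F G).Finite := by
    have : Finite Move := by
      refine Finite.of_injective
        (fun m : Move => (match m with | .del => 0 | .ins => 1 | .diag => 2 : Fin 3)) ?_
      intro a b h
      cases a <;> cases b <;> simp_all
    refine ((List.finite_length_le Move (F.length + G.length)).image (cost w F G 0 0)).subset ?_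
    rintro c ⟨A, hA, rfl⟩
    refine ⟨A, ?_, rfl⟩
    have := IsPath.length_le A _ _ _ _ hA.1
    simpa using this
  have hne : (alignmentCosts w F G).Nonempty := by
    refine ⟨_, List.replicate F.length .del ++ List.replicate G.length .ins, ⟨?_, ?_⟩, rfl⟩
    · simpa using isPath_del_ins G.length 0 F.length 0
    · intro f g f' g' h
      exact absurd h (not_aligns f g _ 0 0 (by simp [List.mem_append, List.mem_replicate]))
  exact ⟨hne.csInf_mem hfin, fun c hc => csInf_le hfin.bddBelow hc⟩

/-! ## The machine model

A deterministic unit-cost random access machine with two kinds of memory cells: words, that is,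
natural numbers below a bound `M`, and real numbers. The program is a fixed finite command with
finitely many variables and arrays. The input parentheses are read-only. Labels are atomic: they can
only be passed to the oracle, which returns the weight of two labels (or of a label and `ε`) as a
real number. Real numbers can only be copied, added, subtracted, halved, and compared. An operation
on words whose result is `M` or more has no meaning: the machine is stuck. Every operation, memory
access, oracle query and branching has cost one. -/

/-- The input of the machine: two strings of parentheses and a weight oracle. -/
structure Input (α : Type u) : Type u where
  F : List (Paren α)
  G : List (Paren α)
  w : Weight α

/-- The read-write memory: word variables and word arrays, real variables and real arrays. -/
structure State : Type where
  nvar : ℕ → ℕ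
  narr : ℕ → ℕ → ℕ
  rvar : ℕ → ℝ
  rarr : ℕ → ℕ → ℝ

/-- Initially every memory cell holds zero. -/
def State.init : State := ⟨fun _ => 0, fun _ _ => 0, fun _ => 0, fun _ _ => 0⟩

/-- Word expressions. -/
inductive NExp : Type where
  | const (c : ℕ) : NExp
  | var (x : ℕ) : NExp
  | arr (a : ℕ) (i : NExp) : NExp
  | lenF : NExp
  | lenG : NExp
  | openF (i : NExp) : NExp
  | openG (i : NExp) : NExp
  | add (d e : NExp) : NExp
  | sub (d e : NExp) : NExp
  | mul (d e : NExp) : NExp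
  | div (d e : NExp) : NExp

/-- `1` if the parenthesis at position `i` is an opening one, `0` otherwise. -/
def openAt {α : Type u} (F : List (Paren α)) (i : ℕ) : ℕ :=
  match F[i]? with
  | some (.op _) => 1
  | _ => 0

/-- The value of a word expression (subtraction is truncated, division is rounded down). -/
def NExp.eval {α : Type u} (I : Input α) (s : State) : NExp → ℕ
  | .const c => c
  | .var x => s.nvar x
  | .arr a i => s.narr a (i.eval I s)
  | .lenF => I.F.length
  | .lenG => I.G.length
  | .openF i => openAt I.F (i.eval I s)
  | .openG i => openAt I.G (i.eval I s)
  | .add d e => d.eval I s + e.eval I s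
  | .sub d e => d.eval I s - e.eval I s
  | .mul d e => d.eval I s * e.eval I s
  | .div d e => d.eval I s / e.eval I s

/-- All values that occur in the evaluation of a word expression are below the bound `M`. -/
def NExp.Fits {α : Type u} (M : ℕ) (I : Input α) (s : State) : NExp → Prop
  | .const c => c < M
  | .var x => s.nvar x < M
  | .arr a i => i.Fits M I s ∧ s.narr a (i.eval I s) < M
  | .lenF => I.F.length < M
  | .lenG => I.G.length < M
  | .openF i => i.Fits M I s ∧ openAt I.F (i.eval I s) < M
  | .openG i => i.Fits M I s ∧ openAt I.G (i.eval I s) < M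
  | .add d e => d.Fits M I s ∧ e.Fits M I s ∧ d.eval I s + e.eval I s < M
  | .sub d e => d.Fits M I s ∧ e.Fits M I s
  | .mul d e => d.Fits M I s ∧ e.Fits M I s ∧ d.eval I s * e.eval I s < M
  | .div d e => d.Fits M I s ∧ e.Fits M I s

/-- The number of operations in a word expression. -/
def NExp.time : NExp → ℕ
  | .const _ => 1
  | .var _ => 1
  | .arr _ i => i.time + 1
  | .lenF => 1
  | .lenG => 1
  | .openF i => i.time + 1
  | .openG i => i.time + 1
  | .add d e => d.time + e.time + 1
  | .sub d e => d.time + e.time + 1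
  | .mul d e => d.time + e.time + 1
  | .div d e => d.time + e.time + 1

/-- Arguments of the oracle: `ε` or the label of an input parenthesis. -/
inductive LExp : Type where
  | eps : LExp
  | labF (i : NExp) : LExp
  | labG (i : NExp) : LExp

/-- The value of an oracle argument (`ε` past the end of the input). -/
def LExp.eval {α : Type u} (I : Input α) (s : State) : LExp → Option α
  | .eps => none
  | .labF i => labelAt I.F (i.eval I s)
  | .labG i => labelAt I.G (i.eval I s)

/-- All words that occur in the evaluation are below the bound `M`. -/
def LExp.Fits {α : Type u} (M : ℕ) (I : Input α) (s : State) : LExp → Prop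
  | .eps => True
  | .labF i => i.Fits M I s
  | .labG i => i.Fits M I s

/-- The number of operations in an oracle argument. -/
def LExp.time : LExp → ℕ
  | .eps => 1
  | .labF i => i.time + 1
  | .labG i => i.time + 1

/-- Real expressions; `weight p q` is an oracle query. -/
inductive RExp : Type where
  | zero : RExp
  | one : RExp
  | var (x : ℕ) : RExp
  | arr (a : ℕ) (i : NExp) : RExp
  | weight (p q : LExp) : RExp
  | add (d e : RExp) : RExp
  | sub (d e : RExp) : RExp
  | half (d : RExp) : RExp

/-- The value of a real expression. -/
noncomputable def RExp.eval {α : Type u} (I : Input α) (s : State) : RExp → ℝ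
  | .zero => 0
  | .one => 1
  | .var x => s.rvar x
  | .arr a i => s.rarr a (i.eval I s)
  | .weight p q => I.w (p.eval I s) (q.eval I s)
  | .add d e => d.eval I s + e.eval I s
  | .sub d e => d.eval I s - e.eval I s
  | .half d => d.eval I s / 2

/-- All words that occur in the evaluation are below the bound `M`. -/
def RExp.Fits {α : Type u} (M : ℕ) (I : Input α) (s : State) : RExp → Prop
  | .zero => True
  | .one => True
  | .var _ => True
  | .arr _ i => i.Fits M I s
  | .weight p q => p.Fits M I s ∧ q.Fits M I s
  | .add d e => d.Fits M I s ∧ e.Fits M I s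
  | .sub d e => d.Fits M I s ∧ e.Fits M I s
  | .half d => d.Fits M I s

/-- The number of operations in a real expression. -/
def RExp.time : RExp → ℕ
  | .zero => 1
  | .one => 1
  | .var _ => 1
  | .arr _ i => i.time + 1
  | .weight p q => p.time + q.time + 1
  | .add d e => d.time + e.time + 1
  | .sub d e => d.time + e.time + 1
  | .half d => d.time + 1

/-- Conditions: comparisons of words and of reals, and Boolean combinations. -/
inductive BExp : Type where
  | ltN (d e : NExp) : BExp
  | eqN (d e : NExp) : BExp
  | leR (d e : RExp) : BExp
  | not (b : BExp) : BExp
  | and (b c : BExp) : BExp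
  | or (b c : BExp) : BExp

/-- The condition is true. -/
def BExp.Holds {α : Type u} (I : Input α) (s : State) : BExp → Prop
  | .ltN d e => d.eval I s < e.eval I s
  | .eqN d e => d.eval I s = e.eval I s
  | .leR d e => d.eval I s ≤ e.eval I s
  | .not b => ¬ b.Holds I s
  | .and b c => b.Holds I s ∧ c.Holds I s
  | .or b c => b.Holds I s ∨ c.Holds I s

/-- All words that occur in the evaluation are below the bound `M`. -/
def BExp.Fits {α : Type u} (M : ℕ) (I : Input α) (s : State) : BExp → Prop
  | .ltN d e => d.Fits M I s ∧ e.Fits M I s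
  | .eqN d e => d.Fits M I s ∧ e.Fits M I s
  | .leR d e => d.Fits M I s ∧ e.Fits M I s
  | .not b => b.Fits M I s
  | .and b c => b.Fits M I s ∧ c.Fits M I s
  | .or b c => b.Fits M I s ∧ c.Fits M I s

/-- The number of operations in a condition. -/
def BExp.time : BExp → ℕ
  | .ltN d e => d.time + e.time + 1
  | .eqN d e => d.time + e.time + 1
  | .leR d e => d.time + e.time + 1
  | .not b => b.time + 1
  | .and b c => b.time + c.time + 1
  | .or b c => b.time + c.time + 1

/-- Programs. -/
inductive Prog : Type where
  | skip : Prog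
  | setN (x : ℕ) (e : NExp) : Prog
  | setNArr (a : ℕ) (i e : NExp) : Prog
  | setR (x : ℕ) (e : RExp) : Prog
  | setRArr (a : ℕ) (i : NExp) (e : RExp) : Prog
  | seq (P Q : Prog) : Prog
  | ite (b : BExp) (P Q : Prog) : Prog
  | loop (b : BExp) (P : Prog) : Prog

/-- `Exec M I P s s' t`: on input `I`, with words below `M`, the program `P` started in memory
state `s` halts in memory state `s'` after `t` steps. The command `loop b P` repeats `P` while `b`
holds. -/
inductive Exec {α : Type u} (M : ℕ) (I : Input α) : Prog → State → State → ℕ → Prop where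
  | skip (s : State) : Exec M I .skip s s 1
  | setN (s : State) (x : ℕ) (e : NExp) : e.Fits M I s →
      Exec M I (.setN x e) s
        { s with nvar := Function.update s.nvar x (e.eval I s) } (e.time + 1)
  | setNArr (s : State) (a : ℕ) (i e : NExp) : i.Fits M I s → e.Fits M I s →
      Exec M I (.setNArr a i e) s
        { s with narr := Function.update s.narr a
                  (Function.update (s.narr a) (i.eval I s) (e.eval I s)) } (i.time + e.time + 1)
  | setR (s : State) (x : ℕ) (e : RExp) : e.Fits M I s →
      Exec M I (.setR x e) s
        { s with rvar := Function.update s.rvar x (e.eval I s) } (e.time + 1)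
  | setRArr (s : State) (a : ℕ) (i : NExp) (e : RExp) : i.Fits M I s → e.Fits M I s →
      Exec M I (.setRArr a i e) s
        { s with rarr := Function.update s.rarr a
                  (Function.update (s.rarr a) (i.eval I s) (e.eval I s)) } (i.time + e.time + 1)
  | seq {P Q : Prog} {s s' s'' : State} {t t' : ℕ} :
      Exec M I P s s' t → Exec M I Q s' s'' t' → Exec M I (.seq P Q) s s'' (t + t')
  | iteTrue {b : BExp} {P Q : Prog} {s s' : State} {t : ℕ} : b.Fits M I s → b.Holds I s →
      Exec M I P s s' t → Exec M I (.ite b P Q) s s' (b.time + 1 + t)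
  | iteFalse {b : BExp} {P Q : Prog} {s s' : State} {t : ℕ} : b.Fits M I s → ¬ b.Holds I s →
      Exec M I Q s s' t → Exec M I (.ite b P Q) s s' (b.time + 1 + t)
  | loopFalse {b : BExp} {P : Prog} {s : State} : b.Fits M I s → ¬ b.Holds I s →
      Exec M I (.loop b P) s s (b.time + 1)
  | loopTrue {b : BExp} {P : Prog} {s s' s'' : State} {t t' : ℕ} : b.Fits M I s → b.Holds I s →
      Exec M I P s s' t → Exec M I (.loop b P) s' s'' t' →
      Exec M I (.loop b P) s s'' (b.time + 1 + t + t')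

/-- The machine is deterministic. -/
theorem Exec.det {α : Type u} {M : ℕ} {I : Input α} {P : Prog} {s s₁ s₂ : State} {t₁ t₂ : ℕ}
    (h₁ : Exec M I P s s₁ t₁) (h₂ : Exec M I P s s₂ t₂) : s₁ = s₂ ∧ t₁ = t₂ := by
  induction h₁ generalizing s₂ t₂ with
  | skip | setN | setNArr | setR | setRArr => cases h₂; exact ⟨rfl, rfl⟩
  | seq _ _ ih ih' =>
      cases h₂ with
      | seq g g' =>
          obtain ⟨rfl, rfl⟩ := ih g
          obtain ⟨rfl, rfl⟩ := ih' g'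
          exact ⟨rfl, rfl⟩
  | iteTrue _ hb _ ih =>
      cases h₂ with
      | iteTrue _ _ g => obtain ⟨rfl, rfl⟩ := ih g; exact ⟨rfl, rfl⟩
      | iteFalse _ hb' _ => exact absurd hb hb'
  | iteFalse _ hb _ ih =>
      cases h₂ with
      | iteTrue _ hb' _ => exact absurd hb' hb
      | iteFalse _ _ g => obtain ⟨rfl, rfl⟩ := ih g; exact ⟨rfl, rfl⟩
  | loopFalse _ hb =>
      cases h₂ with
      | loopFalse => exact ⟨rfl, rfl⟩
      | loopTrue _ hb' _ _ => exact absurd hb' hb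
  | loopTrue _ hb _ _ ih ih' =>
      cases h₂ with
      | loopFalse _ hb' => exact absurd hb hb'
      | loopTrue _ _ g g' =>
          obtain ⟨rfl, rfl⟩ := ih g
          obtain ⟨rfl, rfl⟩ := ih' g'
          exact ⟨rfl, rfl⟩

end TED

namespace TED

/-! ## Paths -/

section Paths

variable {α : Type u} {w : Weight α} {F G : List (Paren α)}

/-! Every label differs from ε, so by normalization an insertion or deletion costs at least 1/2.
Hence an optimal alignment has at most 2k of them and stays within distance b of the main diagonal
as soon as b ≥ 2k (`Sandwich.eq_ted`). For fixed b, a dynamic program over pairs of substrings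
F[L..R), G[x..y) only needs the cells with |L - x| ≤ b and |R - y| ≤ b, so the row of a pair (L, R)
has O(b²) cells. The recurrences remove the leftmost or the rightmost parenthesis: it is deleted, or
a parenthesis of G is inserted, or the two are aligned; then their mates are aligned as well and the
problem splits there (`Sandwich.left`, `Sandwich.right`). A cell only has to satisfy `Sandwich`: its
value is attained by some alignment and is not beaten by an alignment inside the band. This is
weaker than optimality within the band, and lets each cell start from the value of deleting and
inserting everything.

The heart is a family of O(n log n) rows that is closed under the recurrences. For each power of two
h and each multiple p of h, a chain of substrings grows from the empty one at p, inside the window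
from p + 1 - h to p + h - 1: to the right unless F[R] is matched before L, otherwise to the left
unless F[L - 1] is matched at R or later. If both are blocked inside the window, F[L - 1] and F[R]
are mates and are added together (`ChainInv.mates`). A recurrence that splits at a node needs
another substring of the chain, which exists because one end stays fixed during a phase, and the
interior of the node. That node avoids p, hence all multiples of h, so its interior is known from
earlier scales (`LevelGood.light`). Conversely the chain of p covers the nodes around p in its
window, which are all that scale 2h needs in addition (`LevelGood.double`). As soon as h > |F|, the
chain of pivot 0 reaches F itself. A scale has O(n) rows, which gives the bound of `round_run`.

Since k is unknown, b doubles from 2 on. The computed value is at least k, so a value of at most b/2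
certifies itself, while a rejection implies b < 2k (`attempt_run`). Thus all b are at most 4k, and
the sum of their squares is geometric (`search_run`). The case k = 0 is recognized by comparing the
strings; otherwise k ≥ 1/2 (`half_le_ted_of_not_same`), so that b = 2 is affordable. -/

theorem isPath_append {B : List Move} {x' y' : ℕ} : ∀ {A : List Move} {x y : ℕ},
    IsPath x y x' y' (A ++ B) ↔ ∃ u v, IsPath x y u v A ∧ IsPath u v x' y' B
  | [], x, y => by simp [IsPath]
  | .del :: A, x, y => by simpa [IsPath] using isPath_append (A := A)
  | .ins :: A, x, y => by simpa [IsPath] using isPath_append (A := A)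
  | .diag :: A, x, y => by simpa [IsPath] using isPath_append (A := A)

theorem IsPath.append {A B : List Move} {x y u v x' y' : ℕ} (h : IsPath x y u v A)
    (h' : IsPath u v x' y' B) : IsPath x y x' y' (A ++ B) :=
  isPath_append.2 ⟨u, v, h, h'⟩

theorem IsPath.le {A : List Move} {x y x' y' : ℕ} (h : IsPath x y x' y' A) : x ≤ x' ∧ y ≤ y' := by
  induction A generalizing x y with
  | nil => exact ⟨h.1.le, h.2.le⟩
  | cons m A ih =>
      cases m with
      | del => have := ih (x := x + 1) (y := y) h; omega
      | ins => have := ih (x := x) (y := y + 1) h; omega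
      | diag => have := ih (x := x + 1) (y := y + 1) h; omega

theorem IsPath.cost_append {A : List Move} {x y u v : ℕ} (h : IsPath x y u v A) (B : List Move) :
    cost w F G x y (A ++ B) = cost w F G x y A + cost w F G u v B := by
  induction A generalizing x y with
  | nil => obtain ⟨rfl, rfl⟩ := h; simp [cost]
  | cons m A ih =>
      cases m with
      | del => simp [cost, ih (x := x + 1) (y := y) h]; ring
      | ins => simp [cost, ih (x := x) (y := y + 1) h]; ring
      | diag => simp [cost, ih (x := x + 1) (y := y + 1) h]; ring

theorem IsPath.aligns_append {A : List Move} {x y u v : ℕ} (h : IsPath x y u v A) {B : List Move}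
    {f g : ℕ} : Aligns x y (A ++ B) f g ↔ Aligns x y A f g ∨ Aligns u v B f g := by
  induction A generalizing x y with
  | nil => obtain ⟨rfl, rfl⟩ := h; simp [Aligns]
  | cons m A ih =>
      cases m with
      | del => simpa [Aligns] using ih (x := x + 1) (y := y) h
      | ins => simpa [Aligns] using ih (x := x) (y := y + 1) h
      | diag => simp [Aligns, ih (x := x + 1) (y := y + 1) h, or_assoc]

theorem IsPath.aligns_bounds {A : List Move} {x y x' y' f g : ℕ} (h : IsPath x y x' y' A)
    (ha : Aligns x y A f g) : (x ≤ f ∧ f < x') ∧ y ≤ g ∧ g < y' := by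
  induction A generalizing x y with
  | nil => exact ha.elim
  | cons m A ih =>
      cases m with
      | del => have := ih (x := x + 1) (y := y) h ha; omega
      | ins => have := ih (x := x) (y := y + 1) h ha; omega
      | diag =>
          have hle := IsPath.le (x := x + 1) (y := y + 1) h
          rcases ha with ⟨rfl, rfl⟩ | ha
          · omega
          · have := ih (x := x + 1) (y := y + 1) h ha; omega

theorem IsPath.split {A : List Move} {x y x' y' f g : ℕ} (h : IsPath x y x' y' A)
    (ha : Aligns x y A f g) : ∃ A₁ A₂, A = A₁ ++ .diag :: A₂ ∧ IsPath x y f g A₁ ∧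
      IsPath (f + 1) (g + 1) x' y' A₂ := by
  induction A generalizing x y with
  | nil => exact ha.elim
  | cons m A ih =>
      cases m with
      | del =>
          obtain ⟨A₁, A₂, rfl, h1, h2⟩ := ih (x := x + 1) (y := y) h ha
          exact ⟨.del :: A₁, A₂, rfl, h1, h2⟩
      | ins =>
          obtain ⟨A₁, A₂, rfl, h1, h2⟩ := ih (x := x) (y := y + 1) h ha
          exact ⟨.ins :: A₁, A₂, rfl, h1, h2⟩
      | diag =>
          rcases ha with ⟨rfl, rfl⟩ | ha
          · exact ⟨[], A, rfl, ⟨rfl, rfl⟩, h⟩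
          · obtain ⟨A₁, A₂, rfl, h1, h2⟩ := ih (x := x + 1) (y := y + 1) h ha
            exact ⟨.diag :: A₁, A₂, rfl, h1, h2⟩

/-- The point `(x, y)` has distance at most `b` from the main diagonal. -/
def Near (b x y : ℕ) : Prop := x ≤ y + b ∧ y ≤ x + b

/-- All vertices of the path stay within distance `b` of the main diagonal. -/
def InBand (b : ℕ) : ℕ → ℕ → List Move → Prop
  | x, y, [] => Near b x y
  | x, y, .del :: A => Near b x y ∧ InBand b (x + 1) y A
  | x, y, .ins :: A => Near b x y ∧ InBand b x (y + 1) A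
  | x, y, .diag :: A => Near b x y ∧ InBand b (x + 1) (y + 1) A

theorem InBand.start {b x y : ℕ} {A : List Move} (h : InBand b x y A) : Near b x y := by
  match A, h with
  | [], h => exact h
  | .del :: A, h => exact h.1
  | .ins :: A, h => exact h.1
  | .diag :: A, h => exact h.1

theorem IsPath.inBand_append {b : ℕ} {A B : List Move} {x y u v : ℕ} (h : IsPath x y u v A) :
    InBand b x y (A ++ B) ↔ InBand b x y A ∧ InBand b u v B := by
  induction A generalizing x y with
  | nil =>
      obtain ⟨rfl, rfl⟩ := h
      exact ⟨fun h => ⟨h.start, h⟩, fun h => h.2⟩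
  | cons m A ih =>
      cases m with
      | del => simp only [List.cons_append, InBand, ih (x := x + 1) (y := y) h, and_assoc]
      | ins => simp only [List.cons_append, InBand, ih (x := x) (y := y + 1) h, and_assoc]
      | diag => simp only [List.cons_append, InBand, ih (x := x + 1) (y := y + 1) h, and_assoc]

theorem IsPath.inBand_of_le {b : ℕ} {A : List Move} {x y x' y' : ℕ} (h : IsPath x y x' y' A)
    (hx : x' ≤ b) (hy : y' ≤ b) : InBand b x y A := by
  have hle := h.le
  induction A generalizing x y with
  | nil => exact ⟨by omega, by omega⟩
  | cons m A ih =>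
      cases m with
      | del =>
          have := IsPath.le (x := x + 1) (y := y) h
          exact ⟨⟨by omega, by omega⟩, ih h this⟩
      | ins =>
          have := IsPath.le (x := x) (y := y + 1) h
          exact ⟨⟨by omega, by omega⟩, ih h this⟩
      | diag =>
          have := IsPath.le (x := x + 1) (y := y + 1) h
          exact ⟨⟨by omega, by omega⟩, ih h this⟩

/-- The number of insertions and deletions of a path. -/
def numIndels : List Move → ℕ
  | [] => 0
  | .del :: A => numIndels A + 1
  | .ins :: A => numIndels A + 1
  | .diag :: A => numIndels A

/-- The offset x - y changes only at insertions and deletions, by one each, so the initial offset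
and the number of these edges control the whole path. -/
theorem IsPath.inBand_of_numIndels {b : ℕ} {A : List Move} {x y x' y' : ℕ}
    (h : IsPath x y x' y' A) (h1 : x + numIndels A ≤ y + b) (h2 : y + numIndels A ≤ x + b) :
    InBand b x y A := by
  induction A generalizing x y with
  | nil => exact ⟨h1, h2⟩
  | cons m A ih =>
      cases m with
      | del =>
          simp only [numIndels] at h1 h2
          exact ⟨⟨by omega, by omega⟩, ih h (by omega) (by omega)⟩
      | ins =>
          simp only [numIndels] at h1 h2
          exact ⟨⟨by omega, by omega⟩, ih h (by omega) (by omega)⟩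
      | diag =>
          simp only [numIndels] at h1 h2
          exact ⟨⟨by omega, by omega⟩, ih h (by omega) (by omega)⟩

theorem IsPath.near_end_of_numIndels {A : List Move} {x y x' y' : ℕ}
    (h : IsPath x y x' y' A) : x' + y ≤ x + y' + numIndels A ∧ x + y' ≤ x' + y + numIndels A := by
  induction A generalizing x y with
  | nil => obtain ⟨rfl, rfl⟩ := h; simp [numIndels]
  | cons m A ih =>
      cases m with
      | del => have := ih (x := x + 1) (y := y) h; simp only [numIndels]; omega
      | ins => have := ih (x := x) (y := y + 1) h; simp only [numIndels]; omega
      | diag => have := ih (x := x + 1) (y := y + 1) h; simp only [numIndels]; omega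

/-! ### Lower bounds from normalized weights -/

theorem Normalized.nonneg (hw : Normalized w) (a b : Option α) : 0 ≤ w a b := by
  by_cases h : a = b
  · rw [h, hw.self]
  · linarith [hw.one_le a b h]

theorem labelAt_ne_none {x : ℕ} (h : x < F.length) : labelAt F x ≠ none := by
  simp [labelAt, h]

/-- Inside the strings no label is ε, so each insertion or deletion has weight at least 1 and costs
at least 1/2. This converts a bound on the cost into a width of the band. -/
theorem IsPath.numIndels_le_cost (hw : Normalized w) {A : List Move} {x y x' y' : ℕ}
    (h : IsPath x y x' y' A) (hx : x' ≤ F.length) (hy : y' ≤ G.length) :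
    (numIndels A : ℝ) / 2 ≤ cost w F G x y A := by
  induction A generalizing x y with
  | nil => simp [numIndels, cost]
  | cons m A ih =>
      cases m with
      | del =>
          have h1 := ih (x := x + 1) (y := y) h
          have h2 := IsPath.le (x := x + 1) (y := y) h
          have h3 := hw.one_le (labelAt F x) none (labelAt_ne_none (by omega))
          simp only [numIndels, cost, Nat.cast_add, Nat.cast_one]
          linarith
      | ins =>
          have h1 := ih (x := x) (y := y + 1) h
          have h2 := IsPath.le (x := x) (y := y + 1) h
          have h3 := hw.one_le none (labelAt G y) (labelAt_ne_none (by omega)).symm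
          simp only [numIndels, cost, Nat.cast_add, Nat.cast_one]
          linarith
      | diag =>
          have h1 := ih (x := x + 1) (y := y + 1) h
          have h3 := hw.nonneg (labelAt F x) (labelAt G y)
          simp only [numIndels, cost]
          linarith

theorem cost_nonneg (hw : Normalized w) (A : List Move) (x y : ℕ) : 0 ≤ cost w F G x y A := by
  induction A generalizing x y with
  | nil => simp [cost]
  | cons m A ih =>
      cases m with
      | del => exact add_nonneg (div_nonneg (hw.nonneg _ _) zero_le_two) (ih _ _)
      | ins => exact add_nonneg (div_nonneg (hw.nonneg _ _) zero_le_two) (ih _ _)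
      | diag => exact add_nonneg (div_nonneg (hw.nonneg _ _) zero_le_two) (ih _ _)

theorem Aligns.weight_le_cost (hw : Normalized w) {A : List Move} {x y f g : ℕ}
    (h : Aligns x y A f g) : w (labelAt F f) (labelAt G g) / 2 ≤ cost w F G x y A := by
  induction A generalizing x y with
  | nil => exact h.elim
  | cons m A ih =>
      cases m with
      | del =>
          have := hw.nonneg (labelAt F x) none
          have := ih (x := x + 1) (y := y) h
          simp only [cost]; linarith
      | ins =>
          have := hw.nonneg none (labelAt G y)
          have := ih (x := x) (y := y + 1) h
          simp only [cost]; linarith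
      | diag =>
          rcases h with ⟨rfl, rfl⟩ | h
          · have := cost_nonneg (F := F) (G := G) hw A (f + 1) (g + 1)
            simp only [cost]; linarith
          · have := hw.nonneg (labelAt F x) (labelAt G y)
            have := ih h
            simp only [cost]; linarith

/-! ### Purely diagonal paths, and paths without diagonal edges -/

theorem eq_replicate_diag {A : List Move} (h : numIndels A = 0) :
    A = List.replicate A.length .diag := by
  induction A with
  | nil => rfl
  | cons m A ih =>
      cases m with
      | del => simp [numIndels] at h
      | ins => simp [numIndels] at h
      | diag => rw [List.length_cons, List.replicate_succ, ← ih h]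

theorem isPath_replicate_diag (n x y : ℕ) :
    IsPath x y (x + n) (y + n) (List.replicate n .diag) := by
  induction n generalizing x y with
  | zero => exact ⟨rfl, rfl⟩
  | succ n ih =>
      have := ih (x + 1) (y + 1)
      rwa [show x + 1 + n = x + (n + 1) by omega, show y + 1 + n = y + (n + 1) by omega] at this

theorem aligns_replicate_diag (n x y f g : ℕ) :
    Aligns x y (List.replicate n .diag) f g ↔ ∃ i < n, f = x + i ∧ g = y + i := by
  induction n generalizing x y with
  | zero => simp [Aligns]
  | succ n ih =>
      simp only [List.replicate_succ, Aligns, ih]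
      constructor
      · rintro (⟨rfl, rfl⟩ | ⟨i, hi, rfl, rfl⟩)
        · exact ⟨0, by omega, rfl, rfl⟩
        · exact ⟨i + 1, by omega, by omega, by omega⟩
      · rintro ⟨i, hi, rfl, rfl⟩
        rcases i with _ | i
        · exact Or.inl ⟨rfl, rfl⟩
        · exact Or.inr ⟨i, by omega, by omega, by omega⟩

theorem cost_replicate_diag (n x y : ℕ)
    (h : ∀ i < n, w (labelAt F (x + i)) (labelAt G (y + i)) = 0) :
    cost w F G x y (List.replicate n .diag) = 0 := by
  induction n generalizing x y with
  | zero => rfl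
  | succ n ih =>
      have h0 := h 0 (by omega)
      simp only [Nat.add_zero] at h0
      rw [List.replicate_succ, cost, h0, ih]
      · simp
      · intro i hi
        have := h (i + 1) (by omega)
        rwa [show x + (i + 1) = x + 1 + i by omega, show y + (i + 1) = y + 1 + i by omega] at this

/-- Half the total weight of deleting the first `i` parentheses of `F`. -/
noncomputable def delSum (w : Weight α) (F : List (Paren α)) (i : ℕ) : ℝ :=
  ∑ j ∈ Finset.range i, w (labelAt F j) none / 2

/-- Half the total weight of inserting the first `i` parentheses of `G`. -/
noncomputable def insSum (w : Weight α) (G : List (Paren α)) (i : ℕ) : ℝ :=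
  ∑ j ∈ Finset.range i, w none (labelAt G j) / 2

/-- Only differences of prefix sums occur, so the machine evaluates this cost in constant time after
linear preprocessing. -/
theorem cost_del_ins (a b x y : ℕ) :
    cost w F G x y (List.replicate a .del ++ List.replicate b .ins) =
      delSum w F (x + a) - delSum w F x + (insSum w G (y + b) - insSum w G y) := by
  induction a generalizing x with
  | zero =>
      induction b generalizing y with
      | zero => simp [cost]
      | succ b ih =>
          have := ih (y + 1)
          simp only [List.replicate_zero, List.nil_append, List.replicate_succ, cost] at this ⊢
          rw [this, show y + 1 + b = y + (b + 1) by omega]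
          simp only [insSum, Finset.sum_range_succ]
          ring
  | succ a ih =>
      simp only [List.replicate_succ, List.cons_append, cost]
      rw [ih (x + 1), show x + 1 + a = x + (a + 1) by omega]
      simp only [delSum, Finset.sum_range_succ]
      ring

end Paths

/-! ## Matching parentheses -/

section Mates

variable {α : Type u} {F : List (Paren α)}

/-- The contribution of a parenthesis to the nesting depth. -/
def Paren.sign : Paren α → ℤ
  | .op _ => 1
  | .cl _ => -1

/-- The nesting depth before position `i`. -/
def depth (F : List (Paren α)) (i : ℕ) : ℤ := ((F.take i).map Paren.sign).sum

/-- In the case of a node, the opening parenthesis lifts the inner depths by one, so the closing one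
cannot lead below zero. Uniqueness and nesting of mates rest on this. -/
theorem IsForest.depth {F : List (Paren α)} (h : IsForest F) :
    (F.map Paren.sign).sum = 0 ∧ ∀ i, 0 ≤ depth F i := by
  unfold TED.depth
  induction h with
  | nil => simp
  | append _ _ ih ih' =>
      refine ⟨by simp [ih.1, ih'.1], fun i => ?_⟩
      rw [List.take_append, List.map_append, List.sum_append]
      exact add_nonneg (ih.2 i) (ih'.2 _)
  | @node X a _ ih =>
      refine ⟨by simp [ih.1, Paren.sign], fun i => ?_⟩
      rcases i with _ | i
      · simp
      · rw [List.take_succ_cons, List.take_append, List.map_cons, List.map_append, List.sum_cons,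
          List.sum_append]
        have := ih.2 i
        generalize ((X.take i).map Paren.sign).sum = z at this ⊢
        rcases i - X.length with _ | j <;> simp [Paren.sign] <;> omega

theorem depth_add (F : List (Paren α)) (i j : ℕ) :
    depth F (i + j) = depth F i + depth (F.drop i) j := by
  simp [depth, List.take_add]

theorem depth_succ {i : ℕ} {p : Paren α} (h : F[i]? = some p) :
    depth F (i + 1) = depth F i + p.sign := by
  simp [depth, List.take_add_one, h]

theorem IsNode.lt {i j : ℕ} (h : IsNode F i j) : i < j ∧ j < F.length := by
  obtain ⟨h1, -, ⟨b, hb⟩, -⟩ := h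
  refine ⟨h1, ?_⟩
  by_contra hc
  rw [List.getElem?_eq_none (by omega)] at hb
  simp at hb

/-- The string between `i` and `j` is balanced, so its relative depth is nonnegative and ends at
zero: position `j + 1` is the first after `i` at which the depth is back to its value before `i`. -/
theorem IsNode.depth {i j : ℕ} (h : IsNode F i j) :
    TED.depth F (i + 1) = TED.depth F i + 1 ∧ TED.depth F j = TED.depth F i + 1 ∧
      TED.depth F (j + 1) = TED.depth F i ∧
      ∀ x, i < x → x ≤ j → TED.depth F i + 1 ≤ TED.depth F x := by
  obtain ⟨h1, ⟨a, ha⟩, ⟨b, hb⟩, hf⟩ := h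
  have e1 : TED.depth F (i + 1) = TED.depth F i + 1 := depth_succ ha
  have e2 : TED.depth F (j + 1) = TED.depth F j - 1 := depth_succ hb
  obtain ⟨d1, d2⟩ := hf.depth
  have key : ∀ x, i < x → x ≤ j → TED.depth F x = TED.depth F (i + 1) +
      TED.depth ((F.drop (i + 1)).take (j - (i + 1))) (x - (i + 1)) := by
    intro x hx hxj
    conv_lhs => rw [show x = (i + 1) + (x - (i + 1)) by omega]
    rw [depth_add]
    simp only [TED.depth, List.take_take]
    rw [min_eq_left (by omega)]
  have e3 : TED.depth F j = TED.depth F i + 1 := by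
    rw [key j h1 le_rfl, e1]
    have : TED.depth ((F.drop (i + 1)).take (j - (i + 1))) (j - (i + 1)) = 0 := by
      rw [TED.depth, List.take_take, min_self]; exact d1
    omega
  refine ⟨e1, e3, by omega, fun x hx hxj => ?_⟩
  rw [key x hx hxj, e1]
  have := d2 (x - (i + 1))
  omega

theorem IsNode.right_unique {i j j' : ℕ} (h : IsNode F i j) (h' : IsNode F i j') : j = j' := by
  obtain ⟨-, -, a, b⟩ := h.depth
  obtain ⟨-, -, a', b'⟩ := h'.depth
  have := h.lt
  have := h'.lt
  rcases lt_trichotomy j j' with hl | hl | hl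
  · have := b' (j + 1) (by omega) hl; omega
  · exact hl
  · have := b (j' + 1) (by omega) hl; omega

theorem IsNode.left_unique {i i' j : ℕ} (h : IsNode F i j) (h' : IsNode F i' j) : i = i' := by
  obtain ⟨-, -, a, b⟩ := h.depth
  obtain ⟨-, -, a', b'⟩ := h'.depth
  have := h.lt
  have := h'.lt
  rcases lt_trichotomy i i' with hl | hl | hl
  · have := b i' (by omega) (by omega); omega
  · exact hl
  · have := b' i (by omega) (by omega); omega

/-- If `j < j'`, then `j + 1` lies within the second node and is deeper than `i'`, which in turn is
deeper than `i`; but the depth at `j + 1` equals that at `i`. -/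
theorem IsNode.not_crossing {i j i' j' : ℕ} (h : IsNode F i j) (h' : IsNode F i' j')
    (h1 : i < i') (h2 : i' < j) : j' < j := by
  obtain ⟨-, -, a, b⟩ := h.depth
  obtain ⟨-, -, a', b'⟩ := h'.depth
  have := h'.lt
  rcases lt_trichotomy j j' with hl | hl | hl
  · have := b' (j + 1) (by omega) (by omega)
    have := b i' h1 h2.le
    omega
  · subst hl; exact absurd (h.left_unique h') (by omega)
  · exact hl

theorem IsNode.not_op_cl {i j k : ℕ} (h : IsNode F i j) (h' : IsNode F j k) : False := by
  obtain ⟨-, -, ⟨b, hb⟩, -⟩ := h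
  obtain ⟨-, ⟨a, ha⟩, -, -⟩ := h'
  simp [ha] at hb

theorem IsMate.symm {i j : ℕ} (h : IsMate F i j) : IsMate F j i := Or.symm h

theorem IsMate.unique {i j j' : ℕ} (h : IsMate F i j) (h' : IsMate F i j') : j = j' := by
  rcases h with h | h <;> rcases h' with h' | h'
  · exact h.right_unique h'
  · exact (h'.not_op_cl h).elim
  · exact (h.not_op_cl h').elim
  · exact h.left_unique h'

/-- A non-crossing perfect matching of the positions below `N`. -/
structure IsNest (N : ℕ) (μ : ℕ → ℕ) : Prop where
  lt : ∀ i < N, μ i < N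
  invol : ∀ i < N, μ (μ i) = i
  ne : ∀ i < N, μ i ≠ i
  nest : ∀ i < N, i < μ i → ∀ x, i < x → x < μ i → i < μ x ∧ μ x < μ i

/-- The recurrences and the chains use the forest structure only through this non-crossing
involution. -/
theorem isNest_of_isMate {μ : ℕ → ℕ} (h : ∀ i < F.length, IsMate F i (μ i)) :
    IsNest F.length μ := by
  have hlt : ∀ i < F.length, μ i < F.length := by
    intro i hi
    rcases h i hi with h | h
    · exact h.lt.2
    · exact h.lt.1.trans h.lt.2
  refine ⟨hlt, fun i hi => ((h _ (hlt i hi)).unique (h i hi).symm), fun i hi => ?_, ?_⟩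
  · rcases h i hi with h | h
    · exact h.lt.1.ne'
    · exact h.lt.1.ne
  · intro i hi hlt' x h1 h2
    have hn : IsNode F i (μ i) := by
      rcases h i hi with h | h
      · exact h
      · exact absurd h.lt.1 (by omega)
    rcases h x (by have := hn.lt; omega) with hx | hx
    · have := hx.lt
      exact ⟨by omega, hn.not_crossing hx h1 h2⟩
    · have := hx.lt
      refine ⟨?_, by omega⟩
      rcases lt_trichotomy (μ x) i with hl | hl | hl
      · have := hx.not_crossing hn hl h1; omega
      · rw [hl] at hx; exact absurd (hx.right_unique hn) (by omega)
      · exact hl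

theorem IsForest.length {F : List (Paren α)} (h : IsForest F) : F.length = 2 * numNodes F := by
  unfold numNodes
  induction h with
  | nil => rfl
  | append _ _ ih ih' => simp [ih, ih']; omega
  | node a _ ih => simp [ih, List.countP_cons, Paren.isOp]; omega

end Mates

/-! ## Alignments of substrings -/

section Valid

variable {α : Type u} {w : Weight α} {F G : List (Paren α)} {μ ν : ℕ → ℕ}

/-- The mates of aligned parentheses are aligned. -/
def MateClosed (μ ν : ℕ → ℕ) (x y : ℕ) (A : List Move) : Prop :=
  ∀ f g, Aligns x y A f g → Aligns x y A (μ f) (ν g)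

/-- Alignments of the substring `F[L .. R)` onto the substring `G[x .. y)`. -/
def Valid (μ ν : ℕ → ℕ) (L x R y : ℕ) (A : List Move) : Prop :=
  IsPath L x R y A ∧ MateClosed μ ν L x A

/-- Mates are unique, so the relational condition is closure under the functions `μ` and `ν`, whose
values the machine can store. -/
theorem isForestAlignment_iff (hμ : ∀ i < F.length, IsMate F i (μ i))
    (hν : ∀ i < G.length, IsMate G i (ν i)) (A : List Move) :
    IsForestAlignment F G A ↔ Valid μ ν 0 0 F.length G.length A := by
  refine and_congr_right fun hp => ⟨fun h f g ha => ?_, fun h f g f' g' ha hf hg => ?_⟩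
  · have := hp.aligns_bounds ha
    exact h f g _ _ ha (hμ f this.1.2) (hν g this.2.2)
  · have := hp.aligns_bounds ha
    rw [hf.unique (hμ f this.1.2), hg.unique (hν g this.2.2)]
    exact h f g ha

/-- `v` is the cost of an alignment of `F[L .. R)` onto `G[x .. y)`, and no such alignment within
the band is cheaper. -/
def Sandwich (w : Weight α) (F G : List (Paren α)) (μ ν : ℕ → ℕ) (b L x R y : ℕ) (v : ℝ) : Prop :=
  (∃ A, Valid μ ν L x R y A ∧ v = cost w F G L x A) ∧
    ∀ A, Valid μ ν L x R y A → InBand b L x A → v ≤ cost w F G L x A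

/-- By monotonicity, an aligned pair whose first coordinate lies in the range of the middle piece
must occur in that piece. Hence it suffices to control the mates in `F`; nothing is required of `ν`.
-/
theorem MateClosed.middle {x y u v u' v' x' y' : ℕ} {A₁ A₂ A₃ : List Move}
    (h : MateClosed μ ν x y (A₁ ++ (A₂ ++ A₃)))
    (h1 : IsPath x y u v A₁) (h2 : IsPath u v u' v' A₂) (h3 : IsPath u' v' x' y' A₃)
    (hr : ∀ f g, Aligns u v A₂ f g → u ≤ μ f ∧ μ f < u') : MateClosed μ ν u v A₂ := by
  intro f g ha
  have h' := h f g (h1.aligns_append.2 (Or.inr (h2.aligns_append.2 (Or.inl ha))))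
  have := hr f g ha
  rcases h1.aligns_append.1 h' with h' | h'
  · have := h1.aligns_bounds h'; omega
  · rcases h2.aligns_append.1 h' with h' | h'
    · exact h'
    · have := h3.aligns_bounds h'; omega

/-- The value of deleting all of `F[L .. R)` and inserting all of `G[x .. y)`. -/
noncomputable def indelCost (w : Weight α) (F G : List (Paren α)) (L x R y : ℕ) : ℝ :=
  delSum w F R - delSum w F L + (insSum w G y - insSum w G x)

theorem valid_del_ins {L x R y : ℕ} (hL : L ≤ R) (hx : x ≤ y) :
    ∃ A, Valid μ ν L x R y A ∧ indelCost w F G L x R y = cost w F G L x A := by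
  refine ⟨List.replicate (R - L) .del ++ List.replicate (y - x) .ins, ⟨?_, ?_⟩, ?_⟩
  · have := isPath_del_ins (y - x) x (R - L) L
    rwa [show L + (R - L) = R by omega, show x + (y - x) = y by omega] at this
  · intro f g h
    exact absurd h (not_aligns f g _ _ _ (by simp [List.mem_append, List.mem_replicate]))
  · rw [cost_del_ins, show L + (R - L) = R by omega, show x + (y - x) = y by omega, indelCost]

/-- A path over an empty piece of `F` consists of insertions only, so there is just one and the band
plays no role. -/
theorem Sandwich.base {b L x y : ℕ} (hx : x ≤ y) :
    Sandwich w F G μ ν b L x L y (indelCost w F G L x L y) := by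
  refine ⟨valid_del_ins le_rfl hx, fun A hA hb => le_of_eq ?_⟩
  have hp := hA.1
  clear hA hx hb
  induction A generalizing x with
  | nil => obtain ⟨-, rfl⟩ := hp; simp [indelCost, cost]
  | cons m A ih =>
      cases m with
      | del => have := IsPath.le (x := L + 1) (y := x) hp; omega
      | diag => have := IsPath.le (x := L + 1) (y := x + 1) hp; omega
      | ins =>
          rw [cost, ← ih (x := x + 1) hp]
          simp only [indelCost, insSum, Finset.sum_range_succ]
          ring

variable {NF NG : ℕ}

/-- The recurrence that removes the leftmost parenthesis. -/
theorem Sandwich.left (hμ : IsNest NF μ) (hν : IsNest NG ν) {b L x R y : ℕ} {v v₁ v₂ v₃ v₄ : ℝ}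
    (hLR : L < R) (hR : R ≤ NF) (hxy : x ≤ y) (hy : y ≤ NG)
    (h₁ : Near b (L + 1) x → Sandwich w F G μ ν b (L + 1) x R y v₁)
    (h₂ : x < y → Near b L (x + 1) → Sandwich w F G μ ν b L (x + 1) R y v₂)
    (h₃ : L < μ L → μ L < R → x < ν x → ν x < y → Near b (μ L) (ν x) →
      Sandwich w F G μ ν b (L + 1) (x + 1) (μ L) (ν x) v₃ ∧
      Sandwich w F G μ ν b (μ L + 1) (ν x + 1) R y v₄)
    (hv : v ≤ indelCost w F G L x R y)
    (hv₁ : Near b (L + 1) x → v ≤ w (labelAt F L) none / 2 + v₁)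
    (hv₂ : x < y ∧ Near b L (x + 1) → v ≤ w none (labelAt G x) / 2 + v₂)
    (hv₃ : x < y ∧ L < μ L ∧ μ L < R ∧ x < ν x ∧ ν x < y ∧ Near b (μ L) (ν x) →
      v ≤ w (labelAt F L) (labelAt G x) / 2 + w (labelAt F (μ L)) (labelAt G (ν x)) / 2 + (v₃ + v₄))
    (hex : v = indelCost w F G L x R y ∨
      (Near b (L + 1) x ∧ v = w (labelAt F L) none / 2 + v₁) ∨
      ((x < y ∧ Near b L (x + 1)) ∧ v = w none (labelAt G x) / 2 + v₂) ∨
      ((x < y ∧ L < μ L ∧ μ L < R ∧ x < ν x ∧ ν x < y ∧ Near b (μ L) (ν x)) ∧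
        v = w (labelAt F L) (labelAt G x) / 2 + w (labelAt F (μ L)) (labelAt G (ν x)) / 2 +
          (v₃ + v₄))) :
    Sandwich w F G μ ν b L x R y v := by
  constructor
  · rcases hex with h | ⟨hc, h⟩ | ⟨⟨hc, hc'⟩, h⟩ | ⟨⟨hc, c1, c2, c3, c4, c5⟩, h⟩
    · rw [h]; exact valid_del_ins hLR.le hxy
    · obtain ⟨A, ⟨hp, hm⟩, hA⟩ := (h₁ hc).1
      exact ⟨.del :: A, ⟨hp, hm⟩, by rw [h, hA, cost]⟩
    · obtain ⟨A, ⟨hp, hm⟩, hA⟩ := (h₂ hc hc').1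
      exact ⟨.ins :: A, ⟨hp, hm⟩, by rw [h, hA, cost]⟩
    · obtain ⟨⟨A, ⟨hp, hm⟩, hA⟩, -⟩ := (h₃ c1 c2 c3 c4 c5).1
      obtain ⟨⟨A', ⟨hp', hm'⟩, hA'⟩, -⟩ := (h₃ c1 c2 c3 c4 c5).2
      have hq : IsPath (μ L) (ν x) R y (.diag :: A') := hp'
      refine ⟨.diag :: (A ++ .diag :: A'), ⟨hp.append hq, ?_⟩, ?_⟩
      · rintro f g (⟨rfl, rfl⟩ | ha)
        · exact Or.inr (hp.aligns_append.2 (Or.inr (Or.inl ⟨rfl, rfl⟩)))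
        · rcases hp.aligns_append.1 ha with ha | ⟨rfl, rfl⟩ | ha
          · exact Or.inr (hp.aligns_append.2 (Or.inl (hm _ _ ha)))
          · rw [hμ.invol _ (by omega), hν.invol _ (by omega)]
            exact Or.inl ⟨rfl, rfl⟩
          · exact Or.inr (hp.aligns_append.2 (Or.inr (Or.inr (hm' _ _ ha))))
      · rw [h, cost, hp.cost_append, cost, hA, hA']; ring
  · rintro A ⟨hp, hm⟩ hb
    match A, hp, hm, hb with
    | [], hp, _, _ => exact absurd hp.1 (by omega)
    | .del :: A, hp, hm, hb =>
        have := (h₁ hb.2.start).2 A ⟨hp, hm⟩ hb.2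
        have := hv₁ hb.2.start
        rw [cost]; linarith
    | .ins :: A, hp, hm, hb =>
        have hl := IsPath.le (x := L) (y := x + 1) hp
        have := (h₂ (by omega) hb.2.start).2 A ⟨hp, hm⟩ hb.2
        have := hv₂ ⟨by omega, hb.2.start⟩
        rw [cost]; linarith
    | .diag :: A, hp, hm, hb =>
        have hp' : IsPath (L + 1) (x + 1) R y A := hp
        have hle := hp'.le
        -- The mates of the first aligned pair are aligned by a later edge, which cuts the path into
        -- the part inside the two nodes and the part behind them.
        rcases hm L x (Or.inl ⟨rfl, rfl⟩) with ⟨h, -⟩ | ha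
        · exact absurd h (hμ.ne L (by omega))
        · have hbd := hp'.aligns_bounds ha
          obtain ⟨A₁, A₂, rfl, h1, h2⟩ := hp'.split ha
          have h2' : IsPath (μ L) (ν x) R y (.diag :: A₂) := h2
          have hb1 := (h1.inBand_append.1 hb.2).1
          have hb2 : Near b (μ L) (ν x) ∧ InBand b (μ L + 1) (ν x + 1) A₂ :=
            (h1.inBand_append.1 hb.2).2
          have hd : IsPath L x (L + 1) (x + 1) [.diag] := ⟨rfl, rfl⟩
          have hd' : IsPath (μ L) (ν x) (μ L + 1) (ν x + 1) [.diag] := ⟨rfl, rfl⟩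
          have m1 : MateClosed μ ν (L + 1) (x + 1) A₁ := by
            refine MateClosed.middle (A₁ := [.diag]) hm hd h1 h2' fun f g haf => ?_
            have := h1.aligns_bounds haf
            have := hμ.nest L (by omega) (by omega) f (by omega) (by omega)
            omega
          have m2 : MateClosed μ ν (μ L + 1) (ν x + 1) A₂ := by
            refine MateClosed.middle (A₁ := .diag :: (A₁ ++ [.diag])) (A₃ := [])
              (x := L) (y := x) (by simpa using hm)
              (hd.append (h1.append hd')) h2 ⟨rfl, rfl⟩ fun f g haf => ?_
            have hbf := h2.aligns_bounds haf
            have hal := hm f g (Or.inr (h1.aligns_append.2 (Or.inr (Or.inr haf))))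
            have hbm := IsPath.aligns_bounds (A := .diag :: (A₁ ++ .diag :: A₂)) hp hal
            refine ⟨?_, hbm.1.2⟩
            -- Were the mate of `f` at or before `μ L`, it would be `L`, or `μ L`, or inside the
            -- node of `L`; then `f` would not lie behind `μ L`.
            by_contra hc
            have e1 := hμ.invol f (by omega)
            have e2 := hμ.invol L (by omega)
            rcases lt_trichotomy (μ f) L with hl | hl | hl
            · omega
            · rw [hl] at e1; omega
            · rcases lt_trichotomy (μ f) (μ L) with hl' | hl' | hl'
              · have := hμ.nest L (by omega) (by omega) (μ f) hl hl'; omega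
              · rw [hl', e2] at e1; omega
              · omega
          obtain ⟨s1, s2⟩ := h₃ (by omega) (by omega) (by omega) (by omega) hb2.1
          have c1 := s1.2 A₁ ⟨h1, m1⟩ hb1
          have c2 := s2.2 A₂ ⟨h2, m2⟩ hb2.2
          have := hv₃ ⟨by omega, by omega, by omega, by omega, by omega, hb2.1⟩
          rw [cost, h1.cost_append, cost]
          linarith

/-- The recurrence that removes the rightmost parenthesis. -/
theorem Sandwich.right (hμ : IsNest NF μ) (hν : IsNest NG ν) {b L x R y : ℕ} {v v₁ v₂ v₃ v₄ : ℝ}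
    (hLR : L < R) (hR : R ≤ NF) (hxy : x ≤ y) (hy : y ≤ NG)
    (h₁ : Near b (R - 1) y → Sandwich w F G μ ν b L x (R - 1) y v₁)
    (h₂ : x < y → Near b R (y - 1) → Sandwich w F G μ ν b L x R (y - 1) v₂)
    (h₃ : x < y → L ≤ μ (R - 1) → μ (R - 1) < R - 1 → x ≤ ν (y - 1) → ν (y - 1) < y - 1 →
      Near b (μ (R - 1)) (ν (y - 1)) →
      Sandwich w F G μ ν b L x (μ (R - 1)) (ν (y - 1)) v₃ ∧
      Sandwich w F G μ ν b (μ (R - 1) + 1) (ν (y - 1) + 1) (R - 1) (y - 1) v₄)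
    (hv : v ≤ indelCost w F G L x R y)
    (hv₁ : Near b (R - 1) y → v ≤ w (labelAt F (R - 1)) none / 2 + v₁)
    (hv₂ : x < y ∧ Near b R (y - 1) → v ≤ w none (labelAt G (y - 1)) / 2 + v₂)
    (hv₃ : x < y ∧ L ≤ μ (R - 1) ∧ μ (R - 1) < R - 1 ∧ x ≤ ν (y - 1) ∧ ν (y - 1) < y - 1 ∧
      Near b (μ (R - 1)) (ν (y - 1)) →
      v ≤ w (labelAt F (R - 1)) (labelAt G (y - 1)) / 2 +
        w (labelAt F (μ (R - 1))) (labelAt G (ν (y - 1))) / 2 + (v₃ + v₄))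
    (hex : v = indelCost w F G L x R y ∨
      (Near b (R - 1) y ∧ v = w (labelAt F (R - 1)) none / 2 + v₁) ∨
      ((x < y ∧ Near b R (y - 1)) ∧ v = w none (labelAt G (y - 1)) / 2 + v₂) ∨
      ((x < y ∧ L ≤ μ (R - 1) ∧ μ (R - 1) < R - 1 ∧ x ≤ ν (y - 1) ∧ ν (y - 1) < y - 1 ∧
        Near b (μ (R - 1)) (ν (y - 1))) ∧
        v = w (labelAt F (R - 1)) (labelAt G (y - 1)) / 2 +
          w (labelAt F (μ (R - 1))) (labelAt G (ν (y - 1))) / 2 + (v₃ + v₄))) :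
    Sandwich w F G μ ν b L x R y v := by
  obtain ⟨R, rfl⟩ : ∃ R', R = R' + 1 := ⟨R - 1, by omega⟩
  simp only [Nat.add_sub_cancel] at *
  constructor
  · rcases hex with h | ⟨hc, h⟩ | ⟨⟨hc, hc'⟩, h⟩ | ⟨⟨hc, c1, c2, c3, c4, c5⟩, h⟩
    · rw [h]; exact valid_del_ins hLR.le hxy
    · obtain ⟨A, ⟨hp, hm⟩, hA⟩ := (h₁ hc).1
      refine ⟨A ++ [.del], ⟨hp.append (show IsPath R y (R + 1) y [.del] from ⟨rfl, rfl⟩),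
        fun f g ha => ?_⟩, ?_⟩
      · rcases hp.aligns_append.1 ha with ha | ha
        · exact hp.aligns_append.2 (Or.inl (hm _ _ ha))
        · exact ha.elim
      · rw [h, hp.cost_append, hA]; simp only [cost]; ring
    · obtain ⟨A, ⟨hp, hm⟩, hA⟩ := (h₂ hc hc').1
      refine ⟨A ++ [.ins], ⟨hp.append (show IsPath (R + 1) (y - 1) (R + 1) y [.ins] from
        ⟨rfl, by omega⟩),
        fun f g ha => ?_⟩, ?_⟩
      · rcases hp.aligns_append.1 ha with ha | ha
        · exact hp.aligns_append.2 (Or.inl (hm _ _ ha))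
        · exact ha.elim
      · rw [h, hp.cost_append, hA]; simp only [cost]; ring
    · obtain ⟨y, rfl⟩ : ∃ y', y = y' + 1 := ⟨y - 1, by omega⟩
      simp only [Nat.add_sub_cancel] at *
      obtain ⟨⟨A, ⟨hp, hm⟩, hA⟩, -⟩ := (h₃ hc c1 c2 c3 c4 c5).1
      obtain ⟨⟨A', ⟨hp', hm'⟩, hA'⟩, -⟩ := (h₃ hc c1 c2 c3 c4 c5).2
      have hd : IsPath (μ R) (ν y) (μ R + 1) (ν y + 1) [.diag] := ⟨rfl, rfl⟩
      have hd' : IsPath R y (R + 1) (y + 1) [.diag] := ⟨rfl, rfl⟩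
      refine ⟨A ++ ([.diag] ++ (A' ++ [.diag])),
        ⟨hp.append (hd.append (hp'.append hd')), ?_⟩, ?_⟩
      · intro f g
        rw [hp.aligns_append, hd.aligns_append, hp'.aligns_append,
          hp.aligns_append, hd.aligns_append, hp'.aligns_append]
        simp only [Aligns, or_false]
        rintro (ha | ⟨rfl, rfl⟩ | ha | ⟨rfl, rfl⟩)
        · exact Or.inl (hm _ _ ha)
        · exact Or.inr (Or.inr (Or.inr ⟨hμ.invol _ (by omega), hν.invol _ (by omega)⟩))
        · exact Or.inr (Or.inr (Or.inl (hm' _ _ ha)))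
        · exact Or.inr (Or.inl ⟨rfl, rfl⟩)
      · rw [h, hp.cost_append, hd.cost_append, hp'.cost_append, hA, hA']
        simp only [cost]; ring
  · rintro A ⟨hp, hm⟩ hb
    -- Mirror image of the argument for the left end: the path is analysed by its last edge.
    rcases List.eq_nil_or_concat A with rfl | ⟨A, m, rfl⟩
    · exact absurd hp.1 (by omega)
    rw [List.concat_eq_append] at *
    obtain ⟨R', y', hp1, hp2⟩ := isPath_append.1 hp
    have hb1 := (hp1.inBand_append.1 hb).1
    have hb2 := (hp1.inBand_append.1 hb).2.start
    rw [hp1.cost_append]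
    cases m with
    | del =>
        obtain ⟨e1, rfl⟩ := hp2
        obtain rfl : R' = R := by omega
        have hm' : MateClosed μ ν L x A := by
          intro f g ha
          rcases hp1.aligns_append.1 (hm f g (hp1.aligns_append.2 (Or.inl ha))) with h | h
          · exact h
          · exact h.elim
        have := (h₁ hb2).2 A ⟨hp1, hm'⟩ hb1
        have := hv₁ hb2
        simp only [cost]; linarith
    | ins =>
        obtain ⟨rfl, rfl⟩ := hp2
        have hl := hp1.le
        simp only [Nat.add_sub_cancel] at *
        have hm' : MateClosed μ ν L x A := by
          intro f g ha
          rcases hp1.aligns_append.1 (hm f g (hp1.aligns_append.2 (Or.inl ha))) with h | h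
          · exact h
          · exact h.elim
        have := (h₂ (by omega) hb2).2 A ⟨hp1, hm'⟩ hb1
        have := hv₂ ⟨by omega, hb2⟩
        simp only [cost]; linarith
    | diag =>
        obtain ⟨e1, rfl⟩ := hp2
        obtain rfl : R' = R := by omega
        have hl := hp1.le
        simp only [Nat.add_sub_cancel] at *
        have ha := hm R' y' (hp1.aligns_append.2 (Or.inr (Or.inl ⟨rfl, rfl⟩)))
        rcases hp1.aligns_append.1 ha with ha | ⟨h, -⟩ | h
        · have hbd := hp1.aligns_bounds ha
          obtain ⟨A₁, A₂, rfl, h1, h2⟩ := hp1.split ha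
          have h2' : IsPath (μ R') (ν y') R' y' (.diag :: A₂) := h2
          have hb11 := (h1.inBand_append.1 hb1).1
          have hb12 : Near b (μ R') (ν y') ∧ InBand b (μ R' + 1) (ν y' + 1) A₂ :=
            (h1.inBand_append.1 hb1).2
          have hd : IsPath R' y' (R' + 1) (y' + 1) [.diag] := ⟨rfl, rfl⟩
          have hd' : IsPath (μ R') (ν y') (μ R' + 1) (ν y' + 1) [.diag] := ⟨rfl, rfl⟩
          have e1 := hμ.invol R' (by omega)
          have m2 : MateClosed μ ν (μ R' + 1) (ν y' + 1) A₂ := by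
            refine MateClosed.middle (A₁ := A₁ ++ [.diag]) (A₃ := [.diag])
              (x := L) (y := x) (by simpa using hm) (h1.append hd') h2 hd fun f g haf => ?_
            have := h2.aligns_bounds haf
            have := hμ.nest (μ R') (by omega) (by omega) f (by omega) (by omega)
            omega
          have m1 : MateClosed μ ν L x A₁ := by
            refine MateClosed.middle (A₁ := []) (A₃ := .diag :: (A₂ ++ [.diag]))
              (x := L) (y := x) (x' := R' + 1) (y' := y' + 1) (by simpa using hm) ⟨rfl, rfl⟩ h1
              (h2.append hd) fun f g haf => ?_
            have hbf := h1.aligns_bounds haf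
            have hal := hm f g (hp1.aligns_append.2 (Or.inl (h1.aligns_append.2 (Or.inl haf))))
            have hbm := hp.aligns_bounds hal
            refine ⟨hbm.1.1, ?_⟩
            by_contra hc
            have e2 := hμ.invol f (by omega)
            rcases lt_trichotomy (μ f) R' with hl | hl | hl
            · rcases lt_trichotomy (μ f) (μ R') with hl' | hl' | hl'
              · omega
              · rw [hl', e1] at e2; omega
              · have := hμ.nest (μ R') (by omega) (by omega) (μ f) hl' (by omega); omega
            · rw [hl] at e2; omega
            · omega
          obtain ⟨s1, s2⟩ := h₃ (by omega) (by omega) (by omega) (by omega) (by omega) hb12.1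
          have c1 := s1.2 A₁ ⟨h1, m1⟩ hb11
          have c2 := s2.2 A₂ ⟨h2, m2⟩ hb12.2
          have := hv₃ ⟨by omega, by omega, by omega, by omega, by omega, hb12.1⟩
          rw [h1.cost_append]
          simp only [cost]
          linarith
        · exact absurd h (hμ.ne R' (by omega))
        · exact h.elim

end Valid

end TED

namespace TED

/-! ## Bounds for the tree edit distance -/

section Ted

variable {α : Type u} {w : Weight α} {F G : List (Paren α)} {μ ν : ℕ → ℕ}

theorem exists_valid_ted_eq (hμ : ∀ i < F.length, IsMate F i (μ i))
    (hν : ∀ i < G.length, IsMate G i (ν i)) :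
    ∃ A, Valid μ ν 0 0 F.length G.length A ∧ ted w F G = cost w F G 0 0 A := by
  obtain ⟨A, hA, h⟩ := (ted_isLeast w F G).1
  exact ⟨A, (isForestAlignment_iff hμ hν A).1 hA, h⟩

theorem ted_le (hμ : ∀ i < F.length, IsMate F i (μ i)) (hν : ∀ i < G.length, IsMate G i (ν i))
    {A : List Move} (hA : Valid μ ν 0 0 F.length G.length A) : ted w F G ≤ cost w F G 0 0 A :=
  (ted_isLeast w F G).2 ⟨A, (isForestAlignment_iff hμ hν A).2 hA, rfl⟩

theorem ted_nonneg (hw : Normalized w) : 0 ≤ ted w F G := by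
  obtain ⟨A, -, h⟩ := (ted_isLeast w F G).1
  rw [h]; exact cost_nonneg hw A 0 0

/-- The two strings are equal, as far as the oracle can tell. -/
def Same (w : Weight α) (F G : List (Paren α)) : Prop :=
  F.length = G.length ∧ ∀ i < F.length, openAt F i = openAt G i ∧ w (labelAt F i) (labelAt G i) ≤ 0

theorem eq_of_weight_lt_one (hw : Normalized w) {a b : Option α} (h : w a b < 1) : a = b := by
  by_contra hne
  linarith [hw.one_le a b hne]

theorem openAt_eq_one {i : ℕ} : openAt F i = 1 ↔ ∃ a, F[i]? = some (.op a) := by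
  unfold openAt
  split
  · rename_i a h; exact ⟨fun _ => ⟨a, h⟩, fun _ => rfl⟩
  · rename_i h
    refine ⟨fun h => by simp at h, fun ⟨a, ha⟩ => (h a ha).elim⟩

theorem openAt_le_one (F : List (Paren α)) (i : ℕ) : openAt F i ≤ 1 := by
  unfold openAt; split <;> omega

theorem openAt_eq_one_iff_lt (hμ : ∀ i < F.length, IsMate F i (μ i)) {i : ℕ} (hi : i < F.length) :
    openAt F i = 1 ↔ i < μ i := by
  rw [openAt_eq_one]
  rcases hμ i hi with h | h
  · exact ⟨fun _ => h.lt.1, fun _ => h.2.1⟩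
  · refine ⟨fun ⟨a, ha⟩ => ?_, fun h' => ?_⟩
    · obtain ⟨b, hb⟩ := h.2.2.1
      simp [ha] at hb
    · exact absurd h.lt.1 (by omega)

/-- Distinct labels have weight at least 1, so a nonpositive answer of the oracle means equal
labels; label and direction determine a parenthesis. -/
theorem Same.eq (hw : Normalized w) (h : Same w F G) : F = G := by
  refine List.ext_getElem h.1 fun i h1 h2 => ?_
  obtain ⟨ho, hl⟩ := h.2 i h1
  have hl := eq_of_weight_lt_one hw (hl.trans_lt one_pos)
  simp only [openAt, labelAt, List.getElem?_eq_getElem h1, List.getElem?_eq_getElem h2,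
    Option.map_some, Option.some.injEq] at ho hl
  generalize F[i] = p at *
  generalize G[i] = q at *
  cases p <;> cases q <;> simp_all [Paren.label]

theorem ted_eq_zero_of_same (hw : Normalized w) (hμ : ∀ i < F.length, IsMate F i (μ i))
    (h : Same w F G) : ted w F G = 0 := by
  obtain rfl := h.eq hw
  refine le_antisymm ?_ (ted_nonneg hw)
  have hp := isPath_replicate_diag F.length 0 0
  have hc : cost w F F 0 0 (List.replicate F.length .diag) = 0 :=
    cost_replicate_diag _ _ _ fun i _ => hw.self _
  rw [← hc]
  refine ted_le hμ hμ ⟨by simpa using hp, fun f g ha => ?_⟩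
  rw [aligns_replicate_diag] at ha ⊢
  obtain ⟨i, hi, rfl, rfl⟩ := ha
  simp only [zero_add] at *
  exact ⟨μ i, (isNest_of_isMate hμ).lt i hi, rfl, rfl⟩

/-- An alignment cheaper than 1/2 has no insertion or deletion, so it is the main diagonal, and each
aligned pair has weight below 1, hence equal labels. -/
theorem half_le_ted_of_not_same (hw : Normalized w) (hμ : ∀ i < F.length, IsMate F i (μ i))
    (hν : ∀ i < G.length, IsMate G i (ν i)) (h : ¬ Same w F G) : 1 / 2 ≤ ted w F G := by
  obtain ⟨A, ⟨hp, hm⟩, hA⟩ := exists_valid_ted_eq (w := w) hμ hν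
  rw [hA]
  by_contra hlt
  push Not at hlt
  have hle := hp.numIndels_le_cost hw le_rfl le_rfl
  have hn : numIndels A = 0 := by
    by_contra hne
    have : (1 : ℝ) ≤ numIndels A := by exact_mod_cast Nat.one_le_iff_ne_zero.2 hne
    linarith
  have hnear := hp.near_end_of_numIndels
  have hlen : F.length = G.length := by omega
  have hrep := eq_replicate_diag hn
  have hAl : A.length = F.length := by
    have hp' := isPath_replicate_diag A.length 0 0
    rw [← hrep] at hp'
    have : ∀ (A : List Move) (x y a b c d : ℕ), IsPath x y a b A → IsPath x y c d A → a = c := by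
      intro A
      induction A with
      | nil => intro x y a b c d h h'; exact h.1.symm.trans h'.1
      | cons m A ih => intro x y a b c d h h'; cases m <;> exact ih _ _ _ _ _ _ h h'
    have := this _ _ _ _ _ _ _ hp hp'
    omega
  have hal : ∀ f g, Aligns 0 0 A f g ↔ f < F.length ∧ g = f := by
    intro f g
    rw [hrep, aligns_replicate_diag, hAl]
    constructor
    · rintro ⟨i, hi, rfl, rfl⟩; exact ⟨by omega, by omega⟩
    · rintro ⟨h1, rfl⟩; exact ⟨g, h1, by omega, by omega⟩
  refine h ⟨hlen, fun i hi => ?_⟩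
  have ha := (hal i i).2 ⟨hi, rfl⟩
  constructor
  -- On the main diagonal, aligned mates mean `μ i = ν i`; both parentheses therefore look for their
  -- mate in the same direction.
  · have := ((hal _ _).1 (hm i i ha)).2
    have h1 := openAt_eq_one_iff_lt hμ hi
    have h2 := openAt_eq_one_iff_lt hν (hlen ▸ hi)
    rw [this] at h2
    have := openAt_le_one F i
    have := openAt_le_one G i
    by_cases hc : i < μ i
    · rw [h1.2 hc, h2.2 hc]
    · have := fun e => hc (h1.1 e)
      have := fun e => hc (h2.1 e)
      omega
  · have := ha.weight_le_cost (F := F) (G := G) hw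
    rw [eq_of_weight_lt_one hw (a := labelAt F i) (b := labelAt G i) (by linarith), hw.self]

theorem numIndels_le_of_ted {b : ℕ} (hw : Normalized w) (hb : 2 * ted w F G ≤ b) {A : List Move}
    (hA : Valid μ ν 0 0 F.length G.length A) (h : ted w F G = cost w F G 0 0 A) :
    numIndels A ≤ b := by
  have := hA.1.numIndels_le_cost hw le_rfl le_rfl
  rw [← h] at this
  have : (numIndels A : ℝ) ≤ b := by linarith
  exact_mod_cast this

/-- The lengths differ by at most the number of insertions and deletions of an optimal alignment. So
if the corner of the grid is outside the band, the band is certainly too narrow. -/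
theorem near_of_ted {b : ℕ} (hw : Normalized w) (hμ : ∀ i < F.length, IsMate F i (μ i))
    (hν : ∀ i < G.length, IsMate G i (ν i)) (hb : 2 * ted w F G ≤ b) :
    Near b F.length G.length := by
  obtain ⟨A, hA, h⟩ := exists_valid_ted_eq (w := w) hμ hν
  have h1 := numIndels_le_of_ted hw hb hA h
  have := hA.1.near_end_of_numIndels
  exact ⟨by omega, by omega⟩

theorem Sandwich.ted_le {b : ℕ} {v : ℝ} (hμ : ∀ i < F.length, IsMate F i (μ i))
    (hν : ∀ i < G.length, IsMate G i (ν i))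
    (h : Sandwich w F G μ ν b 0 0 F.length G.length v) : ted w F G ≤ v := by
  obtain ⟨⟨A, hA, rfl⟩, -⟩ := h
  exact TED.ted_le hμ hν hA

/-- Some optimal alignment lies in the band: it has at most `b` insertions and deletions in the
first case, and in the second the band contains the whole grid. -/
theorem Sandwich.eq_ted {b : ℕ} {v : ℝ} (hw : Normalized w)
    (hμ : ∀ i < F.length, IsMate F i (μ i))
    (hν : ∀ i < G.length, IsMate G i (ν i))
    (h : Sandwich w F G μ ν b 0 0 F.length G.length v)
    (hb : 2 * ted w F G ≤ b ∨ F.length + G.length ≤ b) : v = ted w F G := by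
  refine le_antisymm ?_ (h.ted_le hμ hν)
  obtain ⟨A, hA, hc⟩ := exists_valid_ted_eq (w := w) hμ hν
  rw [hc]
  refine h.2 A hA ?_
  rcases hb with hb | hb
  · have := numIndels_le_of_ted hw hb hA hc
    exact hA.1.inBand_of_numIndels (by omega) (by omega)
  · exact hA.1.inBand_of_le (by omega) (by omega)

end Ted

/-! ## The chain of substrings around a pivot

`Good L R` says that the row of the dynamic program for the substring `F[L .. R)` is available. -/

section Chain

variable {N : ℕ} {μ : ℕ → ℕ} {Good Good' : ℕ → ℕ → Prop} {p lo hi L R : ℕ}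

/-- The rows needed to compute the row of `F[L .. R)` by removing `F[R - 1]`. -/
def NeedRight (μ : ℕ → ℕ) (Good : ℕ → ℕ → Prop) (L R : ℕ) : Prop :=
  Good L (R - 1) ∧ (L ≤ μ (R - 1) → μ (R - 1) < R - 1 →
    Good L (μ (R - 1)) ∧ Good (μ (R - 1) + 1) (R - 1))

/-- The rows needed to compute the row of `F[L .. R)` by removing `F[L]`. -/
def NeedLeft (μ : ℕ → ℕ) (Good : ℕ → ℕ → Prop) (L R : ℕ) : Prop :=
  Good (L + 1) R ∧ (L < μ L → μ L < R → Good (L + 1) (μ L) ∧ Good (μ L + 1) R)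

/-- The invariant of the chain of substrings around the pivot `p`. -/
structure ChainInv (N : ℕ) (μ : ℕ → ℕ) (Good : ℕ → ℕ → Prop) (p lo hi L R : ℕ) : Prop where
  lo_le : lo ≤ L
  le_p : L ≤ p
  p_le : p ≤ R
  le_hi : R ≤ hi
  phase : (∃ R₀, p ≤ R₀ ∧ R₀ ≤ R ∧ (∀ x, L ≤ x → x < R₀ → μ x < R₀) ∧
      (∀ x, L ≤ x → x < R → L ≤ μ x) ∧ ∀ x, R₀ ≤ x → x ≤ R → Good L x) ∨
    (∃ L₀, L ≤ L₀ ∧ L₀ ≤ p ∧ (∀ x, L₀ ≤ x → x < R → L₀ ≤ μ x) ∧ (R = hi ∨ μ R < L) ∧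
      ∀ x, L ≤ x → x ≤ L₀ → Good x R)
  cov : ∀ l < N, l < p → p ≤ μ l → Good (l + 1) (μ l) ∨ (l + 1 ≤ L ∧ R ≤ μ l)

theorem ChainInv.good (h : ChainInv N μ Good p lo hi L R) : Good L R := by
  rcases h.phase with ⟨R₀, -, h1, -, -, h2⟩ | ⟨L₀, h1, -, -, -, h2⟩
  · exact h2 R h1 le_rfl
  · exact h2 L le_rfl h1

theorem ChainInv.start (h1 : lo ≤ p) (h2 : p ≤ hi) (hg : Good p p) :
    ChainInv N μ Good p lo hi p p := by
  refine ⟨h1, le_rfl, le_rfl, h2, Or.inl ⟨p, le_rfl, le_rfl, fun x _ _ => by omega,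
    fun x _ _ => by omega, fun x a b => ?_⟩, fun l _ a b => Or.inr ⟨a, b⟩⟩
  obtain rfl : x = p := by omega
  exact hg

/-- The rows of the nodes within the range that do not contain the pivot are available. -/
def LightGood (N : ℕ) (μ : ℕ → ℕ) (Good : ℕ → ℕ → Prop) (p lo hi : ℕ) : Prop :=
  ∀ l < N, l < μ l → lo ≤ l + 1 → μ l ≤ hi → (μ l < p ∨ p ≤ l) → Good (l + 1) (μ l)

/-- In the right phase F[L..R₀) is closed under mates, so a node that closes at `R` and opens at or
after `L` opens at or after `R₀`. The part before it is then a row of the current phase, and the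
node lies to the right of the pivot, so its interior is light. In the left phase no right move is
possible. -/
theorem ChainInv.need_right (h : ChainInv N μ Good p lo hi L R) (hμ : IsNest N μ) (hN : hi ≤ N)
    (hl : LightGood N μ Good p lo hi) (h1 : R < hi) (h2 : ¬ μ R < L) :
    NeedRight μ Good L (R + 1) := by
  refine ⟨h.good, fun h3 h4 => ?_⟩
  simp only [Nat.add_sub_cancel] at *
  have i1 := hμ.invol R (by omega)
  have hlo := h.lo_le
  rcases h.phase with ⟨R₀, a1, a2, a3, a4, a5⟩ | ⟨L₀, -, -, -, a3, -⟩
  · have hR₀ : R₀ ≤ μ R := by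
      by_contra hc
      have := a3 (μ R) h3 (by omega)
      omega
    refine ⟨a5 _ hR₀ h4.le, ?_⟩
    have := hl (μ R) (by omega) (by omega) (by omega) (by omega) (by omega)
    rwa [i1] at this
  · omega

theorem ChainInv.right (h : ChainInv N μ Good p lo hi L R)
    (h1 : R < hi) (h2 : ¬ μ R < L) (hμ : IsNest N μ)
    (hG : ∀ a b, Good a b → Good' a b) (hg : Good' L (R + 1)) :
    ChainInv N μ Good' p lo hi L (R + 1) := by
  refine ⟨h.lo_le, h.le_p, h.p_le.trans (Nat.le_succ R), h1, Or.inl ?_, ?_⟩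
  · rcases h.phase with ⟨R₀, a1, a2, a3, a4, a5⟩ | ⟨L₀, -, -, -, a3, -⟩
    · refine ⟨R₀, a1, by omega, a3, fun x b1 b2 => ?_, fun x b1 b2 => ?_⟩
      · rcases Nat.lt_succ_iff_lt_or_eq.1 b2 with b | rfl
        · exact a4 x b1 b
        · omega
      · rcases Nat.le_succ_iff.1 b2 with b | rfl
        · exact hG _ _ (a5 x b1 b)
        · exact hg
    · omega
  · intro l hl b1 b2
    rcases h.cov l hl b1 b2 with c | ⟨c1, c2⟩
    · exact Or.inl (hG _ _ c)
    · refine Or.inr ⟨c1, ?_⟩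
      by_contra hc
      have := hμ.invol l hl
      rw [show μ l = R by omega] at this
      omega

/-- A right phase that is blocked turns into a left phase with `L₀ = L`, because no parenthesis of
F[L..R) has its mate before `L`. -/
theorem ChainInv.toLeft (h : ChainInv N μ Good p lo hi L R)
    (h1 : ¬ (R < hi ∧ ¬ μ R < L)) :
    ∃ L₀, L ≤ L₀ ∧ L₀ ≤ p ∧ (∀ x, L₀ ≤ x → x < R → L₀ ≤ μ x) ∧ (R = hi ∨ μ R < L) ∧
      ∀ x, L ≤ x → x ≤ L₀ → Good x R := by
  rcases h.phase with ⟨R₀, a1, a2, a3, a4, a5⟩ | h'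
  · have := h.le_hi
    refine ⟨L, le_rfl, h.le_p, a4, by omega, fun x b1 b2 => ?_⟩
    obtain rfl : x = L := by omega
    exact h.good
  · exact h'

/-- Parentheses in F[L₀..R) have no mate before `L₀`, so the mate of F[L - 1] comes before `L₀`. The
rest behind the node is thus a row of the current phase, and the node itself lies to the left of the
pivot. -/
theorem ChainInv.need_left (h : ChainInv N μ Good p lo hi L R) (hμ : IsNest N μ) (hN : hi ≤ N)
    (hl : LightGood N μ Good p lo hi) (h1 : ¬ (R < hi ∧ ¬ μ R < L)) (h2 : lo < L) :
    μ (L - 1) < R → NeedLeft μ Good (L - 1) R := by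
  intro h3
  have hLp := h.le_p
  have hpR := h.p_le
  have hRh := h.le_hi
  have i1 := hμ.invol (L - 1) (by omega)
  obtain ⟨L₀, a1, a2, a3, a4, a5⟩ := h.toLeft h1
  unfold NeedLeft
  rw [show L - 1 + 1 = L by omega]
  refine ⟨h.good, fun h4 _ => ?_⟩
  have hm : μ (L - 1) < L₀ := by
    by_contra hc
    have := a3 (μ (L - 1)) (by omega) h3
    omega
  refine ⟨?_, a5 _ (by omega) (by omega)⟩
  have := hl (L - 1) (by omega) h4 (by omega) (by omega) (by omega)
  rwa [show L - 1 + 1 = L by omega] at this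

theorem ChainInv.left (h : ChainInv N μ Good p lo hi L R) (hμ : IsNest N μ) (hN : hi ≤ N)
    (h1 : ¬ (R < hi ∧ ¬ μ R < L)) (h2 : lo < L) (h3 : μ (L - 1) < R)
    (hG : ∀ a b, Good a b → Good' a b) (hg : Good' (L - 1) R) :
    ChainInv N μ Good' p lo hi (L - 1) R := by
  have hLp := h.le_p
  have hpR := h.p_le
  have hRh := h.le_hi
  obtain ⟨L₀, a1, a2, a3, a4, a5⟩ := h.toLeft h1
  refine ⟨by omega, by omega, hpR, hRh, Or.inr ⟨L₀, by omega, a2, a3, ?_, fun x b1 b2 => ?_⟩, ?_⟩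
  · rcases a4 with a4 | a4
    · exact Or.inl a4
    · by_cases hR : R = hi
      · exact Or.inl hR
      · refine Or.inr ?_
        have := hμ.invol R (by omega)
        -- If F[R] were matched with the new left end, then `μ (L - 1) = R`, and the left move would
        -- not have been allowed.
        by_contra hc
        rw [show μ R = L - 1 by omega] at this
        omega
  · rcases Nat.lt_or_ge x L with b | b
    · obtain rfl : x = L - 1 := by omega
      exact hg
    · exact hG _ _ (a5 x b b2)
  · intro l hl b1 b2
    rcases h.cov l hl b1 b2 with c | ⟨c1, c2⟩
    · exact Or.inl (hG _ _ c)
    · refine Or.inr ⟨?_, c2⟩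
      by_contra hc
      rw [show L - 1 = l by omega] at h3
      omega

/-- If the chain can be extended neither to the right nor to the left, the next two parentheses
are mates. -/
theorem ChainInv.mates (h : ChainInv N μ Good p lo hi L R) (hμ : IsNest N μ) (hN : hi ≤ N)
    (h1 : ¬ (R < hi ∧ ¬ μ R < L)) (h2 : ¬ (lo < L ∧ μ (L - 1) < R)) (h3 : R < hi) (h4 : lo < L) :
    μ R = L - 1 ∧ μ (L - 1) = R := by
  have hLp := h.le_p
  have hpR := h.p_le
  have i1 := hμ.invol R (by omega)
  have e : μ R = L - 1 := by
    -- Otherwise `L - 1` is strictly inside the node that closes at `R`; so is its mate, and the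
    -- left move would be possible.
    by_contra hc
    have := hμ.nest (μ R) (by omega) (by omega) (L - 1) (by omega) (by omega)
    omega
  exact ⟨e, by rw [← e, i1]⟩

/-- The new parentheses enclose everything between them, so the enlarged substring is closed under
mates and a right phase starts afresh with `R₀ = R + 1`. The interior of the added node is the
previous row. -/
theorem ChainInv.both (h : ChainInv N μ Good p lo hi L R) (hμ : IsNest N μ) (hN : hi ≤ N)
    (h1 : ¬ (R < hi ∧ ¬ μ R < L)) (h2 : ¬ (lo < L ∧ μ (L - 1) < R)) (h3 : R < hi) (h4 : lo < L)
    (hG : ∀ a b, Good a b → Good' a b) (hg : Good' (L - 1) (R + 1)) :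
    ChainInv N μ Good' p lo hi (L - 1) (R + 1) := by
  have hLp := h.le_p
  have hpR := h.p_le
  obtain ⟨e1, e2⟩ := h.mates hμ hN h1 h2 h3 h4
  have key : ∀ x, L - 1 ≤ x → x < R + 1 → L - 1 ≤ μ x ∧ μ x < R + 1 := by
    intro x b1 b2
    by_cases c1 : x = L - 1
    · subst c1; omega
    by_cases c2 : x = R
    · subst c2; omega
    have := hμ.nest (L - 1) (by omega) (by omega) x (by omega) (by omega)
    omega
  refine ⟨by omega, by omega, by omega, h3, Or.inl ⟨R + 1, by omega, le_rfl,
    fun x b1 b2 => (key x b1 b2).2, fun x b1 b2 => (key x b1 b2).1, fun x b1 b2 => ?_⟩, ?_⟩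
  · obtain rfl : x = R + 1 := by omega
    exact hg
  · intro l hl b1 b2
    rcases h.cov l hl b1 b2 with c | ⟨c1, c2⟩
    · exact Or.inl (hG _ _ c)
    · by_cases hc : l = L - 1
      · subst hc
        rw [e2, show L - 1 + 1 = L by omega]
        exact Or.inl (hG _ _ h.good)
      · refine Or.inr ⟨by omega, ?_⟩
        by_contra hc'
        have := hμ.invol l hl
        rw [show μ l = R by omega] at this
        omega

/-- When the chain halts, an end of the window has been reached. A node around the pivot that is not
yet covered agrees with F[L..R) at that end, and by nesting also at the other, since otherwise the
blocked move would be possible. -/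
theorem ChainInv.final (h : ChainInv N μ Good p lo hi L R) (hμ : IsNest N μ)
    (h1 : ¬ (R < hi ∧ ¬ μ R < L)) (h2 : ¬ (lo < L ∧ μ (L - 1) < R)) (h3 : ¬ (R < hi ∧ lo < L))
    {l : ℕ} (hl : l < N) (hlp : l < p) (hp : p ≤ μ l) (hlo : lo ≤ l + 1) (hhi : μ l ≤ hi) :
    Good (l + 1) (μ l) := by
  have hLp := h.le_p
  have hpR := h.p_le
  have hRh := h.le_hi
  have hLlo := h.lo_le
  rcases h.cov l hl hlp hp with c | ⟨c1, c2⟩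
  · exact c
  have hq := hμ.lt l hl
  have key : l + 1 = L ∧ R = μ l := by
    rcases Nat.lt_or_ge R hi with hR | hR
    · refine ⟨by omega, ?_⟩
      by_contra hc
      have := hμ.nest l hl (by omega) R (by omega) (by omega)
      omega
    · refine ⟨?_, by omega⟩
      by_contra hc
      have := hμ.nest l hl (by omega) (L - 1) (by omega) (by omega)
      omega
  rw [key.1, ← key.2]
  exact h.good

/-- With `L = 0` no mate lies before `L`, so only the end of the window can stop the chain. -/
theorem ChainInv.final_zero {hi L R : ℕ} (h : ChainInv N μ Good 0 0 hi L R)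
    (h1 : ¬ (R < hi ∧ ¬ μ R < L)) : Good 0 hi := by
  have hLp := h.le_p
  have hRh := h.le_hi
  obtain rfl : L = 0 := by omega
  obtain rfl : R = hi := by omega
  exact h.good

/-- The rows of the nodes that do not contain a multiple of `h` are available. -/
def LevelGood (N : ℕ) (μ : ℕ → ℕ) (Good : ℕ → ℕ → Prop) (h : ℕ) : Prop :=
  ∀ l < N, l < μ l → (∀ y, h ∣ y → l + 1 ≤ y → ¬ y ≤ μ l) → Good (l + 1) (μ l)

/-- Vacuous: `l + 1` is itself a multiple of 1 in the forbidden range. -/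
theorem levelGood_one : LevelGood N μ Good 1 := fun l _ h1 h2 =>
  (h2 (l + 1) (one_dvd _) le_rfl h1).elim

/-- The window extends less than `h` to either side of `p`, so `p` is the only multiple of `h` that
a node inside it could contain. -/
theorem LevelGood.light {h : ℕ} (hg : LevelGood N μ Good h) (hp : h ∣ p) (hlo : p + 1 - h ≤ lo)
    (hhi : hi ≤ p + h - 1) (h0 : 0 < h) : LightGood N μ Good p lo hi := by
  intro l hl h1 h2 h3 h4
  refine hg l hl h1 fun y hy h5 h6 => ?_
  obtain ⟨a, rfl⟩ := hp
  obtain ⟨b, rfl⟩ := hy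
  rcases lt_trichotomy a b with hab | rfl | hab
  · have := Nat.mul_le_mul_left h (Nat.succ_le_of_lt hab)
    rw [Nat.succ_eq_add_one, mul_add] at this
    omega
  · omega
  · have := Nat.mul_le_mul_left h (Nat.succ_le_of_lt hab)
    rw [Nat.succ_eq_add_one, mul_add] at this
    omega

/-- One of any two consecutive multiples of `h` is a multiple of `h + h`. So a node that becomes
relevant at the doubled scale contains exactly one multiple of `h` and fits into the window around
it. -/
theorem LevelGood.double {h : ℕ} (hμ : IsNest N μ) (hg : LevelGood N μ Good h)
    (hp : ∀ p, h ∣ p → p ≤ N → ∀ l < N, l < p → p ≤ μ l → p + 1 - h ≤ l + 1 →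
      μ l ≤ min N (p + h - 1) → Good (l + 1) (μ l)) :
    LevelGood N μ Good (h + h) := by
  intro l hl h1 h2
  by_cases hc : ∀ y, h ∣ y → l + 1 ≤ y → ¬ y ≤ μ l
  · exact hg l hl h1 hc
  push Not at hc
  obtain ⟨y, ⟨a, rfl⟩, h3, h4⟩ := hc
  have hq := hμ.lt l hl
  have key : ∀ c, l + 1 ≤ h * c → h * c ≤ μ l → l + 1 ≤ h * (c + 1) → h * (c + 1) ≤ μ l →
      False := by
    intro c c1 c2 c3 c4
    rcases Nat.even_or_odd c with ⟨d, hd⟩ | ⟨d, hd⟩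
    · exact h2 (h * c) ⟨d, by rw [hd]; ring⟩ c1 c2
    · exact h2 (h * (c + 1)) ⟨d + 1, by rw [hd]; ring⟩ c3 c4
  refine hp (h * a) ⟨a, rfl⟩ (by omega) l hl (by omega) h4 ?_ ?_
  · by_contra hc
    obtain ⟨a, rfl⟩ : ∃ a', a = a' + 1 := ⟨a - 1, by
      rcases a with _ | a
      · omega
      · omega⟩
    have e : h * (a + 1) = h * a + h := by ring
    exact key a (by omega) (by omega) h3 h4
  · by_contra hc
    have e : h * (a + 1) = h * a + h := by ring
    exact key a h3 h4 (by omega) (by omega)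

end Chain

/-! ## Reasoning about programs -/

section Machine

def State.setN (s : State) (x v : ℕ) : State := { s with nvar := Function.update s.nvar x v }

def State.setNArr (s : State) (a i v : ℕ) : State :=
  { s with narr := Function.update s.narr a (Function.update (s.narr a) i v) }

def State.setR (s : State) (x : ℕ) (v : ℝ) : State :=
  { s with rvar := Function.update s.rvar x v }

def State.setRArr (s : State) (a i : ℕ) (v : ℝ) : State :=
  { s with rarr := Function.update s.rarr a (Function.update (s.rarr a) i v) }

variable (s : State) (x a i : ℕ) (v : ℕ) (r : ℝ)

@[simp] theorem State.setN_nvar (y : ℕ) : (s.setN x v).nvar y = if y = x then v else s.nvar y := by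
  simp [State.setN, Function.update_apply]

@[simp] theorem State.setN_narr : (s.setN x v).narr = s.narr := rfl
@[simp] theorem State.setN_rvar : (s.setN x v).rvar = s.rvar := rfl
@[simp] theorem State.setN_rarr : (s.setN x v).rarr = s.rarr := rfl

@[simp] theorem State.setNArr_narr (b j : ℕ) :
    (s.setNArr a i v).narr b j = if b = a ∧ j = i then v else s.narr b j := by
  by_cases h : b = a
  · subst h; simp [State.setNArr, Function.update_apply]
  · simp [State.setNArr, h]

@[simp] theorem State.setNArr_nvar : (s.setNArr a i v).nvar = s.nvar := rfl

@[simp] theorem State.setR_rvar (y : ℕ) : (s.setR x r).rvar y = if y = x then r else s.rvar y := by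
  simp [State.setR, Function.update_apply]

@[simp] theorem State.setR_nvar : (s.setR x r).nvar = s.nvar := rfl
@[simp] theorem State.setR_narr : (s.setR x r).narr = s.narr := rfl
@[simp] theorem State.setR_rarr : (s.setR x r).rarr = s.rarr := rfl

@[simp] theorem State.setRArr_rarr (b j : ℕ) :
    (s.setRArr a i r).rarr b j = if b = a ∧ j = i then r else s.rarr b j := by
  by_cases h : b = a
  · subst h; simp [State.setRArr, Function.update_apply]
  · simp [State.setRArr, h]

@[simp] theorem State.setRArr_nvar : (s.setRArr a i r).nvar = s.nvar := rfl
@[simp] theorem State.setRArr_rvar : (s.setRArr a i r).rvar = s.rvar := rfl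

variable {α : Type u} {M : ℕ} {I : Input α}

/-- Started in `s`, the program `P` halts within time `T` in a state that satisfies `Q`. -/
def Run (M : ℕ) (I : Input α) (P : Prog) (s : State) (T : ℕ) (Q : State → Prop) : Prop :=
  ∃ s' t, Exec M I P s s' t ∧ t ≤ T ∧ Q s'

variable {s} {P P' : Prog} {T T' : ℕ} {Q Q' : State → Prop} {b : BExp}

theorem Run.mono (h : Run M I P s T Q) (hT : T ≤ T') (hQ : ∀ s', Q s' → Q' s') :
    Run M I P s T' Q' := by
  obtain ⟨s', t, h1, h2, h3⟩ := h
  exact ⟨s', t, h1, h2.trans hT, hQ _ h3⟩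

theorem Run.seq (h : Run M I P s T fun s' => Run M I P' s' T' Q) :
    Run M I (.seq P P') s (T + T') Q := by
  obtain ⟨s', t, h1, h2, s'', t', h3, h4, h5⟩ := h
  exact ⟨s'', t + t', .seq h1 h3, by omega, h5⟩

theorem Run.ite (hf : b.Fits M I s) (h1 : b.Holds I s → Run M I P s T Q)
    (h2 : ¬ b.Holds I s → Run M I P' s T Q) : Run M I (.ite b P P') s (b.time + 1 + T) Q := by
  by_cases hb : b.Holds I s
  · obtain ⟨s', t, a, c, d⟩ := h1 hb
    exact ⟨s', _, .iteTrue hf hb a, by omega, d⟩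
  · obtain ⟨s', t, a, c, d⟩ := h2 hb
    exact ⟨s', _, .iteFalse hf hb a, by omega, d⟩

/-- Loops whose running time is bounded by a potential function. -/
theorem Run.loop (Inv : State → Prop) (pot : State → ℕ) (hf : ∀ s, Inv s → b.Fits M I s)
    (hP : ∀ s, Inv s → b.Holds I s → ∃ T, Run M I P s T fun s' =>
      Inv s' ∧ T + b.time + 1 + pot s' ≤ pot s) (hs : Inv s) :
    Run M I (.loop b P) s (pot s + b.time + 1) fun s' => Inv s' ∧ ¬ b.Holds I s' := by
  induction hn : pot s using Nat.strong_induction_on generalizing s with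
  | _ n ih =>
      subst hn
      by_cases hb : b.Holds I s
      · obtain ⟨T, s', t, h1, h2, h3, h4⟩ := hP s hs hb
        obtain ⟨s'', t', h5, h6, h7⟩ := ih (pot s') (by omega) h3 rfl
        exact ⟨s'', _, .loopTrue (hf s hs) hb h1 h5, by omega, h7⟩
      · exact ⟨s, _, .loopFalse (hf s hs) hb, by omega, hs, hb⟩

/-- Weakest preconditions of programs without loops. -/
def Prog.Wp (M : ℕ) (I : Input α) : Prog → (State → Prop) → State → Prop
  | .skip, Q, s => Q s
  | .setN x e, Q, s => e.Fits M I s ∧ Q (s.setN x (e.eval I s))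
  | .setNArr a i e, Q, s => i.Fits M I s ∧ e.Fits M I s ∧ Q (s.setNArr a (i.eval I s) (e.eval I s))
  | .setR x e, Q, s => e.Fits M I s ∧ Q (s.setR x (e.eval I s))
  | .setRArr a i e, Q, s => i.Fits M I s ∧ e.Fits M I s ∧ Q (s.setRArr a (i.eval I s) (e.eval I s))
  | .seq P P', Q, s => P.Wp M I (P'.Wp M I Q) s
  | .ite b P P', Q, s => b.Fits M I s ∧ (b.Holds I s → P.Wp M I Q s) ∧
      (¬ b.Holds I s → P'.Wp M I Q s)
  | .loop _ _, _, _ => False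

/-- A bound for the running time of a program without loops. -/
def Prog.maxTime : Prog → ℕ
  | .skip => 1
  | .setN _ e => e.time + 1
  | .setNArr _ i e => i.time + e.time + 1
  | .setR _ e => e.time + 1
  | .setRArr _ i e => i.time + e.time + 1
  | .seq P P' => P.maxTime + P'.maxTime
  | .ite b P P' => b.time + 1 + max P.maxTime P'.maxTime
  | .loop _ _ => 0

theorem Run.of_wp (h : P.Wp M I Q s) : Run M I P s P.maxTime Q := by
  induction P generalizing s Q with
  | skip => exact ⟨_, _, .skip s, le_rfl, h⟩
  | setN x e => exact ⟨_, _, .setN s x e h.1, le_rfl, h.2⟩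
  | setNArr a i e => exact ⟨_, _, .setNArr s a i e h.1 h.2.1, le_rfl, h.2.2⟩
  | setR x e => exact ⟨_, _, .setR s x e h.1, le_rfl, h.2⟩
  | setRArr a i e => exact ⟨_, _, .setRArr s a i e h.1 h.2.1, le_rfl, h.2.2⟩
  | seq P P' ih ih' => exact Run.seq ((ih h).mono le_rfl fun _ h' => ih' h')
  | ite b P P' ih ih' =>
      exact Run.ite h.1 (fun hb => (ih (h.2.1 hb)).mono (le_max_left _ _) fun _ => id)
        (fun hb => (ih' (h.2.2 hb)).mono (le_max_right _ _) fun _ => id)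
  | loop b P => exact h.elim

end Machine

end TED

namespace TED

/-! ## One cell of the dynamic program -/

namespace Alg

/-- The side length of the four-dimensional table. -/
def base : NExp := .add (.add .lenF .lenG) (.const 1)

/-- The address of a cell of the four-dimensional table. -/
def idxE (a b c d : NExp) : NExp :=
  .add (.mul (.add (.mul (.add (.mul a base) b) base) c) base) d

abbrev band : NExp := .var 3
abbrev left : NExp := .var 8
abbrev right : NExp := .var 9
abbrev fst : NExp := .var 11
abbrev snd : NExp := .var 12
abbrev succE (e : NExp) : NExp := .add e (.const 1)
abbrev predE (e : NExp) : NExp := .sub e (.const 1)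
abbrev mateF (e : NExp) : NExp := .arr 0 e
abbrev mateG (e : NExp) : NExp := .arr 1 e
abbrev table (a b c d : NExp) : RExp := .arr 0 (idxE a b c d)

def nearE (a c : NExp) : BExp :=
  .and (.ltN a (succE (.add c band))) (.ltN c (succE (.add a band)))

/-- If `c` holds, replace the real variable `2` by its minimum with `e`. -/
def relax (c : BExp) (e : RExp) : Prog :=
  .ite c (.ite (.leR e (.var 2)) (.setR 2 e) .skip) .skip

def indelE : RExp :=
  .add (.sub (.arr 1 right) (.arr 1 left)) (.sub (.arr 2 snd) (.arr 2 fst))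

/-- The initial value `indelE` gives the cell a legitimate value even if all neighbours are outside
the band. -/
def cell (c₁ : BExp) (e₁ : RExp) (c₂ : BExp) (e₂ : RExp) (c₃ : BExp) (e₃ : RExp) : Prog :=
  .seq (.setR 2 indelE) (.seq (relax c₁ e₁) (.seq (relax c₂ e₂) (.seq (relax c₃ e₃)
    (.setRArr 0 (idxE left right fst snd) (.var 2)))))

/-- For an empty substring of `F` all relaxations are switched off, and only the insertion cost
remains. -/
def guarded (c : BExp) : BExp := .and (.ltN left right) c

def leftCell : Prog :=
  cell (guarded (nearE (succE left) fst))
    (.add (.half (.weight (.labF left) .eps)) (table (succE left) right fst snd))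
    (guarded (.and (.ltN fst snd) (nearE left (succE fst))))
    (.add (.half (.weight .eps (.labG fst))) (table left right (succE fst) snd))
    (guarded (.and (.ltN fst snd) (.and (.ltN left (mateF left)) (.and (.ltN (mateF left) right)
      (.and (.ltN fst (mateG fst)) (.and (.ltN (mateG fst) snd)
        (nearE (mateF left) (mateG fst))))))))
    (.add (.add (.half (.weight (.labF left) (.labG fst)))
        (.half (.weight (.labF (mateF left)) (.labG (mateG fst)))))
      (.add (table (succE left) (mateF left) (succE fst) (mateG fst))
        (table (succE (mateF left)) right (succE (mateG fst)) snd)))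

def rightCell : Prog :=
  cell (guarded (nearE (predE right) snd))
    (.add (.half (.weight (.labF (predE right)) .eps)) (table left (predE right) fst snd))
    (guarded (.and (.ltN fst snd) (nearE right (predE snd))))
    (.add (.half (.weight .eps (.labG (predE snd)))) (table left right fst (predE snd)))
    (guarded (.and (.ltN fst snd) (.and (.not (.ltN (mateF (predE right)) left))
      (.and (.ltN (mateF (predE right)) (predE right))
      (.and (.not (.ltN (mateG (predE snd)) fst)) (.and (.ltN (mateG (predE snd)) (predE snd))
        (nearE (mateF (predE right)) (mateG (predE snd)))))))))
    (.add (.add (.half (.weight (.labF (predE right)) (.labG (predE snd))))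
        (.half (.weight (.labF (mateF (predE right))) (.labG (mateG (predE snd))))))
      (.add (table left (mateF (predE right)) fst (mateG (predE snd)))
        (table (succE (mateF (predE right))) (predE right) (succE (mateG (predE snd)))
          (predE snd))))

end Alg

open Alg

section Cell

variable {α : Type u} {M : ℕ} {I : Input α} {μ ν : ℕ → ℕ} {s : State}

/-- The address of a cell of the four-dimensional table with indices up to `Z`. -/
def idx (Z a b c d : ℕ) : ℕ := ((a * (Z + 1) + b) * (Z + 1) + c) * (Z + 1) + d

theorem digit_inj {Z a b c d : ℕ} (hb : b ≤ Z) (hd : d ≤ Z)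
    (h : a * (Z + 1) + b = c * (Z + 1) + d) : a = c ∧ b = d := by
  have h1 := Nat.add_mul_mod_self_right b a (Z + 1)
  have h2 := Nat.add_mul_mod_self_right d c (Z + 1)
  rw [add_comm b, h, add_comm, h2, Nat.mod_eq_of_lt (by omega), Nat.mod_eq_of_lt (by omega)] at h1
  subst h1
  exact ⟨Nat.eq_of_mul_eq_mul_right (show 0 < Z + 1 by omega) (by omega), rfl⟩

theorem idx_inj {Z a b c d a' b' c' d' : ℕ} (hb : b ≤ Z) (hc : c ≤ Z) (hd : d ≤ Z)
    (hb' : b' ≤ Z) (hc' : c' ≤ Z) (hd' : d' ≤ Z) (h : idx Z a b c d = idx Z a' b' c' d') :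
    a = a' ∧ b = b' ∧ c = c' ∧ d = d' := by
  obtain ⟨h, h1⟩ := digit_inj hd hd' h
  obtain ⟨h, h2⟩ := digit_inj hc hc' h
  obtain ⟨h, h3⟩ := digit_inj hb hb' h
  exact ⟨h, h3, h2, h1⟩

theorem digit_lt {Z a b X : ℕ} (ha : a < X) (hb : b ≤ Z) : a * (Z + 1) + b < X * (Z + 1) := by
  have := Nat.mul_le_mul_right (Z + 1) (Nat.succ_le_of_lt ha)
  rw [Nat.succ_eq_add_one, add_mul] at this
  omega

/-- The sizes and the matching of the input are known, and the words are long enough. -/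
structure Ctx (M : ℕ) (I : Input α) (μ ν : ℕ → ℕ) : Prop where
  nestF : IsNest I.F.length μ
  nestG : IsNest I.G.length ν
  leF : ∀ x, μ x ≤ I.F.length
  leG : ∀ x, ν x ≤ I.G.length
  lin : 100 * (I.F.length + I.G.length + 2) ≤ M
  quart : (I.F.length + I.G.length + 1) ^ 4 ≤ M

@[simp] theorem idxE_eval (a b c d : NExp) : (idxE a b c d).eval I s =
    idx (I.F.length + I.G.length) (a.eval I s) (b.eval I s) (c.eval I s) (d.eval I s) := rfl

theorem Ctx.idxE_fits (h : Ctx M I μ ν) {a b c d : NExp} (ha : a.Fits M I s) (hb : b.Fits M I s)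
    (hc : c.Fits M I s) (hd : d.Fits M I s) (ha' : a.eval I s ≤ I.F.length + I.G.length)
    (hb' : b.eval I s ≤ I.F.length + I.G.length) (hc' : c.eval I s ≤ I.F.length + I.G.length)
    (hd' : d.eval I s ≤ I.F.length + I.G.length) : (idxE a b c d).Fits M I s := by
  have h1 := h.lin
  have h2 := h.quart
  have f1 : I.F.length < M := by omega
  have f2 : I.G.length < M := by omega
  simp only [idxE, base, NExp.Fits, NExp.eval]
  generalize I.F.length + I.G.length = Z at *
  have e1 := digit_lt (Nat.lt_succ_of_le ha') hb'
  have e2 := digit_lt e1 hc'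
  have e3 := digit_lt e2 hd'
  rw [Nat.succ_eq_add_one] at e1 e2 e3
  have e4 : (Z + 1) * (Z + 1) * (Z + 1) * (Z + 1) = (Z + 1) ^ 4 := by ring
  have l3 := Nat.le_mul_of_pos_right ((Z + 1) * (Z + 1) * (Z + 1)) (Nat.succ_pos Z)
  have l2 := Nat.le_mul_of_pos_right ((Z + 1) * (Z + 1)) (Nat.succ_pos Z)
  rw [Nat.succ_eq_add_one] at l2 l3
  refine ⟨⟨⟨⟨⟨⟨ha, ⟨⟨?_, ?_, ?_⟩, ?_, ?_⟩, ?_⟩, hb, ?_⟩, ⟨⟨?_, ?_, ?_⟩, ?_, ?_⟩, ?_⟩, hc, ?_⟩,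
    ⟨⟨?_, ?_, ?_⟩, ?_, ?_⟩, ?_⟩, hd, ?_⟩ <;> omega

@[simp] theorem State.setR_setR (x : ℕ) (r r' : ℝ) : (s.setR x r).setR x r' = s.setR x r' := by
  simp [State.setR]

/-- Conditions are evaluated in full, without short-circuiting, so they must fit unconditionally,
whereas `e` only has to fit under `C`. This is why `Ctx` bounds the stored mates at all indices,
even past the end. -/
theorem relax_wp {c : BExp} {e : RExp} {C : Prop} {E r : ℝ} {Q : State → Prop}
    (hc : c.Fits M I (s.setR 2 r)) (hC : c.Holds I (s.setR 2 r) ↔ C)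
    (he : C → e.Fits M I (s.setR 2 r)) (hE : e.eval I (s.setR 2 r) = E)
    (hQ : ∀ v, v ≤ r → (C → v ≤ E) → (v = r ∨ (C ∧ v = E)) → Q (s.setR 2 v)) :
    (relax c e).Wp M I Q (s.setR 2 r) := by
  simp only [relax, Prog.Wp, BExp.Fits, RExp.Fits, BExp.Holds, hC, hE, RExp.eval,
    State.setR_rvar, State.setR_setR, and_true, if_true]
  refine ⟨hc, fun h => ⟨he h, fun h' => ⟨he h, ?_⟩, fun h' => ?_⟩, fun h => ?_⟩
  · exact hQ E h' (fun _ => le_rfl) (Or.inr ⟨h, rfl⟩)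
  · exact hQ r le_rfl (fun _ => (not_le.1 h').le) (Or.inl rfl)
  · exact hQ r le_rfl (fun h'' => (h h'').elim) (Or.inl rfl)

theorem cell_wp {c₁ c₂ c₃ : BExp} {e₁ e₂ e₃ : RExp} {C₁ C₂ C₃ : Prop} {E₀ : ℝ} {k : ℕ}
    {Q : State → Prop} (hi : indelE.Fits M I s) (hI : indelE.eval I s = E₀)
    (hx : ∀ r, (idxE left right fst snd).Fits M I (s.setR 2 r))
    (hX : ∀ r, (idxE left right fst snd).eval I (s.setR 2 r) = k)
    (h₁ : ∀ r, c₁.Fits M I (s.setR 2 r) ∧ (c₁.Holds I (s.setR 2 r) ↔ C₁) ∧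
      (C₁ → e₁.Fits M I (s.setR 2 r)) ∧ e₁.eval I (s.setR 2 r) = e₁.eval I s)
    (h₂ : ∀ r, c₂.Fits M I (s.setR 2 r) ∧ (c₂.Holds I (s.setR 2 r) ↔ C₂) ∧
      (C₂ → e₂.Fits M I (s.setR 2 r)) ∧ e₂.eval I (s.setR 2 r) = e₂.eval I s)
    (h₃ : ∀ r, c₃.Fits M I (s.setR 2 r) ∧ (c₃.Holds I (s.setR 2 r) ↔ C₃) ∧
      (C₃ → e₃.Fits M I (s.setR 2 r)) ∧ e₃.eval I (s.setR 2 r) = e₃.eval I s)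
    (hQ : ∀ v, v ≤ E₀ → (C₁ → v ≤ e₁.eval I s) → (C₂ → v ≤ e₂.eval I s) → (C₃ → v ≤ e₃.eval I s) →
      (v = E₀ ∨ (C₁ ∧ v = e₁.eval I s) ∨ (C₂ ∧ v = e₂.eval I s) ∨ (C₃ ∧ v = e₃.eval I s)) →
      Q ((s.setR 2 v).setRArr 0 k v)) :
    (cell c₁ e₁ c₂ e₂ c₃ e₃).Wp M I Q s := by
  simp only [cell, Prog.Wp]
  refine ⟨hi, ?_⟩
  rw [hI]
  refine relax_wp (h₁ _).1 (h₁ _).2.1 (h₁ _).2.2.1 (h₁ _).2.2.2 fun v₁ a₁ b₁ d₁ => ?_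
  refine relax_wp (h₂ _).1 (h₂ _).2.1 (h₂ _).2.2.1 (h₂ _).2.2.2 fun v₂ a₂ b₂ d₂ => ?_
  refine relax_wp (h₃ _).1 (h₃ _).2.1 (h₃ _).2.2.1 (h₃ _).2.2.2 fun v₃ a₃ b₃ d₃ => ?_
  refine ⟨hx _, trivial, ?_⟩
  rw [hX]
  simp only [RExp.eval, State.setR_rvar, if_true]
  refine hQ v₃ (a₃.trans (a₂.trans a₁)) (fun h => a₃.trans (a₂.trans (b₁ h)))
    (fun h => a₃.trans (b₂ h)) b₃ ?_
  rcases d₃ with rfl | h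
  · rcases d₂ with rfl | h
    · rcases d₁ with rfl | h
      · exact Or.inl rfl
      · exact Or.inr (Or.inl h)
    · exact Or.inr (Or.inr (Or.inl h))
  · exact Or.inr (Or.inr (Or.inr h))

/-- The tables computed in the preprocessing are in memory. -/
structure Env (I : Input α) (μ ν : ℕ → ℕ) (s : State) : Prop where
  mateF : ∀ x, s.narr 0 x = μ x
  mateG : ∀ x, s.narr 1 x = ν x
  del : ∀ x ≤ I.F.length, s.rarr 1 x = delSum I.w I.F x
  ins : ∀ x ≤ I.G.length, s.rarr 2 x = insSum I.w I.G x

/-- The cell of the table contains a correct value. -/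
def CellGood (I : Input α) (μ ν : ℕ → ℕ) (b : ℕ) (s : State) (L R x y : ℕ) : Prop :=
  Sandwich I.w I.F I.G μ ν b L x R y (s.rarr 0 (idx (I.F.length + I.G.length) L R x y))

/-- All cells in the band with given `L` and `R` contain correct values. -/
def RowGood (I : Input α) (μ ν : ℕ → ℕ) (b : ℕ) (s : State) (L R : ℕ) : Prop :=
  L ≤ I.F.length ∧ R ≤ I.F.length ∧
    ∀ x y, x ≤ y → y ≤ I.G.length → Near b L x → Near b R y → CellGood I μ ν b s L R x y

/-- The processed cells of a row before the cell `(x, y)`. -/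
def RowDone (I : Input α) (μ ν : ℕ → ℕ) (b : ℕ) (s : State) (L R x y : ℕ) : Prop :=
  ∀ x' y', x' ≤ y' → y' ≤ I.G.length → Near b L x' → Near b R y' →
    (x < x' ∨ (x' = x ∧ y' < y)) → CellGood I μ ν b s L R x' y'

/-- The effect of computing the cell `(x, y)` of a row. -/
def CellStep (I : Input α) (μ ν : ℕ → ℕ) (b L R x y : ℕ) (s s' : State) : Prop :=
  ∃ v, s' = (s.setR 2 v).setRArr 0 (idx (I.F.length + I.G.length) L R x y) v ∧
    Sandwich I.w I.F I.G μ ν b L x R y v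

/-- The state of the machine before computing the cell `(x, y)` of a row. -/
structure AtCell (I : Input α) (μ ν : ℕ → ℕ) (b L R x y : ℕ) (s : State) : Prop where
  env : Env I μ ν s
  hb : s.nvar 3 = b
  hL : s.nvar 8 = L
  hR : s.nvar 9 = R
  hx : s.nvar 11 = x
  hy : s.nvar 12 = y
  lr : L ≤ R
  rn : R ≤ I.F.length
  xy : x ≤ y
  yn : y ≤ I.G.length
  nearL : Near b L x
  nearR : Near b R y
  done : RowDone I μ ν b s L R x y

theorem leftCell_wp (hC : Ctx M I μ ν) {b L R x y : ℕ}
    (hb : b ≤ 2 * (I.F.length + I.G.length) + 2) (hs : AtCell I μ ν b L R x y s)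
    (hN : L < R → NeedLeft μ (RowGood I μ ν b s) L R) :
    leftCell.Wp M I (CellStep I μ ν b L R x y s) s := by
  obtain ⟨⟨m1, m2, d1, d2⟩, h3, h8, h9, h11, h12, lr, rn, xy, yn, nl, nr, hd⟩ := hs
  have hM := hC.lin
  have hFL := hC.leF L
  have hGx := hC.leG x
  have n1 := nl.1
  have n2 := nl.2
  have n3 := nr.1
  have n4 := nr.2
  refine cell_wp (C₁ := L < R ∧ Near b (L + 1) x) (C₂ := L < R ∧ x < y ∧ Near b L (x + 1))
    (C₃ := L < R ∧ x < y ∧ L < μ L ∧ μ L < R ∧ x < ν x ∧ ν x < y ∧ Near b (μ L) (ν x))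
    (k := (idxE left right fst snd).eval I s) ?_
    (E₀ := indelCost I.w I.F I.G L x R y) ?_ (fun r => ?_) (fun r => rfl)
    (fun r => ⟨?_, ?_, fun hc => ?_, rfl⟩) (fun r => ⟨?_, ?_, fun hc => ?_, rfl⟩)
    (fun r => ⟨?_, ?_, fun hc => ?_, rfl⟩) ?_
  · simp only [indelE, RExp.Fits, NExp.Fits]; omega
  · simp only [indelE, RExp.eval, NExp.eval, h8, h9, h11, h12, d1 R rn, d1 L (by omega), d2 y yn,
      d2 x (by omega), indelCost]
  · refine hC.idxE_fits ?_ ?_ ?_ ?_ ?_ ?_ ?_ ?_ <;>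
      simp only [NExp.Fits, NExp.eval, State.setR_nvar] <;> omega
  · simp only [guarded, nearE, BExp.Fits, NExp.Fits, NExp.eval, State.setR_nvar]
    omega
  · simp only [guarded, nearE, BExp.Holds, NExp.eval, State.setR_nvar, h3, h8, h9, h11, Near]
    omega
  · obtain ⟨hlt, -⟩ := hc
    refine ⟨⟨?_, trivial⟩, hC.idxE_fits ?_ ?_ ?_ ?_ ?_ ?_ ?_ ?_⟩ <;>
      simp only [LExp.Fits, NExp.Fits, NExp.eval, State.setR_nvar] <;> omega
  · simp only [guarded, nearE, BExp.Fits, NExp.Fits, NExp.eval, State.setR_nvar]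
    omega
  · simp only [guarded, nearE, BExp.Holds, NExp.eval, State.setR_nvar, h3, h8, h9, h11, h12, Near]
    omega
  · obtain ⟨hlt, hxy, -⟩ := hc
    refine ⟨⟨trivial, ?_⟩, hC.idxE_fits ?_ ?_ ?_ ?_ ?_ ?_ ?_ ?_⟩ <;>
      simp only [LExp.Fits, NExp.Fits, NExp.eval, State.setR_nvar] <;> omega
  · simp only [guarded, nearE, BExp.Fits, NExp.Fits, NExp.eval, State.setR_nvar,
      State.setR_narr, h8, h11, m1, m2]
    omega
  · simp only [guarded, nearE, BExp.Holds, NExp.eval, State.setR_nvar, State.setR_narr, h3, h8, h9,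
      h11, h12, m1, m2, Near]
    omega
  · obtain ⟨hlt, hxy, q1, q2, q3, q4, -⟩ := hc
    refine ⟨⟨⟨?_, ?_⟩, ?_, ?_⟩, hC.idxE_fits ?_ ?_ ?_ ?_ ?_ ?_ ?_ ?_,
      hC.idxE_fits ?_ ?_ ?_ ?_ ?_ ?_ ?_ ?_⟩ <;>
      simp only [LExp.Fits, NExp.Fits, NExp.eval, State.setR_nvar, State.setR_narr, h8,
        h9, h11, h12, m1, m2] <;> omega
  · intro v g0 g1 g2 g3 g4
    refine ⟨v, by simp [NExp.eval, h8, h9, h11, h12], ?_⟩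
    simp only [RExp.eval, LExp.eval, NExp.eval, idxE_eval, h8, h9, h11, h12, m1,
      m2] at g1 g2 g3 g4
    rcases lr.eq_or_lt with rfl | hlt
    · have : v = indelCost I.w I.F I.G L x L y := by
        rcases g4 with h | ⟨h, -⟩ | ⟨h, -⟩ | ⟨h, -⟩
        · exact h
        all_goals exact absurd h.1 (lt_irrefl _)
      rw [this]
      exact Sandwich.base xy
    · obtain ⟨N1, N2⟩ := hN hlt
      simp only [hlt, true_and] at g1 g2 g3 g4
      refine Sandwich.left hC.nestF hC.nestG hlt rn xy yn (fun hn => ?_) (fun c1 c2 => ?_)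
        (fun c1 c2 c3 c4 c5 => ?_) g0 g1 g2 g3 g4
      · exact N1.2.2 x y xy yn hn nr
      -- A cell of the same row with larger first index: available because `x` runs downwards.
      · exact hd (x + 1) y c1 yn c2 nr (Or.inl (Nat.lt_succ_self x))
      · obtain ⟨N3, N4⟩ := N2 c1 c2
        obtain ⟨c6, c7⟩ := c5
        exact ⟨N3.2.2 (x + 1) (ν x) c3 (by omega) ⟨by omega, by omega⟩ ⟨c6, c7⟩,
          N4.2.2 (ν x + 1) y c4 yn ⟨by omega, by omega⟩ nr⟩

theorem rightCell_wp (hC : Ctx M I μ ν) {b L R x y : ℕ}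
    (hb : b ≤ 2 * (I.F.length + I.G.length) + 2) (hs : AtCell I μ ν b L R x y s)
    (hN : L < R → NeedRight μ (RowGood I μ ν b s) L R) :
    rightCell.Wp M I (CellStep I μ ν b L R x y s) s := by
  obtain ⟨⟨m1, m2, d1, d2⟩, h3, h8, h9, h11, h12, lr, rn, xy, yn, nl, nr, hd⟩ := hs
  have hM := hC.lin
  have hFL := hC.leF (R - 1)
  have hGx := hC.leG (y - 1)
  have n1 := nl.1
  have n2 := nl.2
  have n3 := nr.1
  have n4 := nr.2
  refine cell_wp (C₁ := L < R ∧ Near b (R - 1) y) (C₂ := L < R ∧ x < y ∧ Near b R (y - 1))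
    (C₃ := L < R ∧ x < y ∧ L ≤ μ (R - 1) ∧ μ (R - 1) < R - 1 ∧ x ≤ ν (y - 1) ∧ ν (y - 1) < y - 1 ∧
      Near b (μ (R - 1)) (ν (y - 1)))
    (k := (idxE left right fst snd).eval I s) ?_
    (E₀ := indelCost I.w I.F I.G L x R y) ?_ (fun r => ?_) (fun r => rfl)
    (fun r => ⟨?_, ?_, fun hc => ?_, rfl⟩) (fun r => ⟨?_, ?_, fun hc => ?_, rfl⟩)
    (fun r => ⟨?_, ?_, fun hc => ?_, rfl⟩) ?_
  · simp only [indelE, RExp.Fits, NExp.Fits]; omega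
  · simp only [indelE, RExp.eval, NExp.eval, h8, h9, h11, h12, d1 R rn, d1 L (by omega), d2 y yn,
      d2 x (by omega), indelCost]
  · refine hC.idxE_fits ?_ ?_ ?_ ?_ ?_ ?_ ?_ ?_ <;>
      simp only [NExp.Fits, NExp.eval, State.setR_nvar] <;> omega
  · simp only [guarded, nearE, BExp.Fits, NExp.Fits, NExp.eval, State.setR_nvar]
    omega
  · simp only [guarded, nearE, BExp.Holds, NExp.eval, State.setR_nvar, h3, h8, h9, h12, Near]
    omega
  · obtain ⟨hlt, -⟩ := hc
    refine ⟨⟨?_, trivial⟩, hC.idxE_fits ?_ ?_ ?_ ?_ ?_ ?_ ?_ ?_⟩ <;>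
      simp only [LExp.Fits, NExp.Fits, NExp.eval, State.setR_nvar] <;> omega
  · simp only [guarded, nearE, BExp.Fits, NExp.Fits, NExp.eval, State.setR_nvar]
    omega
  · simp only [guarded, nearE, BExp.Holds, NExp.eval, State.setR_nvar, h3, h8, h9, h11, h12, Near]
    omega
  · obtain ⟨hlt, hxy, -⟩ := hc
    refine ⟨⟨trivial, ?_⟩, hC.idxE_fits ?_ ?_ ?_ ?_ ?_ ?_ ?_ ?_⟩ <;>
      simp only [LExp.Fits, NExp.Fits, NExp.eval, State.setR_nvar] <;> omega
  · simp only [guarded, nearE, BExp.Fits, NExp.Fits, NExp.eval, State.setR_nvar,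
      State.setR_narr, h9, h12, m1, m2]
    omega
  · simp only [guarded, nearE, BExp.Holds, NExp.eval, State.setR_nvar, State.setR_narr, h3, h8, h9,
      h11, h12, m1, m2, Near]
    omega
  · obtain ⟨hlt, hxy, q1, q2, q3, q4, -⟩ := hc
    refine ⟨⟨⟨?_, ?_⟩, ?_, ?_⟩, hC.idxE_fits ?_ ?_ ?_ ?_ ?_ ?_ ?_ ?_,
      hC.idxE_fits ?_ ?_ ?_ ?_ ?_ ?_ ?_ ?_⟩ <;>
      simp only [LExp.Fits, NExp.Fits, NExp.eval, State.setR_nvar, State.setR_narr, h8,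
        h9, h11, h12, m1, m2] <;> omega
  · intro v g0 g1 g2 g3 g4
    refine ⟨v, by simp [NExp.eval, h8, h9, h11, h12], ?_⟩
    simp only [RExp.eval, LExp.eval, NExp.eval, idxE_eval, h8, h9, h11, h12, m1,
      m2] at g1 g2 g3 g4
    rcases lr.eq_or_lt with rfl | hlt
    · have : v = indelCost I.w I.F I.G L x L y := by
        rcases g4 with h | ⟨h, -⟩ | ⟨h, -⟩ | ⟨h, -⟩
        · exact h
        all_goals exact absurd h.1 (lt_irrefl _)
      rw [this]
      exact Sandwich.base xy
    · obtain ⟨N1, N2⟩ := hN hlt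
      simp only [hlt, true_and] at g1 g2 g3 g4
      refine Sandwich.right hC.nestF hC.nestG hlt rn xy yn (fun hn => ?_) (fun c1 c2 => ?_)
        (fun c0 c1 c2 c3 c4 c5 => ?_) g0 g1 g2 g3 g4
      · exact N1.2.2 x y xy yn nl hn
      -- A cell of the same row with smaller second index: available because `y` runs upwards.
      · exact hd x (y - 1) (by omega) (by omega) nl c2 (Or.inr ⟨rfl, by omega⟩)
      · obtain ⟨N3, N4⟩ := N2 c1 c2
        obtain ⟨c6, c7⟩ := c5
        exact ⟨N3.2.2 x (ν (y - 1)) c3 (by omega) nl ⟨c6, c7⟩,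
          N4.2.2 (ν (y - 1) + 1) (y - 1) c4 (by omega) ⟨by omega, by omega⟩
            ⟨by omega, by omega⟩⟩

end Cell

end TED

namespace TED

/-! ## One row of the dynamic program -/

namespace Alg

/-- Truncated subtraction expresses minimum and maximum without branching. -/
abbrev minE (a b : NExp) : NExp := .sub a (.sub a b)
abbrev maxE (a b : NExp) : NExp := .add a (.sub b a)

def rowInner (c : Prog) : Prog :=
  .loop (.and (.ltN snd (succE .lenG)) (.ltN snd (succE (.add right band))))
    (.seq c (.setN 12 (succE snd)))

/-- Compute all cells in the band for the substring of `F` that is given by the variables `8`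
and `9`. -/
def row (c : Prog) : Prog :=
  .seq (.setN 10 (succE (minE .lenG (.add left band))))
    (.loop (.ltN (.sub left band) (.var 10))
      (.seq (.setN 11 (predE (.var 10)))
        (.seq (.setN 12 (maxE fst (.sub right band)))
          (.seq (rowInner c) (.setN 10 fst)))))

end Alg

open Alg

section Row

variable {α : Type u} {M : ℕ} {I : Input α} {μ ν : ℕ → ℕ} {s s' s'' s₀ : State}

theorem Prog.Wp.mono {P : Prog} {Q Q' : State → Prop} (h : P.Wp M I Q s)
    (hQ : ∀ s', Q s' → Q' s') : P.Wp M I Q' s := by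
  induction P generalizing s Q Q' with
  | skip => exact hQ _ h
  | setN x e => exact ⟨h.1, hQ _ h.2⟩
  | setNArr a i e => exact ⟨h.1, h.2.1, hQ _ h.2.2⟩
  | setR x e => exact ⟨h.1, hQ _ h.2⟩
  | setRArr a i e => exact ⟨h.1, h.2.1, hQ _ h.2.2⟩
  | seq P P' ih ih' => exact ih h fun s' h' => ih' h' hQ
  | ite b P P' ih ih' => exact ⟨h.1, fun hb => ih (h.2.1 hb) hQ, fun hb => ih' (h.2.2 hb) hQ⟩
  | loop b P => exact h.elim

/-- Only the table and the variables that do not satisfy `keep` may differ. -/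
structure Frame (keep : ℕ → Prop) (s s' : State) : Prop where
  narr : s'.narr = s.narr
  rarr : ∀ a, a ≠ 0 → s'.rarr a = s.rarr a
  rvar : s'.rvar 1 = s.rvar 1
  nvar : ∀ z, keep z → s'.nvar z = s.nvar z

variable {keep keep' : ℕ → Prop}

theorem Frame.refl (s : State) : Frame keep s s := ⟨rfl, fun _ _ => rfl, rfl, fun _ _ => rfl⟩

theorem Frame.trans (h : Frame keep s s') (h' : Frame keep s' s'') : Frame keep s s'' :=
  ⟨h'.narr.trans h.narr, fun a ha => (h'.rarr a ha).trans (h.rarr a ha), h'.rvar.trans h.rvar,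
    fun z hz => (h'.nvar z hz).trans (h.nvar z hz)⟩

theorem Frame.mono (h : Frame keep s s') (hk : ∀ z, keep' z → keep z) : Frame keep' s s' :=
  ⟨h.narr, h.rarr, h.rvar, fun z hz => h.nvar z (hk z hz)⟩

theorem Frame.setN (h : Frame keep s s') {x v : ℕ} (hx : ¬ keep x) :
    Frame keep s (s'.setN x v) :=
  ⟨h.narr, h.rarr, h.rvar, fun z hz => by
    have hne : z ≠ x := by rintro rfl; exact hx hz
    rw [State.setN_nvar, if_neg hne, h.nvar z hz]⟩

theorem Frame.env (h : Frame keep s s') (hs : Env I μ ν s) : Env I μ ν s' :=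
  ⟨by simpa [h.narr] using hs.mateF, by simpa [h.narr] using hs.mateG,
    by simpa [h.rarr 1 (by omega)] using hs.del, by simpa [h.rarr 2 (by omega)] using hs.ins⟩

/-- Correct rows stay correct. -/
def Keeps (I : Input α) (μ ν : ℕ → ℕ) (b : ℕ) (s s' : State) : Prop :=
  ∀ L R, RowGood I μ ν b s L R → RowGood I μ ν b s' L R

theorem CellStep.frame {b L R x y : ℕ} (h : CellStep I μ ν b L R x y s s') :
    Frame (fun _ => True) s s' := by
  obtain ⟨v, rfl, -⟩ := h
  refine ⟨rfl, fun a ha => ?_, by simp, fun _ _ => rfl⟩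
  funext j
  simp [ha]

/-- Addresses are injective within the index range, and a cell that is overwritten receives another
correct value. Rows may therefore be recomputed at will. -/
theorem CellStep.cellGood {b L R x y L' R' x' y' : ℕ} (h : CellStep I μ ν b L R x y s s')
    (hR : R ≤ I.F.length) (hx : x ≤ I.G.length) (hy : y ≤ I.G.length)
    (hR' : R' ≤ I.F.length) (hx' : x' ≤ I.G.length) (hy' : y' ≤ I.G.length)
    (hg : CellGood I μ ν b s L' R' x' y') : CellGood I μ ν b s' L' R' x' y' := by
  obtain ⟨v, rfl, hv⟩ := h
  unfold CellGood at hg ⊢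
  by_cases he : idx (I.F.length + I.G.length) L' R' x' y' = idx (I.F.length + I.G.length) L R x y
  · obtain ⟨rfl, rfl, rfl, rfl⟩ := idx_inj (by omega) (by omega) (by omega) (by omega) (by omega)
      (by omega) he
    simpa using hv
  · simpa [he] using hg

theorem CellStep.keeps {b L R x y : ℕ} (h : CellStep I μ ν b L R x y s s')
    (hR : R ≤ I.F.length) (hx : x ≤ I.G.length) (hy : y ≤ I.G.length) : Keeps I μ ν b s s' :=
  fun _ _ hg => ⟨hg.1, hg.2.1, fun x' y' h1 h2 h3 h4 =>
    h.cellGood hR hx hy hg.2.1 (h1.trans h2) h2 (hg.2.2 x' y' h1 h2 h3 h4)⟩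

theorem CellStep.self {b L R x y : ℕ} (h : CellStep I μ ν b L R x y s s') :
    CellGood I μ ν b s' L R x y := by
  obtain ⟨v, rfl, hv⟩ := h
  simpa [CellGood] using hv

/-- The variables that are not changed by `row`. -/
def RowKeep (z : ℕ) : Prop := z ≤ 9 ∨ 13 ≤ z

theorem rowInner_run (hC : Ctx M I μ ν) {b L R x : ℕ}
    (hb : b ≤ 2 * (I.F.length + I.G.length) + 2) {c : Prog}
    (he : Env I μ ν s₀) (h3 : s₀.nvar 3 = b) (h8 : s₀.nvar 8 = L) (h9 : s₀.nvar 9 = R)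
    (lr : L ≤ R) (rn : R ≤ I.F.length)
    (hc : ∀ s x y, AtCell I μ ν b L R x y s → Keeps I μ ν b s₀ s →
      c.Wp M I (CellStep I μ ν b L R x y s) s)
    (hf : Frame RowKeep s₀ s) (hk : Keeps I μ ν b s₀ s) (hx : s.nvar 11 = x)
    (hy : s.nvar 12 = x + (R - b - x)) (xn : x ≤ I.G.length) (nx : Near b L x)
    (hd : RowDone I μ ν b s L R x (x + (R - b - x))) :
    Run M I (rowInner c) s ((2 * b + 1) * (c.maxTime + 20) + 20) fun s' =>
      Frame RowKeep s₀ s' ∧ Keeps I μ ν b s₀ s' ∧ s'.nvar 11 = x ∧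
      RowDone I μ ν b s' L R x (I.G.length + 1) := by
  have hM := hC.lin
  have k3 : ∀ {s}, Frame RowKeep s₀ s → s.nvar 3 = b := fun h =>
    (h.nvar 3 (Or.inl (by omega))).trans h3
  have k8 : ∀ {s}, Frame RowKeep s₀ s → s.nvar 8 = L := fun h =>
    (h.nvar 8 (Or.inl (by omega))).trans h8
  have k9 : ∀ {s}, Frame RowKeep s₀ s → s.nvar 9 = R := fun h =>
    (h.nvar 9 (Or.inl (by omega))).trans h9
  -- The start max(x, R - b) may exceed |G|, and then the loop is idle; the alternative `s.nvar 12 ≤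
  -- R` keeps the word bounded in that case.
  refine (Run.loop (fun s => Frame RowKeep s₀ s ∧ Keeps I μ ν b s₀ s ∧ s.nvar 11 = x ∧
      x ≤ s.nvar 12 ∧ R ≤ s.nvar 12 + b ∧ (s.nvar 12 ≤ I.G.length + 1 ∨ s.nvar 12 ≤ R) ∧
      RowDone I μ ν b s L R x (s.nvar 12))
    (fun s => (R + b + 1 - s.nvar 12) * (c.maxTime + 20)) ?_ ?_
    ⟨hf, hk, hx, by omega, by omega, by omega, by rwa [hy]⟩).mono ?_ ?_
  · rintro s ⟨hf, hk, hx, a1, a2, a3, hd⟩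
    simp only [BExp.Fits, NExp.Fits, NExp.eval, k3 hf, k9 hf]
    omega
  · rintro s ⟨hf, hk, hx, a1, a2, a3, hd⟩ ⟨g1, g2⟩
    simp only [BExp.Holds, NExp.eval, k3 hf, k9 hf] at g1 g2
    refine ⟨_, Run.of_wp (P := .seq c (.setN 12 (succE snd))) (Prog.Wp.mono (P := c)
      (Q' := Prog.Wp M I (.setN 12 (succE snd)) _)
      (hc s x (s.nvar 12) ⟨hf.env he, k3 hf, k8 hf, k9 hf, hx, rfl,
      lr, rn, a1, by omega, nx, ⟨by omega, by omega⟩, hd⟩ hk) fun s' hs' => ?_)⟩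
    have hf' : Frame RowKeep s₀ s' := hf.trans (hs'.frame.mono fun _ _ => trivial)
    have e12 : s'.nvar 12 = s.nvar 12 := hs'.frame.nvar 12 trivial
    have e11 : s'.nvar 11 = s.nvar 11 := hs'.frame.nvar 11 trivial
    refine ⟨by simp only [NExp.Fits, NExp.eval]; omega, ⟨hf'.setN (by unfold RowKeep; omega),
      fun a d h => hs'.keeps rn xn (by omega) a d (hk a d h), by simp [e11, hx], ?_, ?_, ?_, ?_⟩,
      ?_⟩
    · simp only [NExp.eval, State.setN_nvar, if_true]; omega
    · simp only [NExp.eval, State.setN_nvar, if_true]; omega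
    · simp only [NExp.eval, State.setN_nvar, if_true]; omega
    · intro x' y' b1 b2 b3 b4 b5
      simp only [NExp.eval, State.setN_nvar, if_true] at b5
      by_cases hcell : x' = x ∧ y' = s.nvar 12
      · rw [hcell.1, hcell.2]; exact hs'.self
      · exact hs'.cellGood rn xn (by omega) rn (by omega) b2 (hd x' y' b1 b2 b3 b4 (by omega))
    · obtain ⟨d, hd⟩ : ∃ d, R + b + 1 - s.nvar 12 = d + 1 := ⟨R + b - s.nvar 12, by omega⟩
      simp only [NExp.eval, State.setN_nvar, if_true, e12, Prog.maxTime, BExp.time, NExp.time]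
      rw [show R + b + 1 - (s.nvar 12 + 1) = d by omega, hd,
        Nat.succ_mul d]
      omega
  · have : (R + b + 1 - s.nvar 12) * (c.maxTime + 20) ≤ (2 * b + 1) * (c.maxTime + 20) :=
      Nat.mul_le_mul_right _ (by omega)
    simp only [BExp.time, NExp.time]
    omega
  · rintro s' ⟨⟨hf, hk, hx, a1, a2, a3, hd⟩, hg⟩
    refine ⟨hf, hk, hx, fun x' y' b1 b2 b3 b4 b5 => hd x' y' b1 b2 b3 b4 ?_⟩
    simp only [BExp.Holds, NExp.eval, k3 hf, k9 hf] at hg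
    have := b4.2
    omega

/-- A bound for the running time of `row` with band width `b` if a cell takes time at most `T`. -/
def rowTime (T b : ℕ) : ℕ := (2 * b + 1) * ((2 * b + 1) * (T + 20) + 60) + 20

/-- The order, `x` downwards and `y` upwards, serves both kinds of cells. Variable 10 holds `x + 1`,
so that the descending loop can include `x = 0`. Each index takes at most `2 * b + 1` values. -/
theorem row_run (hC : Ctx M I μ ν) {b L R : ℕ}
    (hb : b ≤ 2 * (I.F.length + I.G.length) + 2) {c : Prog}
    (he : Env I μ ν s₀) (h3 : s₀.nvar 3 = b) (h8 : s₀.nvar 8 = L) (h9 : s₀.nvar 9 = R)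
    (lr : L ≤ R) (rn : R ≤ I.F.length)
    (hc : ∀ s x y, AtCell I μ ν b L R x y s → Keeps I μ ν b s₀ s →
      c.Wp M I (CellStep I μ ν b L R x y s) s) :
    Run M I (row c) s₀ (rowTime c.maxTime b) fun s' =>
      Frame RowKeep s₀ s' ∧ Keeps I μ ν b s₀ s' ∧ RowGood I μ ν b s' L R := by
  have hM := hC.lin
  have k3 : ∀ {s}, Frame RowKeep s₀ s → s.nvar 3 = b := fun h =>
    (h.nvar 3 (Or.inl (by omega))).trans h3
  have k8 : ∀ {s}, Frame RowKeep s₀ s → s.nvar 8 = L := fun h =>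
    (h.nvar 8 (Or.inl (by omega))).trans h8
  have k9 : ∀ {s}, Frame RowKeep s₀ s → s.nvar 9 = R := fun h =>
    (h.nvar 9 (Or.inl (by omega))).trans h9
  set TI := (2 * b + 1) * (c.maxTime + 20) + 20 with hTI
  refine (Run.seq (T' := (2 * b + 1) * (TI + 40) + 6)
    ((Run.of_wp (P := .setN 10 _) ⟨?_, ?_⟩).mono le_rfl fun s h => h)).mono ?_ fun s h => h
  · simp only [NExp.Fits, NExp.eval]; omega
  · simp only [NExp.eval, h3, h8]
    refine (Run.loop (fun s => Frame RowKeep s₀ s ∧ Keeps I μ ν b s₀ s ∧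
        s.nvar 10 ≤ L + b + 1 ∧ s.nvar 10 ≤ I.G.length + 1 ∧
        ∀ x y, x ≤ y → y ≤ I.G.length → Near b L x → Near b R y → s.nvar 10 ≤ x →
          CellGood I μ ν b s L R x y)
      (fun s => (s.nvar 10 - (L - b)) * (TI + 40)) ?_ ?_ ⟨?_, ?_, ?_, ?_, ?_⟩).mono ?_ ?_
    · rintro s ⟨hf, hk, a1, a2, hd⟩
      simp only [BExp.Fits, NExp.Fits, k3 hf, k8 hf]
      omega
    · rintro s ⟨hf, hk, a1, a2, hd⟩ hg
      simp only [BExp.Holds, NExp.eval, k3 hf, k8 hf] at hg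
      refine ⟨_, Run.seq (Run.of_wp (P := .setN 11 _) ⟨?_, Run.seq (Run.of_wp (P := .setN 12 _) ⟨?_,
        Run.seq ((rowInner_run (x := s.nvar 10 - 1) hC hb he h3 h8 h9 lr rn hc
          ?_ ?_ ?_ ?_ ?_ ?_ ?_).mono
          le_rfl fun s' hs' => Run.of_wp (P := .setN 10 _) ⟨?_, ?_⟩)⟩)⟩)⟩
      · simp only [NExp.Fits]; omega
      · simp only [NExp.Fits, NExp.eval, State.setN_nvar]
        simp [k3 hf, k9 hf]
        omega
      · exact (hf.setN (by unfold RowKeep; omega)).setN (by unfold RowKeep; omega)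
      · exact hk
      · simp [NExp.eval]
      · simp [NExp.eval, k3 hf, k9 hf]
      · omega
      · exact ⟨by omega, by omega⟩
      · intro x y b1 b2 b3 b4 b5
        have := b4.1
        exact hd x y b1 b2 b3 b4 (by omega)
      · simp only [NExp.Fits]
        have := hs'.2.2.1
        omega
      · obtain ⟨hf', hk', hx', hd'⟩ := hs'
        refine ⟨⟨hf'.setN (by unfold RowKeep; omega), hk', ?_, ?_, fun x y b1 b2 b3 b4 b5 => ?_⟩,
          ?_⟩
        · simp [NExp.eval, hx']; omega
        · simp [NExp.eval, hx']; omega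
        · simp only [NExp.eval, State.setN_nvar, if_true, hx'] at b5
          exact hd' x y b1 b2 b3 b4 (by omega)
        · simp only [NExp.eval, State.setN_nvar, if_true, hx', Prog.maxTime, BExp.time, NExp.time]
          obtain ⟨d, hd⟩ : ∃ d, s.nvar 10 - (L - b) = d + 1 := ⟨s.nvar 10 - (L - b) - 1, by omega⟩
          rw [show s.nvar 10 - 1 - (L - b) = d by omega, hd, Nat.succ_mul d]
          omega
    · exact (Frame.refl s₀).setN (by unfold RowKeep; omega)
    · exact fun _ _ h => h
    · simp; omega
    · simp
    · intro x y b1 b2 b3 b4 b5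
      simp only [State.setN_nvar, if_true] at b5
      have := b3.2
      omega
    · simp only [State.setN_nvar, if_true, BExp.time, NExp.time]
      have : (I.G.length - (I.G.length - (L + b)) + 1 - (L - b)) * (TI + 40) ≤
          (2 * b + 1) * (TI + 40) := Nat.mul_le_mul_right _ (by omega)
      omega
    · rintro s' ⟨⟨hf, hk, a1, a2, hd⟩, hg⟩
      refine ⟨hf, hk, by omega, rn, fun x y b1 b2 b3 b4 => hd x y b1 b2 b3 b4 ?_⟩
      simp only [BExp.Holds, NExp.eval, k3 hf, k8 hf] at hg
      have := b3.1
      omega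
  · simp only [Prog.maxTime, NExp.time, rowTime]
    rw [show TI + 40 = (2 * b + 1) * (c.maxTime + 20) + 60 by omega]
    omega

theorem NeedLeft.mono {μ : ℕ → ℕ} {Good Good' : ℕ → ℕ → Prop} {L R : ℕ}
    (h : NeedLeft μ Good L R) (hG : ∀ a b, Good a b → Good' a b) : NeedLeft μ Good' L R :=
  ⟨hG _ _ h.1, fun a b => ⟨hG _ _ (h.2 a b).1, hG _ _ (h.2 a b).2⟩⟩

theorem NeedRight.mono {μ : ℕ → ℕ} {Good Good' : ℕ → ℕ → Prop} {L R : ℕ}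
    (h : NeedRight μ Good L R) (hG : ∀ a b, Good a b → Good' a b) : NeedRight μ Good' L R :=
  ⟨hG _ _ h.1, fun a b => ⟨hG _ _ (h.2 a b).1, hG _ _ (h.2 a b).2⟩⟩

/-- A bound for the running time of computing a row with band width `b`. -/
def anyRowTime (b : ℕ) : ℕ := rowTime (leftCell.maxTime + rightCell.maxTime) b

theorem rowTime_mono {T T' : ℕ} (h : T ≤ T') (b : ℕ) : rowTime T b ≤ rowTime T' b := by
  unfold rowTime; gcongr

theorem row_left (hC : Ctx M I μ ν) {b L R : ℕ}
    (hb : b ≤ 2 * (I.F.length + I.G.length) + 2)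
    (he : Env I μ ν s) (h3 : s.nvar 3 = b) (h8 : s.nvar 8 = L) (h9 : s.nvar 9 = R)
    (lr : L ≤ R) (rn : R ≤ I.F.length) (hN : L < R → NeedLeft μ (RowGood I μ ν b s) L R) :
    Run M I (row leftCell) s (anyRowTime b) fun s' =>
      Frame RowKeep s s' ∧ Keeps I μ ν b s s' ∧ RowGood I μ ν b s' L R :=
  (row_run hC hb he h3 h8 h9 lr rn fun _ _ _ ha hk =>
    leftCell_wp hC hb ha fun h => (hN h).mono hk).mono
      (rowTime_mono (Nat.le_add_right _ _) b) fun _ => id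

theorem row_right (hC : Ctx M I μ ν) {b L R : ℕ}
    (hb : b ≤ 2 * (I.F.length + I.G.length) + 2)
    (he : Env I μ ν s) (h3 : s.nvar 3 = b) (h8 : s.nvar 8 = L) (h9 : s.nvar 9 = R)
    (lr : L ≤ R) (rn : R ≤ I.F.length) (hN : L < R → NeedRight μ (RowGood I μ ν b s) L R) :
    Run M I (row rightCell) s (anyRowTime b) fun s' =>
      Frame RowKeep s s' ∧ Keeps I μ ν b s s' ∧ RowGood I μ ν b s' L R :=
  (row_run hC hb he h3 h8 h9 lr rn fun _ _ _ ha hk =>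
    rightCell_wp hC hb ha fun h => (hN h).mono hk).mono
      (rowTime_mono (Nat.le_add_left _ _) b) fun _ => id

end Row

end TED

namespace TED

/-! ## One round of the dynamic program -/

namespace Alg

abbrev scale : NExp := .var 4
abbrev pivot : NExp := .var 5
abbrev lower : NExp := .var 6
abbrev upper : NExp := .var 7

def canRight : BExp := .and (.ltN right upper) (.not (.ltN (mateF right) left))
def canLeft : BExp := .and (.ltN lower left) (.ltN (mateF (predE left)) right)
def canBoth : BExp := .and (.ltN right upper) (.ltN lower left)

def goRight : Prog := .seq (.setN 9 (succE right)) (row rightCell)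
def goLeft : Prog := .seq (.setN 8 (predE left)) (row leftCell)

/-- The third branch runs only when F[L - 1] and F[R] are mates. Going right first is essential:
that step needs no split, and it supplies the row for the step to the left. -/
def chainStep : Prog :=
  .ite canRight goRight (.ite canLeft goLeft (.ite canBoth (.seq goRight goLeft)
    (.setN 13 (.const 0))))

/-- Compute the rows of the substrings around the pivot. -/
def chain : Prog :=
  .seq (.setN 6 (.sub (succE pivot) scale))
    (.seq (.setN 7 (minE .lenF (predE (.add pivot scale))))
      (.seq (.setN 8 pivot) (.seq (.setN 9 pivot) (.seq (row leftCell)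
        (.seq (.setN 13 (.const 1)) (.loop (.eqN (.var 13) (.const 1)) chainStep))))))

/-- Process all pivots of a given scale. -/
def level : Prog :=
  .seq (.setN 5 (.const 0)) (.loop (.ltN pivot (succE .lenF))
    (.seq chain (.setN 5 (.add pivot scale))))

/-- Compute all rows that are needed for a given band width. -/
def round : Prog :=
  .seq (.setN 4 (.const 1)) (.loop (.ltN scale (.add (.add .lenF .lenF) (.const 2)))
    (.seq level (.setN 4 (.add scale scale))))

end Alg

open Alg

section Round

variable {α : Type u} {M : ℕ} {I : Input α} {μ ν : ℕ → ℕ} {s s' s'' s₀ : State}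

theorem Run.iteTrue {b : BExp} {P P' : Prog} {T : ℕ} {Q : State → Prop} (hf : b.Fits M I s)
    (hb : b.Holds I s) (h : Run M I P s T Q) : Run M I (.ite b P P') s (b.time + 1 + T) Q := by
  obtain ⟨s', t, a, c, d⟩ := h
  exact ⟨s', _, .iteTrue hf hb a, by omega, d⟩

theorem Run.iteFalse {b : BExp} {P P' : Prog} {T : ℕ} {Q : State → Prop} (hf : b.Fits M I s)
    (hb : ¬ b.Holds I s) (h : Run M I P' s T Q) : Run M I (.ite b P P') s (b.time + 1 + T) Q := by
  obtain ⟨s', t, a, c, d⟩ := h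
  exact ⟨s', _, .iteFalse hf hb a, by omega, d⟩

theorem Run.setN_seq {x : ℕ} {e : NExp} {P : Prog} {T : ℕ} {Q : State → Prop}
    (hf : e.Fits M I s) (h : Run M I P (s.setN x (e.eval I s)) T Q) :
    Run M I (.seq (.setN x e) P) s (e.time + 1 + T) Q :=
  Run.seq (Run.of_wp (P := .setN x e) ⟨hf, h⟩)

theorem Keeps.trans {b : ℕ} (h : Keeps I μ ν b s s') (h' : Keeps I μ ν b s' s'') :
    Keeps I μ ν b s s'' := fun _ _ hg => h' _ _ (h _ _ hg)

theorem goRight_run (hC : Ctx M I μ ν) {b : ℕ} (hb : b ≤ 2 * (I.F.length + I.G.length) + 2)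
    (he : Env I μ ν s) (h3 : s.nvar 3 = b) (lr : s.nvar 8 ≤ s.nvar 9 + 1)
    (rn : s.nvar 9 + 1 ≤ I.F.length)
    (hN : NeedRight μ (RowGood I μ ν b s) (s.nvar 8) (s.nvar 9 + 1)) :
    Run M I goRight s (anyRowTime b + 4) fun s' =>
      Frame (fun z => RowKeep z ∧ z ≠ 9) s s' ∧ s'.nvar 9 = s.nvar 9 + 1 ∧ Keeps I μ ν b s s' ∧
        RowGood I μ ν b s' (s.nvar 8) (s.nvar 9 + 1) := by
  have hM := hC.lin
  refine (Run.setN_seq ?_ (row_right hC hb (s := s.setN 9 (s.nvar 9 + 1))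
    (L := s.nvar 8) (R := s.nvar 9 + 1) ?_ ?_ ?_ ?_ lr rn fun _ => hN)).mono
    (by simp only [NExp.time]; omega) ?_
  · simp only [NExp.Fits, NExp.eval]; omega
  · exact ⟨he.mateF, he.mateG, he.del, he.ins⟩
  · simpa using h3
  · simp
  · simp
  · rintro s' ⟨hf, hk, hg⟩
    exact ⟨((Frame.refl s).setN (by simp)).trans (hf.mono fun z hz => hz.1),
      by rw [hf.nvar 9 (Or.inl le_rfl)]; simp, hk, hg⟩

theorem goLeft_run (hC : Ctx M I μ ν) {b : ℕ} (hb : b ≤ 2 * (I.F.length + I.G.length) + 2)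
    (he : Env I μ ν s) (h3 : s.nvar 3 = b) (lr : s.nvar 8 ≤ s.nvar 9)
    (rn : s.nvar 9 ≤ I.F.length)
    (hN : NeedLeft μ (RowGood I μ ν b s) (s.nvar 8 - 1) (s.nvar 9)) :
    Run M I goLeft s (anyRowTime b + 4) fun s' =>
      Frame (fun z => RowKeep z ∧ z ≠ 8) s s' ∧ s'.nvar 8 = s.nvar 8 - 1 ∧ Keeps I μ ν b s s' ∧
        RowGood I μ ν b s' (s.nvar 8 - 1) (s.nvar 9) := by
  have hM := hC.lin
  refine (Run.setN_seq ?_ (row_left hC hb (s := s.setN 8 (s.nvar 8 - 1))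
    (L := s.nvar 8 - 1) (R := s.nvar 9) ?_ ?_ ?_ ?_ (by omega) rn fun _ => hN)).mono
    (by simp only [NExp.time]; omega) ?_
  · simp only [NExp.Fits]; omega
  · exact ⟨he.mateF, he.mateG, he.del, he.ins⟩
  · simpa using h3
  · simp
  · simp
  · rintro s' ⟨hf, hk, hg⟩
    exact ⟨((Frame.refl s).setN (by simp)).trans (hf.mono fun z hz => hz.1),
      by rw [hf.nvar 8 (Or.inl (by omega))]; simp, hk, hg⟩

/-- The variables that are not changed by `chain`. -/
def ChainKeep (z : ℕ) : Prop := z ≤ 5 ∨ 14 ≤ z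

/-- The state during the chain of substrings around the pivot `p`. -/
structure AtChain (I : Input α) (μ ν : ℕ → ℕ) (b p lo hi : ℕ) (s₀ s : State) : Prop where
  frame : Frame ChainKeep s₀ s
  keeps : Keeps I μ ν b s₀ s
  hlo : s.nvar 6 = lo
  hhi : s.nvar 7 = hi
  go : s.nvar 13 ≤ 1
  inv : ChainInv I.F.length μ (RowGood I μ ν b s) p lo hi (s.nvar 8) (s.nvar 9)
  halted : s.nvar 13 = 0 → ¬ (s.nvar 9 < hi ∧ ¬ μ (s.nvar 9) < s.nvar 8) ∧
    ¬ (lo < s.nvar 8 ∧ μ (s.nvar 8 - 1) < s.nvar 9) ∧ ¬ (s.nvar 9 < hi ∧ lo < s.nvar 8)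

/-- Each row lengthens the substring within the window, so the number of remaining rows is at most
the slack `hi - lo - (R - L)`. -/
theorem chainLoop_run (hC : Ctx M I μ ν) {b p lo hi : ℕ}
    (hb : b ≤ 2 * (I.F.length + I.G.length) + 2) (he : Env I μ ν s₀) (h3 : s₀.nvar 3 = b)
    (hN : hi ≤ I.F.length) (hl : LightGood I.F.length μ (RowGood I μ ν b s₀) p lo hi)
    (hd : lo < p → p < hi → ∀ x ≤ I.F.length, RowGood I μ ν b s₀ x x)
    (hs : AtChain I μ ν b p lo hi s₀ s) :
    Run M I (.loop (.eqN (.var 13) (.const 1)) chainStep) s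
      ((hi - lo - (s.nvar 9 - s.nvar 8)) * (anyRowTime b + 100) + 104) fun s' =>
      AtChain I μ ν b p lo hi s₀ s' ∧ s'.nvar 13 = 0 := by
  have hM := hC.lin
  have hμ := hC.nestF
  refine (Run.loop (AtChain I μ ν b p lo hi s₀)
    -- The last summand pays for the one iteration that clears the flag in variable 13.
    (fun s => (hi - lo - (s.nvar 9 - s.nvar 8)) * (anyRowTime b + 100) + s.nvar 13 * 100)
    ?_ ?_ hs).mono ?_ ?_
  · intro s hs
    have := hs.go
    simp only [BExp.Fits, NExp.Fits]; omega
  · intro s hs hg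
    simp only [BExp.Holds, NExp.eval] at hg
    obtain ⟨hf, hk, hlo, hhi, -, hinv, -⟩ := hs
    have hls : LightGood I.F.length μ (RowGood I μ ν b s) p lo hi :=
      fun l a1 a2 a3 a4 a5 => hk _ _ (hl l a1 a2 a3 a4 a5)
    have i1 := hinv.lo_le
    have i2 := hinv.le_p
    have i3 := hinv.p_le
    have i4 := hinv.le_hi
    have e3 : s.nvar 3 = b := (hf.nvar 3 (Or.inl (by omega))).trans h3
    have henv := hf.env he
    have f1 := hC.leF (s.nvar 9)
    have f2 := hC.leF (s.nvar 8 - 1)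
    have fr : canRight.Fits M I s := by
      simp only [canRight, BExp.Fits, NExp.Fits, NExp.eval, henv.mateF]; omega
    have fl : canLeft.Fits M I s := by
      simp only [canLeft, BExp.Fits, NExp.Fits, NExp.eval, henv.mateF]; omega
    have fb : canBoth.Fits M I s := by
      simp only [canBoth, BExp.Fits, NExp.Fits]; omega
    have hr : canRight.Holds I s ↔ (s.nvar 9 < hi ∧ ¬ μ (s.nvar 9) < s.nvar 8) := by
      simp only [canRight, BExp.Holds, NExp.eval, henv.mateF, hhi]
    have hl' : canLeft.Holds I s ↔ (lo < s.nvar 8 ∧ μ (s.nvar 8 - 1) < s.nvar 9) := by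
      simp only [canLeft, BExp.Holds, NExp.eval, henv.mateF, hlo]
    have hbt : canBoth.Holds I s ↔ (s.nvar 9 < hi ∧ lo < s.nvar 8) := by
      simp only [canBoth, BExp.Holds, NExp.eval, hlo, hhi]
    by_cases c1 : s.nvar 9 < hi ∧ ¬ μ (s.nvar 9) < s.nvar 8
    · refine ⟨_, Run.iteTrue fr (hr.2 c1) ((goRight_run hC hb henv e3 (by omega) (by omega)
        (hinv.need_right hμ hN hls c1.1 c1.2)).mono le_rfl ?_)⟩
      rintro s' ⟨hf', h9, hk', hg'⟩
      have e6 := hf'.nvar 6 ⟨Or.inl (by omega), by omega⟩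
      have e7 := hf'.nvar 7 ⟨Or.inl (by omega), by omega⟩
      have e8 := hf'.nvar 8 ⟨Or.inl (by omega), by omega⟩
      have e13 := hf'.nvar 13 ⟨Or.inr (by omega), by omega⟩
      refine ⟨⟨hf.trans (hf'.mono ?_), hk.trans hk', by omega, by omega, by omega, ?_,
        fun h => by omega⟩, ?_⟩
      · unfold ChainKeep RowKeep; intro z; omega
      · rw [e8, h9]
        exact hinv.right c1.1 c1.2 hμ hk' hg'
      · simp only [e8, h9, e13, hg, BExp.time, NExp.time, canRight]
        obtain ⟨d, hd⟩ : ∃ d, hi - lo - (s.nvar 9 - s.nvar 8) = d + 1 :=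
          ⟨hi - lo - (s.nvar 9 - s.nvar 8) - 1, by omega⟩
        rw [show hi - lo - (s.nvar 9 + 1 - s.nvar 8) = d by omega, hd, Nat.succ_mul d]
        omega
    by_cases c2 : lo < s.nvar 8 ∧ μ (s.nvar 8 - 1) < s.nvar 9
    · refine ⟨_, Run.iteFalse fr (fun h => c1 (hr.1 h)) (Run.iteTrue fl (hl'.2 c2)
        ((goLeft_run hC hb henv e3 (by omega) (by omega)
        (hinv.need_left hμ hN hls c1 c2.1 c2.2)).mono le_rfl ?_))⟩
      rintro s' ⟨hf', h8, hk', hg'⟩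
      have e6 := hf'.nvar 6 ⟨Or.inl (by omega), by omega⟩
      have e7 := hf'.nvar 7 ⟨Or.inl (by omega), by omega⟩
      have e9 := hf'.nvar 9 ⟨Or.inl (by omega), by omega⟩
      have e13 := hf'.nvar 13 ⟨Or.inr (by omega), by omega⟩
      refine ⟨⟨hf.trans (hf'.mono ?_), hk.trans hk', by omega, by omega, by omega, ?_,
        fun h => by omega⟩, ?_⟩
      · unfold ChainKeep RowKeep; intro z; omega
      · rw [e9, h8]
        exact hinv.left hμ hN c1 c2.1 c2.2 hk' hg'
      · simp only [e9, h8, e13, hg, BExp.time, NExp.time, canRight, canLeft]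
        obtain ⟨d, hd⟩ : ∃ d, hi - lo - (s.nvar 9 - s.nvar 8) = d + 1 :=
          ⟨hi - lo - (s.nvar 9 - s.nvar 8) - 1, by omega⟩
        rw [show hi - lo - (s.nvar 9 - (s.nvar 8 - 1)) = d by omega, hd, Nat.succ_mul d]
        omega
    by_cases c3 : s.nvar 9 < hi ∧ lo < s.nvar 8
    · obtain ⟨m1, m2⟩ := hinv.mates hμ hN c1 c2 c3.1 c3.2
      refine ⟨_, Run.iteFalse fr (fun h => c1 (hr.1 h)) (Run.iteFalse fl (fun h => c2 (hl'.1 h))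
        (Run.iteTrue fb (hbt.2 c3) (Run.seq (T' := anyRowTime b + 4)
        ((goRight_run hC hb henv e3 (by omega) (by omega)
        ⟨hinv.good, fun h => ?_⟩).mono le_rfl ?_))))⟩
      -- The mate of F[R] is outside the substring, so the split does not arise.
      · rw [Nat.add_sub_cancel, m1] at h; omega
      rintro s' ⟨hf', h9, hk', hg'⟩
      have e3' := hf'.nvar 3 ⟨Or.inl (by omega), by omega⟩
      have e6 := hf'.nvar 6 ⟨Or.inl (by omega), by omega⟩
      have e7 := hf'.nvar 7 ⟨Or.inl (by omega), by omega⟩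
      have e8 := hf'.nvar 8 ⟨Or.inl (by omega), by omega⟩
      have e13 := hf'.nvar 13 ⟨Or.inr (by omega), by omega⟩
      refine (goLeft_run hC hb (hf'.env henv) (e3'.trans e3) (by omega) (by omega) ?_).mono
        le_rfl ?_
      · rw [e8, h9]
        refine ⟨?_, fun h1 h2 => ?_⟩
        · rw [show s.nvar 8 - 1 + 1 = s.nvar 8 by omega]; exact hg'
        · rw [show s.nvar 8 - 1 + 1 = s.nvar 8 by omega, m2]
          -- The split at the mates leaves the old substring inside and the empty one at `R + 1`
          -- behind.
          exact ⟨hk' _ _ hinv.good, hk' _ _ (hk _ _ (hd (by omega) (by omega) _ (by omega)))⟩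
      rintro s'' ⟨hf'', h8', hk'', hg''⟩
      have e6' := hf''.nvar 6 ⟨Or.inl (by omega), by omega⟩
      have e7' := hf''.nvar 7 ⟨Or.inl (by omega), by omega⟩
      have e9' := hf''.nvar 9 ⟨Or.inl (by omega), by omega⟩
      have e13' := hf''.nvar 13 ⟨Or.inr (by omega), by omega⟩
      refine ⟨⟨hf.trans ((hf'.mono ?_).trans (hf''.mono ?_)), hk.trans (hk'.trans hk''),
        by omega, by omega, by omega, ?_, fun h => by omega⟩, ?_⟩
      · unfold ChainKeep RowKeep; intro z; omega
      · unfold ChainKeep RowKeep; intro z; omega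
      · rw [e9', h9, h8', e8]
        rw [e8, h9] at hg''
        exact hinv.both hμ hN c1 c2 c3.1 c3.2 (hk'.trans hk'') hg''
      · simp only [e9', h9, h8', e8, e13', e13, hg, BExp.time, NExp.time, canRight, canLeft,
          canBoth]
        obtain ⟨d, hd⟩ : ∃ d, hi - lo - (s.nvar 9 - s.nvar 8) = d + 1 + 1 :=
          ⟨hi - lo - (s.nvar 9 - s.nvar 8) - 2, by omega⟩
        rw [show hi - lo - (s.nvar 9 + 1 - (s.nvar 8 - 1)) = d by omega, hd, Nat.succ_mul (d + 1),
          Nat.succ_mul d]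
        omega
    · refine ⟨_, Run.iteFalse fr (fun h => c1 (hr.1 h)) (Run.iteFalse fl (fun h => c2 (hl'.1 h))
        (Run.iteFalse fb (fun h => c3 (hbt.1 h)) (Run.of_wp (P := .setN 13 _) ⟨?_, ?_⟩)))⟩
      · simp only [NExp.Fits]; omega
      · refine ⟨⟨hf.setN (by unfold ChainKeep; omega), hk, hlo, hhi, by simp [NExp.eval],
          hinv, fun _ => ⟨c1, c2, c3⟩⟩, ?_⟩
        simp [BExp.time, NExp.time, NExp.eval, canRight, canLeft, canBoth, Prog.maxTime, hg]
        omega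
  · have := hs.go
    simp only [BExp.time, NExp.time]
    omega
  · rintro s' ⟨h1, h2⟩
    have := h1.go
    simp only [BExp.Holds, NExp.eval] at h2
    exact ⟨h1, by omega⟩

/-- The rows of the nodes around the pivot `p` that matter on scale `h` are available. -/
def PointDone (I : Input α) (μ ν : ℕ → ℕ) (b h : ℕ) (s : State) (p : ℕ) : Prop :=
  RowGood I μ ν b s p p ∧
    (∀ l < I.F.length, l < p → p ≤ μ l → p + 1 - h ≤ l + 1 → μ l ≤ min I.F.length (p + h - 1) →
      RowGood I μ ν b s (l + 1) (μ l)) ∧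
    (p = 0 → I.F.length < h → RowGood I μ ν b s 0 I.F.length)

theorem PointDone.keeps {b h p : ℕ} (hp : PointDone I μ ν b h s p) (hk : Keeps I μ ν b s s') :
    PointDone I μ ν b h s' p :=
  ⟨hk _ _ hp.1, fun l h1 h2 h3 h4 h5 => hk _ _ (hp.2.1 l h1 h2 h3 h4 h5),
    fun h1 h2 => hk _ _ (hp.2.2 h1 h2)⟩

/-- The window leaves room for at most `2 * (h - 1)` parentheses, so a chain takes O(h) rows
including the empty one. -/
theorem chain_run (hC : Ctx M I μ ν) {b h p : ℕ}
    (hb : b ≤ 2 * (I.F.length + I.G.length) + 2) (he : Env I μ ν s₀) (h3 : s₀.nvar 3 = b)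
    (h4 : s₀.nvar 4 = h) (h5 : s₀.nvar 5 = p) (h0 : 0 < h) (hh : h < 2 * I.F.length + 2)
    (hp : p ≤ I.F.length) (hdvd : h ∣ p)
    (hl : LevelGood I.F.length μ (RowGood I μ ν b s₀) h)
    (hd : h = 1 ∨ ∀ x ≤ I.F.length, RowGood I μ ν b s₀ x x) :
    Run M I chain s₀ (h * (2 * (anyRowTime b + 200))) fun s' =>
      Frame ChainKeep s₀ s' ∧ Keeps I μ ν b s₀ s' ∧ PointDone I μ ν b h s' p := by
  have hM := hC.lin
  have hμ := hC.nestF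
  obtain ⟨lo, hlo⟩ : ∃ lo, lo = p + 1 - h := ⟨_, rfl⟩
  obtain ⟨hi, hhi⟩ : ∃ hi, hi = I.F.length - (I.F.length - (p + h - 1)) := ⟨_, rfl⟩
  refine (Run.setN_seq ?_ (Run.setN_seq ?_ (Run.setN_seq ?_ (Run.setN_seq ?_
    (Run.seq (T' := 2 + ((hi - lo) * (anyRowTime b + 100) + 104))
      ((row_left hC hb (L := p) (R := p) ?_ ?_ ?_ ?_ le_rfl hp
        fun h => absurd h (lt_irrefl p)).mono le_rfl fun s' hs' =>
      Run.setN_seq ?_ ((chainLoop_run (s₀ := s') (lo := lo) (hi := hi) (p := p) hC hb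
        ?_ ?_ ?_ ?_ ?_ ?_).mono
        (T' := (hi - lo) * (anyRowTime b + 100) + 104) ?_ ?_))))))).mono ?_ fun _ => id
  · simp only [NExp.Fits, NExp.eval]; omega
  · simp only [NExp.Fits, NExp.eval, State.setN_nvar, if_false, Nat.reduceEqDiff]; omega
  · simp only [NExp.Fits, State.setN_nvar, Nat.reduceEqDiff, if_false]; omega
  · simp only [NExp.Fits, State.setN_nvar, Nat.reduceEqDiff, if_false]; omega
  · exact ⟨he.mateF, he.mateG, he.del, he.ins⟩
  · simpa using h3
  · simpa [NExp.eval] using h5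
  · simpa [NExp.eval] using h5
  · simp only [NExp.Fits]; omega
  · exact hs'.1.env ⟨he.mateF, he.mateG, he.del, he.ins⟩
  · rw [hs'.1.nvar 3 (Or.inl (by omega))]; simpa using h3
  · omega
  · intro l a1 a2 a3 a4 a5
    exact hs'.2.1 _ _ (hl.light hdvd (by omega) (by omega) h0 l a1 a2 a3 a4 a5)
  -- At scale 1 the window is the single point `p`, so the empty rows, which that scale is about to
  -- produce, are not yet needed.
  · intro a1 a2
    rcases hd with hd | hd
    · omega
    · exact fun x hx => hs'.2.1 _ _ (hd x hx)
  · obtain ⟨hf, hk, hg⟩ := hs'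
    have e6 := hf.nvar 6 (Or.inl (by omega))
    have e7 := hf.nvar 7 (Or.inl (by omega))
    have e8 := hf.nvar 8 (Or.inl (by omega))
    have e9 := hf.nvar 9 (Or.inl (by omega))
    simp [NExp.eval, h4, h5] at e6 e7 e8 e9
    refine ⟨(Frame.refl s').setN (by unfold ChainKeep; omega), fun _ _ h => h, ?_, ?_,
      by simp [NExp.eval], ?_, by simp [NExp.eval]⟩
    · simp [e6, hlo]
    · simp [e7, hhi]
    · simp only [State.setN_nvar, Nat.reduceEqDiff, if_false, e8, e9]
      exact ChainInv.start (by omega) (by omega) hg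
  · exact Nat.add_le_add_right (Nat.mul_le_mul_right _ (Nat.sub_le _ _)) _
  · rintro s'' ⟨⟨hf, hk, g6, g7, g13, hinv, hhalt⟩, hz⟩
    obtain ⟨n1, n2, n3⟩ := hhalt hz
    obtain ⟨hf', hk', hg⟩ := hs'
    refine ⟨Frame.trans (Frame.trans ?_ (hf'.mono ?_)) hf, fun _ _ h => hk _ _ (hk' _ _ h),
      hk _ _ hg, fun l a1 a2 a3 a4 a5 => ?_, fun a1 a2 => ?_⟩
    · exact ((((Frame.refl s₀).setN (by unfold ChainKeep; omega)).setN
          (by unfold ChainKeep; omega)).setN (by unfold ChainKeep; omega)).setN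
          (by unfold ChainKeep; omega)
    · unfold ChainKeep RowKeep; intro z; omega
    · exact hinv.final hμ n1 n2 n3 a1 a2 a3 (by omega) (by omega)
    · have e1 : lo = 0 := by omega
      have e2 : hi = I.F.length := by omega
      rw [← e2]
      rw [e1, a1] at hinv
      exact hinv.final_zero n1
  · simp only [NExp.time]
    obtain ⟨h, rfl⟩ : ∃ h', h = h' + 1 := ⟨h - 1, by omega⟩
    have : (hi - lo) * (anyRowTime b + 100) ≤ (2 * h) * (anyRowTime b + 100) :=
      Nat.mul_le_mul_right _ (by omega)
    have e1 : 2 * h * (anyRowTime b + 100) = 2 * (h * anyRowTime b) + 200 * h := by ring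
    have e2 : (h + 1) * (2 * (anyRowTime b + 200)) =
      2 * (h * anyRowTime b) + 400 * h + 2 * anyRowTime b + 400 := by ring
    omega

/-- A bound for the running time per scale and parenthesis with band width `b`. -/
def levelUnit (b : ℕ) : ℕ := 2 * (anyRowTime b + 200) + 20

/-- The variables that are not changed by `level`. -/
def LevelKeep (z : ℕ) : Prop := z ≤ 4 ∨ 14 ≤ z

/-- Pivots are spaced by `h` and cost O(h) rows each, hence O(|F| + h) rows per scale. -/
theorem level_run (hC : Ctx M I μ ν) {b h : ℕ}
    (hb : b ≤ 2 * (I.F.length + I.G.length) + 2) (he : Env I μ ν s₀) (h3 : s₀.nvar 3 = b)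
    (h4 : s₀.nvar 4 = h) (h0 : 0 < h) (hh : h < 2 * I.F.length + 2)
    (hl : LevelGood I.F.length μ (RowGood I μ ν b s₀) h)
    (hd : h = 1 ∨ ∀ x ≤ I.F.length, RowGood I μ ν b s₀ x x) :
    Run M I level s₀ ((I.F.length + h) * levelUnit b + 20) fun s' =>
      Frame LevelKeep s₀ s' ∧ LevelGood I.F.length μ (RowGood I μ ν b s') (h + h) ∧
      (∀ x ≤ I.F.length, RowGood I μ ν b s' x x) ∧
      (I.F.length < h → RowGood I μ ν b s' 0 I.F.length) := by
  have hM := hC.lin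
  have hμ := hC.nestF
  have hu : levelUnit b = 2 * (anyRowTime b + 200) + 20 := rfl
  refine (Run.setN_seq ?_ ((Run.loop (fun s => Frame LevelKeep s₀ s ∧ Keeps I μ ν b s₀ s ∧
      h ∣ s.nvar 5 ∧ s.nvar 5 ≤ I.F.length + h ∧
      ∀ q, h ∣ q → q < s.nvar 5 → q ≤ I.F.length → PointDone I μ ν b h s q)
    (fun s => (I.F.length + h - s.nvar 5) * levelUnit b) ?_ ?_
    ⟨?_, ?_, ?_, ?_, ?_⟩).mono (T' := (I.F.length + h) * levelUnit b + 10)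
    ?_ ?_)).mono ?_ fun _ => id
  · simp only [NExp.Fits]; omega
  · rintro s ⟨hf, hk, a1, a2, a3⟩
    simp only [BExp.Fits, NExp.Fits, NExp.eval]; omega
  · rintro s ⟨hf, hk, a1, a2, a3⟩ hg
    simp only [BExp.Holds, NExp.eval] at hg
    have e3 : s.nvar 3 = b := (hf.nvar 3 (Or.inl (by omega))).trans h3
    have e4 : s.nvar 4 = h := (hf.nvar 4 (Or.inl (by omega))).trans h4
    refine ⟨_, Run.seq ((chain_run (p := s.nvar 5) hC hb (hf.env he) e3 e4 rfl h0 hh (by omega) a1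
      (fun l b1 b2 b3 => hk _ _ (hl l b1 b2 b3))
      (hd.imp id fun h x hx => hk _ _ (h x hx))).mono le_rfl fun s' hs' =>
      Run.of_wp (P := .setN 5 _) ⟨?_, ?_⟩)⟩
    · have e4' := hs'.1.nvar 4 (Or.inl (by omega))
      have e5' := hs'.1.nvar 5 (Or.inl (by omega))
      simp only [NExp.Fits, NExp.eval]; omega
    · obtain ⟨hf', hk', hp⟩ := hs'
      have e4' := hf'.nvar 4 (Or.inl (by omega))
      have e5' := hf'.nvar 5 (Or.inl (by omega))
      refine ⟨⟨(hf.trans (hf'.mono ?_)).setN (by unfold LevelKeep; omega), hk.trans hk', ?_, ?_,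
        ?_⟩, ?_⟩
      · unfold LevelKeep ChainKeep; intro z; omega
      · simp only [State.setN_nvar, if_true, NExp.eval, e4', e5', e4]
        exact a1.add (dvd_refl h)
      · simp only [State.setN_nvar, if_true, NExp.eval, e4', e5', e4]
        omega
      · simp only [State.setN_nvar, if_true, NExp.eval, e4', e5', e4]
        intro q hq hq1 hq2
        rcases Nat.lt_or_ge q (s.nvar 5) with hlt | hge
        · exact (a3 q hq hlt hq2).keeps hk'
        · have : q - s.nvar 5 = 0 :=
            Nat.eq_zero_of_dvd_of_lt (Nat.dvd_sub hq a1) (by omega)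
          obtain rfl : q = s.nvar 5 := by omega
          exact hp
      · simp only [State.setN_nvar, if_true, NExp.eval, e4', e5', e4, Prog.maxTime, BExp.time,
          NExp.time]
        rw [show I.F.length + h - s.nvar 5 = (I.F.length + h - (s.nvar 5 + h)) + h by omega,
          add_mul, hu, mul_add h]
        omega
  · exact (Frame.refl s₀).setN (by unfold LevelKeep; omega)
  · exact fun _ _ h => h
  · simp [NExp.eval]
  · simp [NExp.eval]
  · simp [NExp.eval]
  · simp [NExp.eval, BExp.time, NExp.time]
  · rintro s' ⟨⟨hf, hk, a1, a2, a3⟩, hg⟩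
    simp only [BExp.Holds, NExp.eval] at hg
    have hall : ∀ q, h ∣ q → q ≤ I.F.length → PointDone I μ ν b h s' q :=
      fun q h1 h2 => a3 q h1 (by omega) h2
    refine ⟨hf, ?_, fun x hx => ?_, fun hlt => (hall 0 (dvd_zero h) (Nat.zero_le _)).2.2 rfl hlt⟩
    · exact LevelGood.double hμ (fun l b1 b2 b3 => hk _ _ (hl l b1 b2 b3))
        fun p h1 h2 => (hall p h1 h2).2.1
    · rcases hd with rfl | hd
      · exact (hall x (one_dvd x) hx).1
      · exact hk _ _ (hd x hx)
  · simp only [NExp.time]; omega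

/-- The variables that are not changed by `round`. -/
def RoundKeep (z : ℕ) : Prop := z ≤ 3 ∨ 14 ≤ z

/-- A bound for the running time of `round` if `F` has length `N` and the band has width `b`. -/
def roundTime (N b : ℕ) : ℕ :=
  (Nat.log 2 (2 * N + 2) + 1) * ((3 * N + 2) * levelUnit b + 60) + 20

/-- When the loop ends, the last scale processed was half the current one and exceeds |F|, so the
chain of pivot 0 has reached the whole forest. Doubling the scale bounds the number of levels by a
logarithm. -/
theorem round_run (hC : Ctx M I μ ν) {b : ℕ}
    (hb : b ≤ 2 * (I.F.length + I.G.length) + 2) (he : Env I μ ν s₀) (h3 : s₀.nvar 3 = b) :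
    Run M I round s₀ (roundTime I.F.length b) fun s' =>
      Frame RoundKeep s₀ s' ∧ RowGood I μ ν b s' 0 I.F.length := by
  have hM := hC.lin
  obtain ⟨W, hW⟩ : ∃ W, W = (3 * I.F.length + 2) * levelUnit b + 60 :=
    ⟨_, rfl⟩
  refine (Run.setN_seq ?_ ((Run.loop (fun s => Frame RoundKeep s₀ s ∧ 0 < s.nvar 4 ∧
      s.nvar 4 ≤ 4 * I.F.length + 4 ∧ LevelGood I.F.length μ (RowGood I μ ν b s) (s.nvar 4) ∧
      (s.nvar 4 = 1 ∨ ∀ x ≤ I.F.length, RowGood I μ ν b s x x) ∧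
      (2 * I.F.length + 2 ≤ s.nvar 4 → RowGood I μ ν b s 0 I.F.length))
    (fun s => (Nat.log 2 (2 * I.F.length + 2) + 1 - Nat.log 2 (s.nvar 4)) * W) ?_ ?_
    ⟨?_, ?_, ?_, ?_, ?_, ?_⟩).mono (T' := (Nat.log 2 (2 * I.F.length + 2) + 1) * W + 10)
    ?_ ?_)).mono ?_ fun _ => id
  · simp only [NExp.Fits]; omega
  · rintro s ⟨hf, a1, a2, a3, a4, a5⟩
    simp only [BExp.Fits, NExp.Fits, NExp.eval]; omega
  · rintro s ⟨hf, a1, a2, a3, a4, a5⟩ hg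
    simp only [BExp.Holds, NExp.eval] at hg
    have e3 : s.nvar 3 = b := (hf.nvar 3 (Or.inl (by omega))).trans h3
    refine ⟨_, Run.seq ((level_run (h := s.nvar 4) hC hb (hf.env he) e3 rfl a1 (by omega) a3
      a4).mono le_rfl fun s' hs' => Run.of_wp (P := .setN 4 _) ⟨?_, ?_⟩)⟩
    · have e4' := hs'.1.nvar 4 (Or.inl (by omega))
      simp only [NExp.Fits, NExp.eval]; omega
    · obtain ⟨hf', b1, b2, b3⟩ := hs'
      have e4' := hf'.nvar 4 (Or.inl (by omega))
      simp only [State.setN_nvar, if_true, NExp.eval, e4', Prog.maxTime, BExp.time, NExp.time]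
      refine ⟨⟨(hf.trans (hf'.mono ?_)).setN (by unfold RoundKeep; omega), by omega, by omega,
        b1, Or.inr b2, fun h => b3 (by omega)⟩, ?_⟩
      · unfold LevelKeep RoundKeep; intro z; omega
      · have hlog : Nat.log 2 (s.nvar 4 + s.nvar 4) = Nat.log 2 (s.nvar 4) + 1 := by
          rw [← mul_two, Nat.log_mul_base (by omega) (by omega)]
        have hlog' : Nat.log 2 (s.nvar 4) ≤ Nat.log 2 (2 * I.F.length + 2) :=
          Nat.log_mono_right (by omega)
        have hle : (I.F.length + s.nvar 4) * levelUnit b ≤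
            (3 * I.F.length + 2) * levelUnit b :=
          Nat.mul_le_mul_right _ (by omega)
        rw [hlog]
        obtain ⟨d, hd⟩ : ∃ d, Nat.log 2 (2 * I.F.length + 2) + 1 - Nat.log 2 (s.nvar 4) = d + 1 :=
          ⟨Nat.log 2 (2 * I.F.length + 2) - Nat.log 2 (s.nvar 4), by omega⟩
        rw [show Nat.log 2 (2 * I.F.length + 2) + 1 - (Nat.log 2 (s.nvar 4) + 1) = d by omega, hd,
          Nat.succ_mul d]
        omega
  · exact (Frame.refl s₀).setN (by unfold RoundKeep; omega)
  · simp [NExp.eval]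
  · simp [NExp.eval]
  · simp only [State.setN_nvar, if_true, NExp.eval]
    exact levelGood_one
  · simp [NExp.eval]
  · simp [NExp.eval]
  · simp [NExp.eval, BExp.time, NExp.time]
  · rintro s' ⟨⟨hf, a1, a2, a3, a4, a5⟩, hg⟩
    simp only [BExp.Holds, NExp.eval] at hg
    exact ⟨hf, a5 (by omega)⟩
  · simp only [NExp.time, roundTime, ← hW]; omega

end Round

end TED

namespace TED

/-! ## Preprocessing -/

namespace Alg

abbrev counter : NExp := .var 0

/-- Test whether the two strings are equal; the result is the word variable `2`. -/
def eqTest : Prog :=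
  .seq (.ite (.eqN .lenF .lenG) (.setN 2 (.const 1)) (.setN 2 (.const 0)))
    (.seq (.setN 0 (.const 0))
      (.loop (.and (.eqN (.var 2) (.const 1)) (.ltN counter .lenF))
        (.ite (.and (.eqN (.openF counter) (.openG counter))
            (.leR (.weight (.labF counter) (.labG counter)) .zero))
          (.setN 0 (succE counter)) (.setN 2 (.const 0)))))

def matesStep (op : NExp → NExp) (a st : ℕ) : Prog :=
  .seq (.ite (.eqN (op counter) (.const 1))
      (.seq (.setNArr st (.var 1) counter) (.setN 1 (succE (.var 1))))
      (.seq (.setN 1 (predE (.var 1))) (.seq (.setNArr a counter (.arr st (.var 1)))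
        (.setNArr a (.arr st (.var 1)) counter))))
    (.setN 0 (succE counter))

/-- Store the positions of the mates in the array `a`, using the array `st` as a stack. -/
def mates (len : NExp) (op : NExp → NExp) (a st : ℕ) : Prog :=
  .seq (.setN 0 (.const 0)) (.seq (.setN 1 (.const 0))
    (.loop (.ltN counter len) (matesStep op a st)))

/-- Store half the prefix sums of the weights in the array `a`. -/
def sums (len : NExp) (p q : LExp) (a : ℕ) : Prog :=
  .seq (.setN 0 (.const 0)) (.seq (.setRArr a (.const 0) .zero)
    (.loop (.ltN counter len)
      (.seq (.setRArr a (succE counter) (.add (.arr a counter) (.half (.weight p q))))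
        (.setN 0 (succE counter)))))

end Alg

open Alg

section Preprocessing

variable {α : Type u} {M : ℕ} {I : Input α} {s : State}

theorem eqTest_run (hM : 100 * (I.F.length + I.G.length + 2) ≤ M) :
    Run M I eqTest s (60 * (I.F.length + 2)) fun s' =>
      s'.narr = s.narr ∧ (s'.nvar 2 = 1 ∧ Same I.w I.F I.G ∨
        s'.nvar 2 = 0 ∧ ¬ Same I.w I.F I.G) := by
  refine (Run.seq (T' := 2 + (I.F.length * 50 + 60))
    ((Run.of_wp (P := .ite _ (.setN 2 _) (.setN 2 _))
    (Q := fun s' => s'.narr = s.narr ∧ s'.nvar 2 ≤ 1 ∧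
      (s'.nvar 2 = 1 ↔ I.F.length = I.G.length)) ⟨?_, ?_, ?_⟩).mono le_rfl ?_)).mono
    ?_ fun _ => id
  · simp only [BExp.Fits, NExp.Fits]; omega
  · intro h
    refine ⟨by simp only [NExp.Fits]; omega, ?_⟩
    simp only [BExp.Holds, NExp.eval] at h
    simp [NExp.eval, h]
  · intro h
    refine ⟨by simp only [NExp.Fits]; omega, ?_⟩
    simp only [BExp.Holds, NExp.eval] at h
    simp [NExp.eval, h]
  swap
  · simp only [Prog.maxTime, BExp.time, NExp.time]; omega
  rintro s₁ ⟨h1, h2, h3⟩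
  refine (Run.setN_seq ?_
    (Run.loop (fun s' => s'.narr = s.narr ∧ s'.nvar 2 ≤ 1 ∧ s'.nvar 0 ≤ I.F.length ∧
      (s'.nvar 2 = 1 → I.F.length = I.G.length ∧ ∀ i < s'.nvar 0,
        openAt I.F i = openAt I.G i ∧ I.w (labelAt I.F i) (labelAt I.G i) ≤ 0) ∧
      (s'.nvar 2 = 0 → ¬ Same I.w I.F I.G))
      (fun s' => (I.F.length - s'.nvar 0) * 50 + s'.nvar 2 * 40) ?_ ?_ ?_)).mono ?_ ?_
  · simp only [NExp.Fits]; omega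
  · rintro s' ⟨a1, a2, a3, a4, a5⟩
    simp only [BExp.Fits, NExp.Fits]; omega
  · rintro s' ⟨a1, a2, a3, a4, a5⟩ ⟨g1, g2⟩
    simp only [BExp.Holds, NExp.eval] at g1 g2
    have o1 := openAt_le_one I.F (s'.nvar 0)
    have o2 := openAt_le_one I.G (s'.nvar 0)
    have hf : (BExp.and (.eqN (.openF counter) (.openG counter))
      (.leR (.weight (.labF counter) (.labG counter)) .zero)).Fits M I s' := by
      simp only [BExp.Fits, NExp.Fits, RExp.Fits, LExp.Fits, NExp.eval, and_true]
      omega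
    by_cases hc : openAt I.F (s'.nvar 0) = openAt I.G (s'.nvar 0) ∧
      I.w (labelAt I.F (s'.nvar 0)) (labelAt I.G (s'.nvar 0)) ≤ 0
    · refine ⟨_, Run.iteTrue hf hc (Run.of_wp (P := .setN 0 _) ⟨?_, ?_⟩)⟩
      · simp only [NExp.Fits, NExp.eval]; omega
      · refine ⟨⟨a1, a2, ?_, ?_, ?_⟩, ?_⟩
        · simp [NExp.eval]; omega
        · simp only [NExp.eval, State.setN_nvar, if_true]
          intro h
          refine ⟨(a4 g1).1, fun i hi => ?_⟩
          rcases Nat.lt_succ_iff_lt_or_eq.1 hi with hi | rfl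
          · exact (a4 g1).2 i hi
          · exact hc
        · exact a5
        · simp [NExp.eval, Prog.maxTime, BExp.time, NExp.time, RExp.time, LExp.time]
          omega
    · refine ⟨_, Run.iteFalse hf hc (Run.of_wp (P := .setN 2 _) ⟨?_, ?_⟩)⟩
      · simp only [NExp.Fits]; omega
      · refine ⟨⟨a1, ?_, a3, ?_, fun _ h => hc (h.2 _ g2)⟩, ?_⟩
        · simp [NExp.eval]
        · simp [NExp.eval]
        · simp [NExp.eval, Prog.maxTime, BExp.time, NExp.time, RExp.time, LExp.time, g1]
          omega
  · refine ⟨h1, by simpa using h2, by simp [NExp.eval], ?_, ?_⟩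
    · simp only [NExp.eval, State.setN_nvar, if_true]
      intro h
      exact ⟨h3.1 (by simpa using h), fun i hi => absurd hi (by omega)⟩
    · intro h hs
      simp at h
      have := h3.2 hs.1
      omega
  · simp only [State.setN_nvar, NExp.eval, if_true, BExp.time, NExp.time, if_false,
      OfNat.ofNat_ne_zero]
    omega
  · rintro s' ⟨⟨a1, a2, a3, a4, a5⟩, hg⟩
    simp only [BExp.Holds, NExp.eval] at hg
    refine ⟨a1, ?_⟩
    by_cases h : s'.nvar 2 = 1
    · refine Or.inl ⟨h, (a4 h).1, fun i hi => (a4 h).2 i (by omega)⟩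
    · exact Or.inr ⟨by omega, a5 (by omega)⟩

/-! The stack algorithm that computes mates, as a function. -/

/-- The state of the stack algorithm: the height of the stack, the stack, and the mates. -/
structure StackState : Type where
  height : ℕ
  stack : ℕ → ℕ
  mate : ℕ → ℕ

/-- The step of the stack algorithm at position `i`. -/
def StackState.step (X : List (Paren α)) (i : ℕ) (σ : StackState) : StackState :=
  if openAt X i = 1 then
    ⟨σ.height + 1, fun e => if e = σ.height then i else σ.stack e, σ.mate⟩
  else
    ⟨σ.height - 1, σ.stack, fun x => if x = σ.stack (σ.height - 1) then i else
      if x = i then σ.stack (σ.height - 1) else σ.mate x⟩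

/-- The steps of the stack algorithm at the `m` positions from `i` on. -/
def StackState.run (X : List (Paren α)) : ℕ → ℕ → StackState → StackState
  | _, 0, σ => σ
  | i, m + 1, σ => StackState.run X (i + 1) m (σ.step X i)

theorem StackState.run_add (X : List (Paren α)) (m m' i : ℕ) (σ : StackState) :
    σ.run X i (m + m') = (σ.run X i m).run X (i + m) m' := by
  induction m generalizing i σ with
  | zero => simp [StackState.run]
  | succ m ih =>
      rw [show m + 1 + m' = (m + m') + 1 by omega, StackState.run, StackState.run, ih,
        show i + 1 + m = i + (m + 1) by omega]

/-- On a balanced substring the stack algorithm finds the mates and restores the stack. -/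
theorem IsForest.run {X : List (Paren α)} (h : IsForest X) (F pre post : List (Paren α))
    (hF : F = pre ++ (X ++ post)) (σ : StackState) :
    (σ.run F pre.length X.length).height = σ.height ∧
    (∀ e < σ.height, (σ.run F pre.length X.length).stack e = σ.stack e) ∧
    (∀ x, x < pre.length ∨ pre.length + X.length ≤ x →
      (σ.run F pre.length X.length).mate x = σ.mate x) ∧
    ∀ x, pre.length ≤ x → x < pre.length + X.length →
      IsMate F x ((σ.run F pre.length X.length).mate x) := by
  induction h generalizing pre post σ with
  | nil => exact ⟨rfl, fun _ _ => rfl, fun _ _ => rfl, fun x h1 h2 => by simp at h2; omega⟩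
  | @append X Y _ _ ih ih' =>
      obtain ⟨a1, a2, a3, a4⟩ := ih pre (Y ++ post) (by simpa using hF) σ
      obtain ⟨b1, b2, b3, b4⟩ := ih' (pre ++ X) post (by simpa using hF)
        (σ.run F pre.length X.length)
      rw [List.length_append] at b1 b2 b3 b4
      rw [List.length_append, StackState.run_add]
      refine ⟨b1.trans a1, fun e he => (b2 e (by omega)).trans (a2 e he),
        fun x hx => (b3 x (by omega)).trans (a3 x (by omega)), fun x h1 h2 => ?_⟩
      rcases Nat.lt_or_ge x (pre.length + X.length) with hx | hx
      · rw [b3 x (Or.inl hx)]; exact a4 x h1 hx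
      · exact b4 x hx (by omega)
  | @node X a hX ih =>
      have g1 : F[pre.length]? = some (.op a) := by simp [hF]
      have g2 : F[pre.length + 1 + X.length]? = some (.cl a) := by
        rw [hF, List.getElem?_append_right (by omega),
          show pre.length + 1 + X.length - pre.length = X.length + 1 by omega]
        simp
      have g3 : (F.drop (pre.length + 1)).take (pre.length + 1 + X.length - (pre.length + 1)) =
          X := by
        rw [show pre.length + 1 + X.length - (pre.length + 1) = X.length by omega,
          show F = (pre ++ [Paren.op a]) ++ (X ++ (Paren.cl a :: post)) by simp [hF],
          List.drop_left' (by simp), List.take_left' rfl]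
      have hn : IsNode F pre.length (pre.length + 1 + X.length) :=
        ⟨by omega, ⟨a, g1⟩, ⟨a, g2⟩, by rw [g3]; exact hX⟩
      obtain ⟨b1, b2, b3, b4⟩ := ih (pre ++ [.op a]) (.cl a :: post) (by simpa using hF)
        (σ.step F pre.length)
      have hlen : (Paren.op a :: (X ++ [Paren.cl a])).length = 1 + (X.length + 1) := by
        simp; omega
      rw [hlen, StackState.run_add, StackState.run_add]
      change ((((σ.step F pre.length).run F _ _).step F _).height = _) ∧ (∀ e < _,
        (((σ.step F pre.length).run F _ _).step F _).stack e = _) ∧ (∀ x, _ →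
        (((σ.step F pre.length).run F _ _).step F _).mate x = _) ∧ ∀ x, _ → _ →
        IsMate F x ((((σ.step F pre.length).run F _ _).step F _).mate x)
      rw [List.length_append, List.length_singleton] at b1 b2 b3 b4
      generalize (σ.step F pre.length).run F (pre.length + 1) X.length = τ at *
      have o1 : openAt F pre.length = 1 := openAt_eq_one.2 ⟨a, g1⟩
      have o2 : ¬ openAt F (pre.length + 1 + X.length) = 1 := by
        rw [openAt_eq_one]; simp [g2]
      simp only [StackState.step, o1, if_true] at b1 b2 b3 b4
      -- The inner run preserves the stack below its starting height, hence also the entry just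
      -- pushed.
      have e1 : τ.stack σ.height = pre.length := by
        simpa using b2 σ.height (Nat.lt_succ_self _)
      simp only [StackState.step, o2, if_false, b1, Nat.add_sub_cancel, e1]
      refine ⟨trivial, fun e he => ?_, fun x hx => ?_, fun x h1 h2 => ?_⟩
      · rw [b2 e (by omega), if_neg (by omega)]
      · rw [if_neg (by omega), if_neg (by omega), b3 x (by omega)]
      · by_cases c1 : x = pre.length
        · rw [if_pos c1, c1]; exact Or.inl hn
        · rw [if_neg c1]
          by_cases c2 : x = pre.length + 1 + X.length
          · rw [if_pos c2, c2]; exact Or.inr hn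
          · rw [if_neg c2]
            exact b4 x (by omega) (by omega)

/-- The memory follows the functional stack algorithm step by step, and `IsForest.run` supplies the
correctness. -/
theorem mates_run (X : List (Paren α)) (hX : IsForest X) {len : NExp} {op : NExp → NExp}
    {a st : ℕ} (hast : a ≠ st) (hM : X.length + 2 < M)
    (hlen : ∀ s, len.Fits M I s ∧ len.eval I s = X.length)
    (hop : ∀ s, (op counter).eval I s = openAt X (s.nvar 0) ∧
      (s.nvar 0 < M → (op counter).Fits M I s))
    (hlt : len.time = 1) (hot : (op counter).time = 2)
    (ha : s.narr a = fun _ => 0) (hst : s.narr st = fun _ => 0) :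
    Run M I (mates len op a st) s (60 * (X.length + 1)) fun s' =>
      (∀ x < X.length, IsMate X x (s'.narr a x)) ∧ (∀ x, s'.narr a x ≤ X.length) ∧
      ∀ c, c ≠ a → c ≠ st → s'.narr c = s.narr c := by
  have hsa : st ≠ a := hast.symm
  refine (Run.setN_seq ?_ (Run.setN_seq ?_
    (Run.loop (fun s' => s'.nvar 0 ≤ X.length ∧ s'.nvar 1 ≤ s'.nvar 0 ∧
      (∀ x, s'.narr a x ≤ X.length) ∧ (∀ x, s'.narr st x ≤ X.length) ∧
      (∀ c, c ≠ a → c ≠ st → s'.narr c = s.narr c) ∧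
      (⟨s'.nvar 1, s'.narr st, s'.narr a⟩ : StackState) =
        StackState.run X 0 (s'.nvar 0) ⟨0, fun _ => 0, fun _ => 0⟩)
      (fun s' => (X.length - s'.nvar 0) * 50) ?_ ?_ ?_))).mono ?_ ?_
  · simp only [NExp.Fits]; omega
  · simp only [NExp.Fits]; omega
  · rintro s' ⟨a1, a2, a3, a4, a5, a6⟩
    exact ⟨by simp only [NExp.Fits]; omega, (hlen s').1⟩
  · rintro s' ⟨a1, a2, a3, a4, a5, a6⟩ hg
    simp only [BExp.Holds, NExp.eval, (hlen s').2] at hg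
    have hstep : StackState.run X 0 (s'.nvar 0 + 1) ⟨0, fun _ => 0, fun _ => 0⟩ =
        StackState.step X (s'.nvar 0) ⟨s'.nvar 1, s'.narr st, s'.narr a⟩ := by
      rw [StackState.run_add, a6, zero_add]; rfl
    have htime : (matesStep op a st).maxTime ≤ 40 := by
      simp only [matesStep, Prog.maxTime, BExp.time, NExp.time, hot]
      omega
    refine ⟨40, (Run.of_wp (P := matesStep op a st) (Q := fun s'' => s''.nvar 0 = s'.nvar 0 + 1 ∧
      s''.nvar 1 ≤ s'.nvar 0 + 1 ∧
      (∀ x, s''.narr a x ≤ X.length) ∧ (∀ x, s''.narr st x ≤ X.length) ∧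
      (∀ c, c ≠ a → c ≠ st → s''.narr c = s.narr c) ∧
      (⟨s''.nvar 1, s''.narr st, s''.narr a⟩ : StackState) =
        StackState.step X (s'.nvar 0) ⟨s'.nvar 1, s'.narr st, s'.narr a⟩) ⟨⟨?_, ?_⟩, ?_, ?_⟩).mono
      htime ?_⟩
    · exact (hop s').2 (by omega)
    · simp only [NExp.Fits]; omega
    · intro hb
      simp only [BExp.Holds, NExp.eval, (hop s').1] at hb
      simp only [Prog.Wp, NExp.Fits, NExp.eval, State.setNArr_nvar, State.setN_nvar]
      refine ⟨by omega, by omega, by omega, by simp; omega, by simp, by simp; omega, ?_, ?_, ?_, ?_⟩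
      · intro x; simpa [hast] using a3 x
      · intro x
        simp only [State.setN_narr, State.setNArr_narr]
        split
        · omega
        · exact a4 x
      · intro c h1 h2
        rw [← a5 c h1 h2]
        funext x
        simp [h2]
      · simp only [StackState.step, hb, if_true, State.setN_narr]
        congr 1
        · funext x; simp
        · funext x; simp [hast]
    · intro hb
      simp only [BExp.Holds, NExp.eval, (hop s').1] at hb
      have b1 := a4 (s'.nvar 1 - 1)
      simp only [Prog.Wp, NExp.Fits, NExp.eval, State.setNArr_nvar, State.setN_nvar,
        State.setN_narr, State.setNArr_narr]
      simp only [hsa, false_and, if_false, if_true, one_ne_zero, zero_ne_one]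
      refine ⟨by omega, by omega, by omega, by omega, by omega, by omega, trivial, by omega, ?_, ?_,
        ?_, ?_⟩
      · intro x
        split
        · omega
        · split
          · omega
          · exact a3 x
      · exact a4
      · intro c h1 h2
        rw [← a5 c h1 h2]
        funext x
        simp [h1]
      · simp only [StackState.step, hb, if_false]
        congr 1
        · funext x; simp [hsa]
        · funext x; simp
    · rintro s'' ⟨b1, b2, b3, b4, b5, b6⟩
      refine ⟨⟨by omega, by omega, b3, b4, b5, by rw [b6, b1, hstep]⟩, ?_⟩
      simp only [b1, BExp.time, NExp.time, hlt]
      omega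
  · refine ⟨by simp [NExp.eval], by simp [NExp.eval], by simp [ha], by simp [hst],
      fun c _ _ => rfl, ?_⟩
    simp [NExp.eval, StackState.run, ha, hst]
  · simp [NExp.eval, BExp.time, NExp.time, hlt]; omega
  · rintro s' ⟨⟨a1, a2, a3, a4, a5, a6⟩, hg⟩
    simp only [BExp.Holds, NExp.eval, (hlen s').2] at hg
    refine ⟨fun x hx => ?_, a3, a5⟩
    have := (hX.run X [] [] (by simp) ⟨0, fun _ => 0, fun _ => 0⟩).2.2.2 x (by simp)
      (by simpa using hx)
    rw [show s'.nvar 0 = X.length by omega] at a6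
    simpa only [List.length_nil, ← a6] using this

theorem sums_run {N a : ℕ} {len : NExp} {p q : LExp} {f : ℕ → ℝ} (hM : N + 2 < M)
    (hlen : ∀ s, len.Fits M I s ∧ len.eval I s = N)
    (hf : ∀ s, (RExp.weight p q).eval I s = f (s.nvar 0) ∧
      (s.nvar 0 < M → (RExp.weight p q).Fits M I s))
    (hlt : len.time = 1) (hft : (RExp.weight p q).time = 4) :
    Run M I (sums len p q a) s (60 * (N + 1)) fun s' =>
      (∀ i ≤ N, s'.rarr a i = ∑ j ∈ Finset.range i, f j / 2) ∧
      (∀ c, c ≠ a → s'.rarr c = s.rarr c) ∧ s'.narr = s.narr := by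
  refine (Run.setN_seq ?_
    (Run.seq (Run.of_wp (P := .setRArr a (.const 0) .zero) ⟨?_, trivial,
    (Run.loop (fun s' => s'.nvar 0 ≤ N ∧
      (∀ i ≤ s'.nvar 0, s'.rarr a i = ∑ j ∈ Finset.range i, f j / 2) ∧
      (∀ c, c ≠ a → s'.rarr c = s.rarr c) ∧ s'.narr = s.narr)
      (fun s' => (N - s'.nvar 0) * 50) ?_ ?_ ?_).mono (T' := N * 50 + 10) ?_ fun _ => id⟩))).mono
    ?_ ?_
  · simp only [NExp.Fits]; omega
  · simp only [NExp.Fits]; omega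
  · rintro s' ⟨a1, a2, a3, a4⟩
    exact ⟨by simp only [NExp.Fits]; omega, (hlen s').1⟩
  · rintro s' ⟨a1, a2, a3, a4⟩ hg
    simp only [BExp.Holds, NExp.eval, (hlen s').2] at hg
    refine ⟨_, Run.of_wp (P := .seq (.setRArr a (succE counter)
      (.add (.arr a counter) (.half (.weight p q)))) (.setN 0 (succE counter)))
      ⟨?_, ⟨?_, (hf s').2 (by omega)⟩, ?_, ⟨?_, ?_, ?_, a4⟩, ?_⟩⟩
    · simp only [NExp.Fits, NExp.eval]; omega
    · simp only [RExp.Fits, NExp.Fits]; omega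
    · simp only [NExp.Fits, NExp.eval, State.setRArr_nvar]; omega
    · simp [NExp.eval]; omega
    · intro i hi
      simp only [NExp.eval, State.setN_nvar, if_true, State.setRArr_nvar] at hi
      have := (hf s').1
      simp only [RExp.eval] at this
      simp only [RExp.eval, NExp.eval, State.setN_rarr, State.setRArr_rarr, true_and, this]
      by_cases hc : i = s'.nvar 0 + 1
      · rw [if_pos hc, hc, Finset.sum_range_succ, a2 _ le_rfl]
      · rw [if_neg hc]
        exact a2 i (by omega)
    · intro c hc
      rw [← a3 c hc]
      funext x
      simp [hc]
    · simp only [RExp.time] at hft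
      simp only [NExp.eval, State.setN_nvar, if_true, State.setRArr_nvar, Prog.maxTime, BExp.time,
        NExp.time, RExp.time, hlt]
      omega
  · refine ⟨by simp [NExp.eval], ?_, ?_, rfl⟩
    · intro i hi
      simp [NExp.eval] at hi
      simp [hi, NExp.eval, RExp.eval]
    · intro c hc
      funext x
      simp [hc]
  · simp [NExp.eval, BExp.time, NExp.time, hlt]
  · simp only [Prog.maxTime, NExp.time, RExp.time]; omega
  · rintro s' ⟨⟨a1, a2, a3, a4⟩, hg⟩
    simp only [BExp.Holds, NExp.eval, (hlen s').2] at hg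
    exact ⟨fun i hi => a2 i (by omega), a3, a4⟩

end Preprocessing

end TED

namespace TED

/-! ## The algorithm -/

namespace Alg

/-- The value in the real variable `0` is certainly correct. -/
def accept : BExp :=
  .and (nearE .lenF .lenG) (.or (.leR (.var 0) (.half (.var 1)))
    (.not (.ltN band (.add .lenF .lenG))))

/-- Run `round`; stop if the result is correct, and double the width of the band otherwise. -/
def attempt : Prog :=
  .seq round (.seq (.setR 0 (table (.const 0) .lenF (.const 0) .lenG))
    (.ite accept (.setN 14 (.const 1))
      (.seq (.setN 3 (.add band band)) (.setR 1 (.add (.var 1) (.var 1))))))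

/-- Try bands of increasing width. -/
def search : Prog :=
  .seq (.seq (.setN 3 (.const 2)) (.seq (.setR 1 (.add .one .one)) (.setN 14 (.const 0))))
    (.loop (.eqN (.var 14) (.const 0)) attempt)

/-- The algorithm that computes the tree edit distance. -/
def main : Prog :=
  .seq eqTest (.ite (.eqN (.var 2) (.const 1)) (.setR 0 .zero)
    (.seq (mates .lenF .openF 0 2) (.seq (mates .lenG .openG 1 3)
      (.seq (sums .lenF (.labF counter) .eps 1) (.seq (sums .lenG .eps (.labG counter) 2)
        search)))))

end Alg

open Alg

section Search

variable {α : Type u} {M : ℕ} {I : Input α} {μ ν : ℕ → ℕ} {s : State}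

/-- The state between two attempts. -/
structure Searching (I : Input α) (μ ν : ℕ → ℕ) (s : State) : Prop where
  env : Env I μ ν s
  real : s.rvar 1 = s.nvar 3
  le : s.nvar 3 ≤ 2 * (I.F.length + I.G.length) + 2
  two_le : 2 ≤ s.nvar 3
  le_ted : (s.nvar 3 : ℝ) ≤ 4 * ted I.w I.F I.G
  small : s.nvar 3 = 2 ∨ 2 < I.F.length + I.G.length
  done : s.nvar 14 ≤ 1
  result : s.nvar 14 = 1 → s.rvar 0 = ted I.w I.F I.G

/-- The computed value is never below the distance, so a value of at most b/2 proves b ≥ 2k and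
hence its own exactness. -/
theorem attempt_run (hC : Ctx M I μ ν) (hw : Normalized I.w)
    (hμ : ∀ i < I.F.length, IsMate I.F i (μ i)) (hν : ∀ i < I.G.length, IsMate I.G i (ν i))
    (hs : Searching I μ ν s) (h0 : s.nvar 14 = 0) :
    Run M I attempt s (roundTime I.F.length (s.nvar 3) + 80) fun s' => Searching I μ ν s' ∧
      (s'.nvar 14 = 0 → s'.nvar 3 = 2 * s.nvar 3) := by
  have hM := hC.lin
  obtain ⟨he, hr, hle, h2, ht, hsm, -, -⟩ := hs
  refine (Run.seq (T' := 80) ((round_run hC hle he rfl).mono le_rfl fun s₁ hs₁ =>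
    (Run.of_wp (P := .seq (.setR 0 _) (.ite accept (.setN 14 _) (.seq (.setN 3 _) (.setR 1 _))))
      ⟨?_, ?_, ?_, ?_⟩).mono ?_ fun _ => id)).mono le_rfl fun _ => id
  · refine hC.idxE_fits ?_ ?_ ?_ ?_ ?_ ?_ ?_ ?_ <;> simp only [NExp.Fits, NExp.eval] <;> omega
  · have e3 := hs₁.1.nvar 3 (Or.inl le_rfl)
    simp only [accept, nearE, BExp.Fits, NExp.Fits, RExp.Fits, NExp.eval, State.setR_nvar]
    refine ⟨⟨?_, ?_⟩, ⟨trivial, trivial⟩, ?_⟩ <;> omega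
  all_goals
    obtain ⟨hf, hg⟩ := hs₁
    have e3 := hf.nvar 3 (Or.inl le_rfl)
    have e14 := hf.nvar 14 (Or.inr le_rfl)
    have henv := hf.env he
    have hnear : Near (s.nvar 3) I.F.length I.G.length →
        Sandwich I.w I.F I.G μ ν (s.nvar 3) 0 0 I.F.length I.G.length
          (s₁.rarr 0 (idx (I.F.length + I.G.length) 0 I.F.length 0 I.G.length)) :=
      fun hn => hg.2.2 0 _ (Nat.zero_le _) le_rfl ⟨by omega, by omega⟩ hn
    simp only [accept, nearE, BExp.Holds, NExp.eval, RExp.eval, idxE_eval, State.setR_nvar,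
      State.setR_rvar, if_true, one_ne_zero, if_false, e3, hf.rvar, hr]
  · rintro ⟨⟨n1, n2⟩, ha⟩
    have hS := hnear ⟨by omega, by omega⟩
    have hv := hS.eq_ted hw hμ hν (ha.imp (fun h => by linarith [hS.ted_le hμ hν]) (by omega))
    refine ⟨by simp only [NExp.Fits]; omega, ⟨⟨henv.mateF, henv.mateG, henv.del, henv.ins⟩, ?_, ?_,
      ?_, ?_, ?_, ?_, ?_⟩, ?_⟩ <;> simp [e3, hf.rvar, hr, hle, h2, ht, hsm, NExp.eval, hv]
  · intro ha
    have hb : s.nvar 3 < I.F.length + I.G.length := by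
      by_contra hb
      exact ha ⟨⟨by omega, by omega⟩, Or.inr hb⟩
    -- A band with b ≥ 2k would contain the corner and yield the exact value k ≤ b/2, which is
    -- accepted. So rejection keeps the doubled width below 4k.
    have hk : (s.nvar 3 : ℝ) < 2 * ted I.w I.F I.G := by
      by_contra hk
      push Not at hk
      have hn := near_of_ted hw hμ hν hk
      have hv := (hnear hn).eq_ted hw hμ hν (Or.inl hk)
      obtain ⟨n1, n2⟩ := hn
      exact ha ⟨⟨by omega, by omega⟩, Or.inl (by rw [hv]; linarith)⟩
    refine ⟨?_, ⟨trivial, trivial⟩, ⟨⟨henv.mateF, henv.mateG, henv.del, henv.ins⟩, ?_, ?_,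
      ?_, ?_, ?_, ?_, ?_⟩, ?_⟩
    · simp only [NExp.Fits, NExp.eval, State.setR_nvar]; omega
    · simp [hf.rvar, hr, RExp.eval, NExp.eval, e3]
    · simp [NExp.eval, e3]; omega
    · simp [NExp.eval, e3]; omega
    · simp [NExp.eval, e3]; linarith
    · exact Or.inr (by omega)
    · simp [e14, h0]
    · simp [e14, h0]
    · simp [NExp.eval, e3]; omega
  · simp [Prog.maxTime, BExp.time, NExp.time, RExp.time, base, idxE]

/-- The widths double and cost O(b²) each, so the last attempt dominates. Since `X` is at least
twice the square of every width that occurs, it pays for the whole geometric series. -/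
theorem search_run (hC : Ctx M I μ ν) (hw : Normalized I.w)
    (hμ : ∀ i < I.F.length, IsMate I.F i (μ i)) (hν : ∀ i < I.G.length, IsMate I.G i (ν i))
    (he : Env I μ ν s) (hk : 1 / 2 ≤ ted I.w I.F I.G) {U X : ℕ}
    (hU : ∀ b, 1 ≤ b → roundTime I.F.length b + 100 ≤ U * b ^ 2)
    (hX : ∀ b : ℕ, (b : ℝ) ≤ 4 * ted I.w I.F I.G → (b = 2 ∨ 2 < I.F.length + I.G.length) →
      2 * b ^ 2 ≤ X) :
    Run M I search s (U * X + 20) fun s' => s'.rvar 0 = ted I.w I.F I.G := by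
  have hM := hC.lin
  refine (Run.seq (T' := U * X + 4) (Run.of_wp
    (P := .seq (.setN 3 (.const 2)) (.seq (.setR 1 (.add .one .one)) (.setN 14 (.const 0))))
    ⟨?_, ⟨trivial, trivial⟩, ?_, (Run.loop (Searching I μ ν)
      (fun s => U * ((1 - s.nvar 14) * (X - s.nvar 3 ^ 2))) ?_ ?_
      ⟨?_, ?_, ?_, ?_, ?_, ?_, ?_, ?_⟩).mono ?_ ?_⟩)).mono ?_ fun _ => id
  · simp only [NExp.Fits]; omega
  · simp only [NExp.Fits]; omega
  · intro s hs
    have := hs.done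
    simp only [BExp.Fits, NExp.Fits]; omega
  · intro s hs hg
    simp only [BExp.Holds, NExp.eval] at hg
    refine ⟨_, (attempt_run hC hw hμ hν hs hg).mono le_rfl fun s' hs' => ⟨hs'.1, ?_⟩⟩
    have u := hU (s.nvar 3) (by linarith [hs.two_le])
    have x := hX _ hs.le_ted hs.small
    -- After a rejection the new width is 2b, and the potential falls by 4b² - b² ≥ b²; after
    -- acceptance it falls from X - b² ≥ b² to zero.
    have hsum : s.nvar 3 ^ 2 + (1 - s'.nvar 14) * (X - s'.nvar 3 ^ 2) ≤ X - s.nvar 3 ^ 2 := by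
      have x' := hX _ hs'.1.le_ted hs'.1.small
      have := hs'.1.done
      by_cases hd : s'.nvar 14 = 0
      · rw [hs'.2 hd] at x' ⊢
        rw [hd, mul_pow] at *
        omega
      · rw [show 1 - s'.nvar 14 = 0 by omega, zero_mul]
        omega
    have := Nat.mul_le_mul_left U hsum
    rw [mul_add] at this
    rw [hg, Nat.sub_zero, one_mul]
    simp only [BExp.time, NExp.time]
    omega
  · exact ⟨he.mateF, he.mateG, he.del, he.ins⟩
  · simp [NExp.eval, RExp.eval]; norm_num
  · simp [NExp.eval]
  · simp [NExp.eval]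
  · simp [NExp.eval]; linarith
  · simp [NExp.eval]
  · simp [NExp.eval]
  · simp [NExp.eval]
  · simp only [BExp.time, NExp.time]
    refine Nat.add_le_add_right (Nat.mul_le_mul_left U ?_) 4
    simp [NExp.eval]
  · rintro s' ⟨hs', hg⟩
    have := hs'.done
    simp only [BExp.Holds, NExp.eval] at hg
    exact hs'.result (by omega)
  · simp [Prog.maxTime, NExp.time, RExp.time]; omega

theorem main_run (hF : IsForest I.F) (hG : IsForest I.G) (hw : Normalized I.w)
    (hlin : 100 * (I.F.length + I.G.length + 2) ≤ M)
    (hquart : (I.F.length + I.G.length + 1) ^ 4 ≤ M) {U X : ℕ}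
    (hU : ∀ b, 1 ≤ b → roundTime I.F.length b + 100 ≤ U * b ^ 2)
    (hX : ∀ b : ℕ, (b : ℝ) ≤ 4 * ted I.w I.F I.G → (b = 2 ∨ 2 < I.F.length + I.G.length) →
      2 * b ^ 2 ≤ X) :
    Run M I main .init (U * X + 500 * (I.F.length + I.G.length + 1)) fun s' =>
      s'.rvar 0 = ted I.w I.F I.G := by
  have hopen : ∀ (Y : List (Paren α)) (s : State), s.nvar 0 < M → openAt Y (s.nvar 0) < M :=
    fun Y s _ => (openAt_le_one _ _).trans_lt (by omega)
  refine (Run.seq (T' := U * X + 300 * (I.F.length + I.G.length + 1))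
    ((eqTest_run hlin).mono le_rfl fun s₁ hs₁ => ?_)).mono (by omega) fun _ => id
  obtain ⟨h1, ⟨h2, hsame⟩ | ⟨h2, hne⟩⟩ := hs₁
  · refine (Run.iteTrue ?_ ?_ (Run.of_wp (P := .setR 0 .zero) ⟨trivial, ?_⟩)).mono ?_ fun _ => id
    · simp only [BExp.Fits, NExp.Fits]; omega
    · simpa [BExp.Holds, NExp.eval] using h2
    · have hμ := (hF.run I.F [] [] (by simp) ⟨0, fun _ => 0, fun _ => 0⟩).2.2.2
      simp only [State.setR_rvar, if_true, RExp.eval]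
      exact (ted_eq_zero_of_same hw (fun i hi => hμ i (Nat.zero_le _) (by simpa using hi))
        hsame).symm
    · simp only [BExp.time, NExp.time, Prog.maxTime, RExp.time]; omega
  · have z1 : s₁.narr = fun _ _ => 0 := h1
    have hm1 : I.F.length + 2 < M := by omega
    have hm2 : I.G.length + 2 < M := by omega
    have l1 : ∀ s, NExp.lenF.Fits M I s ∧ NExp.lenF.eval I s = I.F.length :=
      fun s => ⟨by simp only [NExp.Fits]; omega, rfl⟩
    have l2 : ∀ s, NExp.lenG.Fits M I s ∧ NExp.lenG.eval I s = I.G.length :=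
      fun s => ⟨by simp only [NExp.Fits]; omega, rfl⟩
    refine (Run.iteFalse ?_ ?_ (Run.seq
      ((mates_run (a := 0) (st := 2) (op := .openF) I.F hF (by decide) hm1 l1
        (fun s => ⟨rfl, fun h => ⟨h, hopen _ s h⟩⟩) rfl rfl ?_ ?_).mono le_rfl
      fun s₂ hs₂ => Run.seq
      ((mates_run (a := 1) (st := 3) (op := .openG) I.G hG (by decide) hm2 l2
        (fun s => ⟨rfl, fun h => ⟨h, hopen _ s h⟩⟩) rfl rfl ?_ ?_).mono le_rfl
      fun s₃ hs₃ => Run.seq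
      ((sums_run (a := 1) (p := .labF counter) (q := .eps) (f := fun i => I.w (labelAt I.F i) none)
        hm1 l1 (fun s => ⟨rfl, fun h => ⟨h, trivial⟩⟩) rfl rfl).mono le_rfl
      fun s₄ hs₄ => Run.seq (T' := U * X + 20)
      ((sums_run (a := 2) (p := .eps) (q := .labG counter) (f := fun i => I.w none (labelAt I.G i))
        hm2 l2 (fun s => ⟨rfl, fun h => ⟨trivial, h⟩⟩) rfl rfl).mono le_rfl
      fun s₅ hs₅ => ?_)))))).mono ?_ fun _ => id
    · simp only [BExp.Fits, NExp.Fits]; omega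
    · simp only [BExp.Holds, NExp.eval]; omega
    · rw [z1]
    · rw [z1]
    · rw [hs₂.2.2 1 (by decide) (by decide), z1]
    · rw [hs₂.2.2 3 (by decide) (by decide), z1]
    · have e : s₅.narr = s₃.narr := hs₅.2.2.trans hs₄.2.2
      have e0 : s₃.narr 0 = s₂.narr 0 := hs₃.2.2 0 (by decide) (by decide)
      refine search_run (μ := s₂.narr 0) (ν := s₃.narr 1) ⟨isNest_of_isMate hs₂.1,
        isNest_of_isMate hs₃.1, hs₂.2.1, hs₃.2.1, hlin, hquart⟩ hw hs₂.1 hs₃.1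
        ⟨fun x => by rw [e, e0], fun x => by rw [e], fun x hx => ?_, hs₅.1⟩
        (half_le_ted_of_not_same hw hs₂.1 hs₃.1 hne) hU hX
      rw [hs₅.2.1 1 (by decide)]
      exact hs₄.1 x hx
    · simp only [BExp.time, NExp.time]; omega

end Search

end TED

namespace TED

open Alg

/-! ### Numerical bounds for the running time -/

section RunningTime

theorem rowTime_le {b : ℕ} (hb : 1 ≤ b) (T : ℕ) : rowTime T b ≤ (9 * T + 380) * b ^ 2 := by
  have h1 : (2 * b + 1) * ((2 * b + 1) * (T + 20) + 60) ≤
      (3 * b) * ((3 * b) * (T + 20) + 60 * b) := by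
    gcongr <;> omega
  have h2 : 1 ≤ b ^ 2 := Nat.one_le_pow _ _ hb
  have e1 : (3 * b) * ((3 * b) * (T + 20) + 60 * b) = (9 * T + 360) * b ^ 2 := by ring
  have e2 : (9 * T + 380) * b ^ 2 = (9 * T + 360) * b ^ 2 + 20 * b ^ 2 := by ring
  unfold rowTime
  omega

/-- `K` depends only on the running times of the two fixed cell programs, hence it is absolute. -/
theorem exists_roundTime_le : ∃ K, ∀ N b, 1 ≤ b →
    roundTime N b + 100 ≤ (Nat.log 2 (2 * N + 2) + 1) * (N + 1) * K * b ^ 2 := by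
  obtain ⟨T, hT⟩ : ∃ T, T = leftCell.maxTime + rightCell.maxTime := ⟨_, rfl⟩
  obtain ⟨K, hK⟩ : ∃ K, K = 18 * T + 1180 := ⟨_, rfl⟩
  have hl : ∀ b, 1 ≤ b → levelUnit b ≤ K * b ^ 2 := by
    intro b hb
    have h1 := rowTime_le hb T
    have h2 : 1 ≤ b ^ 2 := Nat.one_le_pow _ _ hb
    have e : K * b ^ 2 = 2 * ((9 * T + 380) * b ^ 2) + 420 * b ^ 2 := by rw [hK]; ring
    rw [levelUnit, anyRowTime, ← hT]
    omega
  refine ⟨3 * K + 180, fun N b hb => ?_⟩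
  have h2 : 1 ≤ b ^ 2 := Nat.one_le_pow _ _ hb
  have h3 : (3 * N + 2) * levelUnit b + 60 ≤ (N + 1) * (3 * K + 60) * b ^ 2 := by
    calc (3 * N + 2) * levelUnit b + 60
        ≤ (3 * (N + 1)) * (K * b ^ 2) + 60 * ((N + 1) * b ^ 2) := by
          gcongr
          · omega
          · exact hl b hb
          · nlinarith
      _ = _ := by ring
  unfold roundTime
  generalize Nat.log 2 (2 * N + 2) = l
  have h4 : 1 ≤ (l + 1) * (N + 1) * b ^ 2 :=
    Nat.mul_pos (Nat.mul_pos (Nat.succ_pos _) (Nat.succ_pos _)) h2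
  calc (l + 1) * ((3 * N + 2) * levelUnit b + 60) + 20 + 100
      ≤ (l + 1) * ((N + 1) * (3 * K + 60) * b ^ 2) + 120 * ((l + 1) * (N + 1) * b ^ 2) := by
        have := Nat.mul_le_mul_left (l + 1) h3
        omega
    _ = _ := by ring

theorem natLog_le (n : ℕ) : (Nat.log 2 n : ℝ) ≤ 2 * Real.log n := by
  rcases Nat.eq_zero_or_pos n with rfl | hn
  · simp
  have h1 : (Nat.log 2 n : ℝ) ≤ Real.logb 2 n := by
    simpa using Real.natLog_le_logb n 2
  have h2 : Real.logb 2 n * Real.log 2 = Real.log n := by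
    rw [Real.logb, div_mul_cancel₀ _ (Real.log_pos (by norm_num)).ne']
  have h3 : (1 / 2 : ℝ) ≤ Real.log 2 := by linarith [Real.log_two_gt_d9]
  have h4 : (0 : ℝ) ≤ Real.logb 2 n := (Nat.cast_nonneg _).trans h1
  nlinarith

/-- Here 2N + 2 ≤ 8n, and log₂ n ≥ 1 absorbs the additive constants; this is where `2 ≤ n` is
needed. -/
theorem log_size_le {n N : ℕ} (hn : 2 ≤ n) (hN : N ≤ 2 * n) :
    Nat.log 2 (2 * N + 2) + 1 ≤ 5 * Nat.log 2 n := by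
  have h1 : Nat.log 2 (2 * N + 2) ≤ Nat.log 2 (n * 2 * 2 * 2) := Nat.log_mono_right (by omega)
  rw [Nat.log_mul_base (by omega) (by omega), Nat.log_mul_base (by omega) (by omega),
    Nat.log_mul_base (by omega) (by omega)] at h1
  have h2 : 1 ≤ Nat.log 2 n := Nat.log_pos (by omega) hn
  omega

theorem total_time_le {n N K : ℕ} {k : ℝ} (hn : 2 ≤ n) (hN : N ≤ 2 * n) :
    (((Nat.log 2 (2 * N + 2) + 1) * (N + 1) * K * (2 * ⌊16 * k ^ 2⌋₊) + 500 * (2 * n + 1) : ℕ) : ℝ)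
      ≤ (1000 * K + 1500 : ℝ) * (n * k ^ 2 * Real.log n + n + 1) := by
  have h1 : ((Nat.log 2 (2 * N + 2) + 1 : ℕ) : ℝ) ≤ 10 * Real.log n := by
    have : ((Nat.log 2 (2 * N + 2) + 1 : ℕ) : ℝ) ≤ 5 * Nat.log 2 n := by
      exact_mod_cast log_size_le hn hN
    linarith [natLog_le n]
  have h2 : ((N + 1 : ℕ) : ℝ) ≤ 3 * n := by
    exact_mod_cast (by omega : N + 1 ≤ 3 * n)
  have h3 : ((2 * ⌊16 * k ^ 2⌋₊ : ℕ) : ℝ) ≤ 32 * k ^ 2 := by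
    push_cast
    linarith [Nat.floor_le (show 0 ≤ 16 * k ^ 2 by positivity)]
  have h0 : 0 ≤ Real.log n := Real.log_natCast_nonneg n
  have h4 : (0 : ℝ) ≤ n * k ^ 2 * Real.log n := by positivity
  have hK : (0 : ℝ) ≤ K := Nat.cast_nonneg K
  have hnn : (0 : ℝ) ≤ n := Nat.cast_nonneg n
  rw [Nat.cast_add, Nat.cast_mul, Nat.cast_mul _ K, Nat.cast_mul (Nat.log _ _ + 1)]
  calc _ ≤ 10 * Real.log n * (3 * n) * K * (32 * k ^ 2) + ((500 * (2 * n + 1) : ℕ) : ℝ) := by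
        gcongr
    _ = 960 * (K * (n * k ^ 2 * Real.log n)) + (1000 * n + 500) := by push_cast; ring
    _ ≤ _ := by nlinarith [mul_nonneg hK h4, mul_nonneg hK hnn]

/-- For `n ≤ 1` the logarithm gives nothing, so the additive term must carry the whole cost. The
width stays 2 in this case, and 8 = 2 · 2² takes the place of the budget `X`. -/
theorem total_time_le_of_small {n N K : ℕ} {y : ℝ} (hn : n ≤ 1) (hN : N ≤ 2 * n) (hy : 0 ≤ y) :
    (((Nat.log 2 (2 * N + 2) + 1) * (N + 1) * K * 8 + 500 * (2 * n + 1) : ℕ) : ℝ)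
      ≤ (1000 * K + 1500 : ℝ) * (y + n + 1) := by
  have h1 : (Nat.log 2 (2 * N + 2) + 1) * (N + 1) * K ≤ 9 * K := by
    refine Nat.mul_le_mul_right K ?_
    have hl : Nat.log 2 (2 * N + 2) < 3 := Nat.log_lt_of_lt_pow (by omega) (by omega)
    calc _ ≤ 3 * 3 := Nat.mul_le_mul (by omega) (by omega)
      _ = 9 := rfl
  calc _ ≤ ((1000 * K + 1500 : ℕ) : ℝ) := by
        exact_mod_cast (by omega)
    _ = (1000 * K + 1500 : ℝ) * 1 := by push_cast; ring
    _ ≤ _ := by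
        gcongr
        linarith [(Nat.cast_nonneg n : (0 : ℝ) ≤ n)]

end RunningTime

end TED

theorem theorem2 :
    ∃ (P : TED.Prog) (c : ℕ) (C : ℝ),
      ∀ (α : Type u) (F G : List (TED.Paren α)) (w : TED.Weight α) (n : ℕ) (k : ℝ),
        TED.IsForest F → TED.IsForest G → TED.Normalized w →
        n = TED.numNodes F + TED.numNodes G → k = TED.ted w F G →
        ∃ (s : TED.State) (t : ℕ),
          TED.Exec ((n + 2) ^ c) ⟨F, G, w⟩ P TED.State.init s t ∧
          s.rvar 0 = k ∧
          (t : ℝ) ≤ C * (n * k ^ 2 * Real.log n + n + 1) := by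
  obtain ⟨K, hK⟩ := TED.exists_roundTime_le
  -- The exponent 9 suffices because (2n + 1)⁴ ≤ (n + 2)⁸ for the table addresses and 200(n + 1) ≤
  -- 2⁸(n + 2) for the linear quantities.
  refine ⟨TED.Alg.main, 9, 1000 * K + 1500, fun α F G w n k hF hG hw hn hk => ?_⟩
  have lF := hF.length
  have lG := hG.length
  have hN : F.length ≤ 2 * n := by omega
  have hZ : F.length + G.length = 2 * n := by omega
  have hlin : 100 * (F.length + G.length + 2) ≤ (n + 2) ^ 9 := by
    have : 2 ^ 8 ≤ (n + 2) ^ 8 := Nat.pow_le_pow_left (by omega) 8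
    have := Nat.mul_le_mul_right (n + 2) this
    rw [← pow_succ, show 8 + 1 = 9 from rfl] at this
    omega
  have hquart : (F.length + G.length + 1) ^ 4 ≤ (n + 2) ^ 9 := by
    have h1 : F.length + G.length + 1 ≤ (n + 2) ^ 2 := by
      rw [hZ, show (n + 2) ^ 2 = n * n + 4 * n + 4 by ring]
      omega
    have h2 := Nat.pow_le_pow_left h1 4
    rw [← pow_mul] at h2
    exact h2.trans (Nat.pow_le_pow_right (by omega) (by omega))
  -- Widths are at most 4k, so twice their square is at most twice the floor of 16k². For `n ≤ 1`
  -- only the width 2 occurs, as the band then covers the whole grid.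
  obtain ⟨X, hX⟩ : ∃ X, X = if n ≤ 1 then 8 else 2 * ⌊16 * k ^ 2⌋₊ := ⟨_, rfl⟩
  obtain ⟨s, t, hrun, ht, hs⟩ := TED.main_run (I := ⟨F, G, w⟩) (X := X) hF hG hw hlin hquart
    (hK F.length) fun b hb hsm => by
      rw [← hk] at hb
      by_cases h1 : n ≤ 1
      · rw [hX, if_pos h1]
        obtain rfl : b = 2 := hsm.resolve_right (by change ¬ 2 < F.length + G.length; omega)
        norm_num
      · rw [hX, if_neg h1]
        refine Nat.mul_le_mul_left 2 (Nat.le_floor ?_)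
        calc ((b ^ 2 : ℕ) : ℝ) = (b : ℝ) ^ 2 := Nat.cast_pow b 2
          _ ≤ (4 * k) ^ 2 := pow_le_pow_left₀ (Nat.cast_nonneg b) hb 2
          _ = 16 * k ^ 2 := by ring
  refine ⟨s, t, hrun, hs.trans hk.symm, (Nat.cast_le.2 ht).trans ?_⟩
  change (((Nat.log 2 (2 * F.length + 2) + 1) * (F.length + 1) * K * X +
    500 * (F.length + G.length + 1) : ℕ) : ℝ) ≤ _
  rw [hZ, hX]
  split_ifs with h1
  · have hy : 0 ≤ n * k ^ 2 * Real.log n :=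
      mul_nonneg (by positivity) (Real.log_natCast_nonneg n)
    exact TED.total_time_le_of_small h1 hN hy
  · exact TED.total_time_le (by omega) hN
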